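/- **Setting.** Two provers $A$ (Alice) and $B$ (Bob), with complex Hilbert spaces $\mathcal H_A,\mathcal H_B$ (and an external Hilbert space $\mathcal H_C$), play $n$ CHSH games in sequence. In game $j$ independent uniform questions $a_j,b_j\in\{0,1\}$ are asked and answers $x_j,y_j\in\{0,1\}$ are given. Write $h^A_j=(a_i,x_i)_{i\le j}$, $h^B_j=(b_i,y_i)_{i\le j}$ for the local transcripts and $h_j=(h^A_j,h^B_j)$. A *strategy* $\mathcal S$ consists of a unit vector $|\psi\rangle\in\mathcal H_A\otimes\mathcal H_B\otimes\mathcal H_C$ and, for every prover $D\in\{A,B\}$, game $j$, local transcript $h^D_{j-1}$ and question $\alpha$, a reflection $R^D_{j,\alpha}(h^D_{j-1})$ on $\mathcal H_D$ (self-adjoint, with square $1$). Put $P^A_j(h^A_j)=\frac12\big(1+(-1)^{x_j}R^A_{j,a_j}(h^A_{j-1})\big)$, and likewise $P^B_j(h^B_j)$ with $b_j,y_j$. Let $P^D_{1,j}=P^D_j\cdots P^D_1$. The transcript $H_j$ of the first $j$ games takes the value $h_j$ with probability $4^{-j}\|(P^A_{1,j}(h^A_j)\otimes P^B_{1,j}(h^B_j))\psi\|^2$,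 and $|\psi_{j}(h_{j-1})\rangle$ denotes the normalized vector $(P^A_{1,j-1}\otimes P^B_{1,j-1})\psi$ (and $0$ if this vector vanishes). Game $(j,h_{j-1})$ is *$\epsilon$-structured* if $\sum_{a,b\in\{0,1\}}(-1)^{ab}\langle\psi_j(h_{j-1})|R^A_{j,a}(h^A_{j-1})\otimes R^B_{j,b}(h^B_{j-1})|\psi_j(h_{j-1})\rangle\ge 2\sqrt2-\epsilon$. The strategy is *$(\delta,\epsilon)$-structured* if for every $j\in\{1,\dots,n\}$, $\Pr[\text{game }(j,H_{j-1})\text{ is }\epsilon\text{-structured}]\ge1-\delta$. *Simulation.* Let $\rho_1=|\psi\rangle\langle\psi|$ and $$\mathcal E^D_{1,j}(\rho_1)=2^{-j}\sum_{h^D_j}|h^D_j\rangle\langle h^D_j|\otimes P^D_{1,j}(h^D_j)\,\rho_1\,P^D_{1,j}(h^D_j)^\dagger ,$$ with $\mathcal E^D_{1,0}(\rho_1)=\rho_1$. For two strategies $\mathcal S,\tilde{\mathcal S}$ on the same Hilbert spaces, $\tilde{\mathcal S}$ *$\eta$-simulates* $\mathcal S$ if $\|\mathcal E^D_{1,j}(\rho_1)-\tilde{\mathcal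 E}^D_{1,j}(\tilde\rho_1)\|_{\mathrm{tr}}\le\eta$ for $D\in\{A,B\}$ and all $0\le j\le n$, where $\|T\|_{\mathrm{tr}}=\mathrm{tr}\sqrt{T^\dagger T}$. *Ideal strategies.* Let $|\psi^*\rangle=\frac1{\sqrt2}(|00\rangle+|11\rangle)$. Let $|(0,x)_A\rangle=|x\rangle$, $|(1,x)_A\rangle=\frac1{\sqrt2}(|0\rangle+(-1)^x|1\rangle)$, $|(b,0)_B\rangle=\cos\frac\pi8|0\rangle+(-1)^b\sin\frac\pi8|1\rangle$, $|(b,1)_B\rangle=\sin\frac\pi8|0\rangle-(-1)^b\cos\frac\pi8|1\rangle$, and $R^D_\alpha=|(\alpha,0)_D\rangle\langle(\alpha,0)_D|-|(\alpha,1)_D\rangle\langle(\alpha,1)_D|$; write $(R^D_\alpha)_j$ for $R^D_\alpha$ acting on the $j$th qubit. A strategy is *ideal* via isometries $\mathcal I^D:\mathcal H_D\to(\mathbb C^2)^{\otimes n}\otimes\mathcal H'_D$ if $(\mathcal I^A\otimes\mathcal I^B)|\psi\rangle=|\psi^*\rangle^{\otimes n}\otimes|\psi'\rangle$ for some unit vector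 $\psi'\in\mathcal H'_A\otimes\mathcal H'_B\otimes\mathcal H_C$ and $R^D_{j,\alpha}(h^D_{j-1})=\mathcal I^{D\dagger}(R^D_\alpha)_j\,\mathcal I^D$ for all $D,j,\alpha,h^D_{j-1}$. A strategy is *multi-qubit ideal* if there are Hilbert spaces $\mathcal H'_D$, unitary isomorphisms $\mathcal Y^D:\mathcal H_D\to(\mathbb C^2)^{\otimes n}\otimes\mathcal H_D'$ and unitaries $U^D_j(h^D_{j-1})$ on $(\mathbb C^2)^{\otimes(n-j+1)}\otimes\mathcal H'_D$ (acting on qubits $j,\dots,n$ and $\mathcal H_D'$) such that, with $$M^D_j(h^D_{j-1})=\big(1_{(\mathbb C^2)^{\otimes(j-1)}}\otimes U^D_j(h^D_{j-1})\big)\cdots\big(1_{\mathbb C^2}\otimes U^D_2(h^D_1)\big)\,U^D_1\,\mathcal Y^D ,$$ one has $R^D_{j,\alpha}(h^D_{j-1})=M^D_j(h^D_{j-1})^\dagger(R^D_\alpha)_jM^D_j(h^D_{j-1})$ for all $D,j,\alpha,h^D_{j-1}$. **Theorem.** There is a constant $\kappa>0$ such that for all $n$, all $\delta,\epsilon\ge0$,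 and every $(\delta,\epsilon)$-structured multi-qubit ideal strategy $\mathcal S$ for $n$ sequential CHSH games, with data $\mathcal Y^D,U^D_j$ as above, there is a transcript $\hat h_n=(\hat h^A_n,\hat h^B_n)$ such that $\mathcal S$ is $\kappa n^\kappa(\delta+\epsilon)^{1/\kappa}$-simulated by a strategy $\hat{\mathcal S}$ on the same Hilbert spaces that is ideal via the fixed unitaries $$\hat{\mathcal I}^D=\big(1_{(\mathbb C^2)^{\otimes(n-1)}}\otimes U^D_n(\hat h^D_{n-1})\big)\cdots U^D_1\,\mathcal Y^D\qquad(D\in\{A,B\}).$$ In other words, the qubit locations can be taken independent of the observed transcript. -/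

import Mathlib

open scoped TensorProduct

universe u₁ u₂ u₃ u₄ u₅

namespace CHSH

noncomputable section

/-! ### Hilbert space preliminaries -/

section Hilbert

variable (A : Type u₁) (B : Type u₂) (C : Type u₃)
  [NormedAddCommGroup A] [InnerProductSpace ℂ A]
  [NormedAddCommGroup B] [InnerProductSpace ℂ B]
  [NormedAddCommGroup C] [InnerProductSpace ℂ C]

/-- The Hilbert space tensor product `A ⊗ B ⊗ C` (the completed algebraic tensor product). -/
def Hilb3 : Type (max u₁ u₂ u₃) := UniformSpace.Completion (A ⊗[ℂ] B ⊗[ℂ] C)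

instance : NormedAddCommGroup (Hilb3 A B C) :=
  inferInstanceAs (NormedAddCommGroup (UniformSpace.Completion (A ⊗[ℂ] B ⊗[ℂ] C)))

instance : InnerProductSpace ℂ (Hilb3 A B C) :=
  inferInstanceAs (InnerProductSpace ℂ (UniformSpace.Completion (A ⊗[ℂ] B ⊗[ℂ] C)))

instance : CompleteSpace (Hilb3 A B C) :=
  inferInstanceAs (CompleteSpace (UniformSpace.Completion (A ⊗[ℂ] B ⊗[ℂ] C)))

variable {A B C}
variable {A' : Type u₄} {B' : Type u₅}
  [NormedAddCommGroup A'] [InnerProductSpace ℂ A']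
  [NormedAddCommGroup B'] [InnerProductSpace ℂ B']

/-- `f ⊗ g ⊗ 1_C`, for bounded operators `f` and `g`. -/
def map3 (C : Type u₃) [NormedAddCommGroup C] [InnerProductSpace ℂ C]
    (f : A →L[ℂ] A') (g : B →L[ℂ] B') : Hilb3 A B C →L[ℂ] Hilb3 A' B' C :=
  (TensorProduct.mapL (TensorProduct.mapL f g) (ContinuousLinearMap.id ℂ C)).completion

end Hilbert

/-- The trace norm `‖T‖_tr = tr √(T† T)`, with values in `[0, ∞]`. The trace of the positive
operator `√(T† T)` is the supremum of its diagonal sums over finite orthonormal families. -/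
def traceNorm {H : Type*} [NormedAddCommGroup H] [InnerProductSpace ℂ H] [CompleteSpace H]
    (T : H →L[ℂ] H) : ENNReal :=
  ⨆ (m : ℕ) (e : Fin m → H) (_ : Orthonormal ℂ e),
    ∑ i, ENNReal.ofReal (inner ℂ (e i) (CFC.abs T (e i))).re

/-- For a finite set `X` of classical values and a family `σ` of operators on `H`, the operator
`∑ x, |x⟩⟨x| ⊗ σ x` on `ℂ^X ⊗ H`. -/
def blockDiag {X : Type*} [Fintype X] {H : Type*} [NormedAddCommGroup H] [InnerProductSpace ℂ H]
    (σ : X → (H →L[ℂ] H)) : PiLp 2 (fun _ : X => H) →L[ℂ] PiLp 2 (fun _ : X => H) :=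
  (PiLp.continuousLinearEquiv 2 ℂ (fun _ : X => H)).symm.toContinuousLinearMap ∘L
    ContinuousLinearMap.pi fun x => σ x ∘L PiLp.proj 2 (fun _ : X => H) x

/-! ### Qubit registers -/

section Qubits

variable {ι : Type} [Fintype ι] {K : Type*} [NormedAddCommGroup K] [InnerProductSpace ℂ K]

/-- `(ℂ²)^{⊗ ι} ⊗ K`: the vector `∑ x, |x⟩ ⊗ v x` is the family `v`. -/
abbrev Reg (ι : Type) [Fintype ι] [DecidableEq ι] (K : Type*) [NormedAddCommGroup K]
    [InnerProductSpace ℂ K] :=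
  PiLp 2 (fun _ : ι → Bool => K)

variable [DecidableEq ι]

/-- The isometry `v ↦ |x⟩ ⊗ v`. -/
def ketL (K : Type*) [NormedAddCommGroup K] [InnerProductSpace ℂ K] (x : ι → Bool) :
    K →L[ℂ] Reg ι K :=
  (PiLp.continuousLinearEquiv 2 ℂ (fun _ : ι → Bool => K)).symm.toContinuousLinearMap ∘L
    ContinuousLinearMap.pi fun y => if y = x then ContinuousLinearMap.id ℂ K else 0

/-- The single-qubit operator `G` acting on qubit `j`. -/
def onQubit (K : Type*) [NormedAddCommGroup K] [InnerProductSpace ℂ K]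
    (j : ι) (G : Matrix Bool Bool ℂ) : Reg ι K →L[ℂ] Reg ι K :=
  (PiLp.continuousLinearEquiv 2 ℂ (fun _ : ι → Bool => K)).symm.toContinuousLinearMap ∘L
    ContinuousLinearMap.pi fun x =>
      ∑ c : Bool, G (x j) c • PiLp.proj 2 (fun _ : ι → Bool => K) (Function.update x j c)

end Qubits

/-- The bit string that agrees with `x` before position `j` and with `y` from position `j` on. -/
def glue {n : ℕ} (j : Fin n) (x : Fin n → Bool) (y : {i : Fin n // j ≤ i} → Bool) :
    Fin n → Bool :=
  fun i => if h : j ≤ i then y ⟨i, h⟩ else x i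

/-- `1 ⊗ U` on `(ℂ²)^{⊗ n} ⊗ K`, where `U` acts on the qubits `j, j + 1, …` and on `K`, and the
identity is on the qubits before `j`. -/
def onLast {n : ℕ} {K : Type*} [NormedAddCommGroup K] [InnerProductSpace ℂ K] (j : Fin n)
    (U : Reg {i : Fin n // j ≤ i} K →L[ℂ] Reg {i : Fin n // j ≤ i} K) :
    Reg (Fin n) K →L[ℂ] Reg (Fin n) K :=
  (PiLp.continuousLinearEquiv 2 ℂ (fun _ : Fin n → Bool => K)).symm.toContinuousLinearMap ∘L
    ContinuousLinearMap.pi fun x =>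
      PiLp.proj 2 (fun _ : {i : Fin n // j ≤ i} → Bool => K) (fun i => x i) ∘L U ∘L
        (PiLp.continuousLinearEquiv 2 ℂ
          (fun _ : {i : Fin n // j ≤ i} → Bool => K)).symm.toContinuousLinearMap ∘L
        ContinuousLinearMap.pi fun y =>
          PiLp.proj 2 (fun _ : Fin n → Bool => K) (glue j x y)

/-! ### The ideal CHSH game -/

/-- The coefficients of `|ψ*⟩ = (|00⟩ + |11⟩) / √2`. -/
def epr (x y : Bool) : ℂ := if x = y then ((1 / √2 : ℝ) : ℂ) else 0

/-- The sign `(-1)^b`. -/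
def sgn (b : Bool) : ℝ := if b then -1 else 1

/-- Alice's measurement basis: `ketA a x` is `|(a, x)_A⟩`. -/
def ketA (a x : Bool) : Bool → ℂ := fun c =>
  if a then (if c then ((sgn x / √2 : ℝ) : ℂ) else ((1 / √2 : ℝ) : ℂ))
  else (if c = x then 1 else 0)

/-- Bob's measurement basis: `ketB b y` is `|(b, y)_B⟩`. -/
def ketB (b y : Bool) : Bool → ℂ := fun c =>
  if y then
    (if c then ((-(sgn b * Real.cos (Real.pi / 8)) : ℝ) : ℂ)
      else ((Real.sin (Real.pi / 8) : ℝ) : ℂ))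
  else
    (if c then ((sgn b * Real.sin (Real.pi / 8) : ℝ) : ℂ)
      else ((Real.cos (Real.pi / 8) : ℝ) : ℂ))

/-- The reflection `|v₀⟩⟨v₀| - |v₁⟩⟨v₁|`. -/
def reflOf (v : Bool → Bool → ℂ) : Matrix Bool Bool ℂ :=
  Matrix.vecMulVec (v false) (star (v false)) - Matrix.vecMulVec (v true) (star (v true))

/-- Alice's ideal reflections. -/
def idealA (a : Bool) : Matrix Bool Bool ℂ := reflOf (ketA a)

/-- Bob's ideal reflections. -/
def idealB (b : Bool) : Matrix Bool Bool ℂ := reflOf (ketB b)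

/-! ### Strategies for sequential CHSH games -/

/-- A local transcript of `k` games: the question asked and the answer given in each game. -/
abbrev Hist (k : ℕ) := Fin k → Bool × Bool

/-- One prover's reflections for `n` sequential games: in game `j`, after the local transcript `h`
of the previous games, the question `a` is answered by measuring `R j h a`. -/
structure Reflections (n : ℕ) (H : Type*) [NormedAddCommGroup H] [InnerProductSpace ℂ H]
    [CompleteSpace H] where
  R : (j : Fin n) → Hist j → Bool → (H →L[ℂ] H)
  selfAdjoint : ∀ j h a, IsSelfAdjoint (R j h a)
  mul_self : ∀ j h a, R j h a * R j h a = 1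

namespace Reflections

variable {n : ℕ} {H : Type*} [NormedAddCommGroup H] [InnerProductSpace ℂ H] [CompleteSpace H]

/-- The projection `½ (1 + (-1)^x R)` for game `j`, where the transcript `h` ends with the question
and the answer `x` of game `j`. -/
def proj (S : Reflections n H) (j : Fin n) (h : Hist (j + 1)) : H →L[ℂ] H :=
  (1 / 2 : ℂ) • (1 + ((sgn (h (Fin.last j)).2 : ℝ) : ℂ) •
    S.R j (Fin.init h) (h (Fin.last j)).1)

/-- The product `P_k ⋯ P_2 P_1` of the projections along a transcript of `k` games. -/
def seqProj (S : Reflections n H) : (k : ℕ) → k ≤ n → Hist k → (H →L[ℂ] H)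
  | 0, _, _ => 1
  | k + 1, hk, h => S.proj ⟨k, hk⟩ h * S.seqProj k (Nat.le_of_succ_le hk) (Fin.init h)

end Reflections

/-- A strategy of two provers, with Hilbert spaces `HA` and `HB`, for `n` sequential CHSH games;
`HC` is an external space. -/
structure Strategy (n : ℕ) (HA : Type u₁) (HB : Type u₂) (HC : Type u₃)
    [NormedAddCommGroup HA] [InnerProductSpace ℂ HA] [CompleteSpace HA]
    [NormedAddCommGroup HB] [InnerProductSpace ℂ HB] [CompleteSpace HB]
    [NormedAddCommGroup HC] [InnerProductSpace ℂ HC] where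
  ψ : Hilb3 HA HB HC
  norm_ψ : ‖ψ‖ = 1
  alice : Reflections n HA
  bob : Reflections n HB

/-- The unitary data of a multi-qubit ideal strategy for one prover: the isomorphism
`Y : H ≅ (ℂ²)^{⊗ n} ⊗ K`, and for each game `j` and local transcript of the earlier games a unitary
on the qubits from `j` on and `K`. -/
structure QubitFrame (n : ℕ) (H : Type*) (K : Type*)
    [NormedAddCommGroup H] [InnerProductSpace ℂ H]
    [NormedAddCommGroup K] [InnerProductSpace ℂ K] where
  Y : H ≃ₗᵢ[ℂ] Reg (Fin n) K
  U : (j : Fin n) → Hist j →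
    (Reg {i : Fin n // j ≤ i} K ≃ₗᵢ[ℂ] Reg {i : Fin n // j ≤ i} K)

namespace QubitFrame

variable {n : ℕ} {H : Type*} {K : Type*}
  [NormedAddCommGroup H] [InnerProductSpace ℂ H] [CompleteSpace H]
  [NormedAddCommGroup K] [InnerProductSpace ℂ K] [CompleteSpace K]

/-- The operator `1 ⊗ U_j(h)`, for `h` the local transcript of the games before `j`. -/
def step (F : QubitFrame n H K) (j : Fin n) (h : Hist j) : Reg (Fin n) K →L[ℂ] Reg (Fin n) K :=
  onLast j (F.U j h).toContinuousLinearEquiv.toContinuousLinearMap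

/-- The product `(1 ⊗ U_k(h_{k-1})) ⋯ (1 ⊗ U_2(h_1)) U_1 Y`, which determines the location of the
first `k` qubits along the local transcript `h` (its last game does not enter). -/
def location (F : QubitFrame n H K) : (k : ℕ) → k ≤ n → Hist k → (H →L[ℂ] Reg (Fin n) K)
  | 0, _, _ => F.Y.toContinuousLinearEquiv.toContinuousLinearMap
  | k + 1, hk, h =>
    F.step ⟨k, hk⟩ (Fin.init h) ∘L F.location k (Nat.le_of_succ_le hk) (Fin.init h)

/-- The reflections `S` use, in game `j` after the local transcript `h`, the ideal reflections `G`
on qubit `j` as located by the frame along `h`. -/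
def Describes (F : QubitFrame n H K) (G : Bool → Matrix Bool Bool ℂ)
    (S : Reflections n H) : Prop :=
  ∀ (j : Fin n) (h : Hist j) (a : Bool),
    S.R j h a =
      ContinuousLinearMap.adjoint (F.step j h ∘L F.location j j.isLt.le h) ∘L
        onQubit K j (G a) ∘L (F.step j h ∘L F.location j j.isLt.le h)

end QubitFrame

namespace Strategy

variable {n : ℕ} {HA : Type u₁} {HB : Type u₂} {HC : Type u₃}
  [NormedAddCommGroup HA] [InnerProductSpace ℂ HA] [CompleteSpace HA]
  [NormedAddCommGroup HB] [InnerProductSpace ℂ HB] [CompleteSpace HB]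
  [NormedAddCommGroup HC] [InnerProductSpace ℂ HC]

/-- The unnormalized state after `k` games with transcript `(hA, hB)`. -/
def unnormState (S : Strategy n HA HB HC) (k : ℕ) (hk : k ≤ n) (hA hB : Hist k) :
    Hilb3 HA HB HC :=
  map3 HC (S.alice.seqProj k hk hA) (S.bob.seqProj k hk hB) S.ψ

/-- The shared state after `k` games, conditioned on the transcript `(hA, hB)`; it is `0` if the
transcript has probability `0`. -/
def state (S : Strategy n HA HB HC) (k : ℕ) (hk : k ≤ n) (hA hB : Hist k) : Hilb3 HA HB HC :=
  ((‖S.unnormState k hk hA hB‖⁻¹ : ℝ) : ℂ) • S.unnormState k hk hA hB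

/-- The probability that the transcript of the first `k` games is `(hA, hB)`, when the questions
are independent and uniform. -/
def prob (S : Strategy n HA HB HC) (k : ℕ) (hk : k ≤ n) (hA hB : Hist k) : ℝ :=
  (1 / 4) ^ k * ‖S.unnormState k hk hA hB‖ ^ 2

/-- The CHSH correlation value `∑_{a,b} (-1)^{ab} ⟨R_a ⊗ R_b⟩` of game `j` after the transcript
`(hA, hB)` of the earlier games. -/
def correlation (S : Strategy n HA HB HC) (j : Fin n) (hA hB : Hist j) : ℝ :=
  ∑ a : Bool, ∑ b : Bool, sgn (a && b) *
    (inner ℂ (S.state j j.isLt.le hA hB)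
      (map3 HC (S.alice.R j hA a) (S.bob.R j hB b) (S.state j j.isLt.le hA hB))).re

open Classical in
/-- `(δ, ε)`-structured: for every `j`, with probability at least `1 - δ` over the transcript of the
earlier games, game `j` has correlation value at least `2 √2 - ε`. -/
def IsStructured (S : Strategy n HA HB HC) (δ ε : ℝ) : Prop :=
  ∀ j : Fin n, 1 - δ ≤
    ∑ hA : Hist j, ∑ hB : Hist j,
      if 2 * √2 - ε ≤ S.correlation j hA hB then S.prob j j.isLt.le hA hB else 0

/-- The family of blocks of `E^A_{1,k}(ρ₁)`, indexed by Alice's transcript: starting with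
`ρ₁ = |ψ⟩⟨ψ|`, game `k` sends `|h⟩⟨h| ⊗ ρ` to
`½ ∑_{a,x} |h,a,x⟩⟨h,a,x| ⊗ P_k(h,a,x) ρ P_k(h,a,x)`. -/
def playA (S : Strategy n HA HB HC) :
    (k : ℕ) → k ≤ n → Hist k → (Hilb3 HA HB HC →L[ℂ] Hilb3 HA HB HC)
  | 0, _, _ => InnerProductSpace.rankOne ℂ S.ψ S.ψ
  | k + 1, hk, h => (1 / 2 : ℂ) •
      (map3 HC (S.alice.proj ⟨k, hk⟩ h) (.id ℂ HB) ∘L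
        S.playA k (Nat.le_of_succ_le hk) (Fin.init h) ∘L
        map3 HC (S.alice.proj ⟨k, hk⟩ h) (.id ℂ HB))

/-- The family of blocks of `E^B_{1,k}(ρ₁)`, indexed by Bob's transcript. -/
def playB (S : Strategy n HA HB HC) :
    (k : ℕ) → k ≤ n → Hist k → (Hilb3 HA HB HC →L[ℂ] Hilb3 HA HB HC)
  | 0, _, _ => InnerProductSpace.rankOne ℂ S.ψ S.ψ
  | k + 1, hk, h => (1 / 2 : ℂ) •
      (map3 HC (.id ℂ HA) (S.bob.proj ⟨k, hk⟩ h) ∘L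
        S.playB k (Nat.le_of_succ_le hk) (Fin.init h) ∘L
        map3 HC (.id ℂ HA) (S.bob.proj ⟨k, hk⟩ h))

/-- `T` `ε`-simulates `S`: for each prover and each number `k` of games,
`‖E_{1,k}(ρ₁) - Ẽ_{1,k}(ρ̃₁)‖_tr ≤ ε`. -/
def Simulates (T S : Strategy n HA HB HC) (ε : ℝ) : Prop :=
  ∀ (k : ℕ) (hk : k ≤ n),
    traceNorm (blockDiag (S.playA k hk) - blockDiag (T.playA k hk)) ≤ ENNReal.ofReal ε ∧
    traceNorm (blockDiag (S.playB k hk) - blockDiag (T.playB k hk)) ≤ ENNReal.ofReal ε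

variable {KA : Type u₄} {KB : Type u₅}
  [NormedAddCommGroup KA] [InnerProductSpace ℂ KA] [CompleteSpace KA]
  [NormedAddCommGroup KB] [InnerProductSpace ℂ KB] [CompleteSpace KB]

/-- `S` is a multi-qubit ideal strategy, as witnessed by the frames `FA` and `FB`. -/
def IsMultiQubitIdeal (S : Strategy n HA HB HC) (FA : QubitFrame n HA KA)
    (FB : QubitFrame n HB KB) : Prop :=
  FA.Describes idealA S.alice ∧ FB.Describes idealB S.bob

/-- `|ψ*⟩^{⊗ n} ⊗ ψ'`, where the `j`-th EPR pair consists of the `j`-th qubits of the provers. -/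
def eprPairs (n : ℕ) (ψ' : Hilb3 KA KB HC) : Hilb3 (Reg (Fin n) KA) (Reg (Fin n) KB) HC :=
  ∑ x : Fin n → Bool, ∑ y : Fin n → Bool,
    (∏ i, epr (x i) (y i)) • map3 HC (ketL KA x) (ketL KB y) ψ'

/-- `S` is an ideal strategy, as witnessed by the isometries `IA` and `IB`. -/
def IsIdealVia (S : Strategy n HA HB HC) (IA : HA →L[ℂ] Reg (Fin n) KA)
    (IB : HB →L[ℂ] Reg (Fin n) KB) : Prop :=
  Isometry IA ∧ Isometry IB ∧
  (∃ ψ' : Hilb3 KA KB HC, ‖ψ'‖ = 1 ∧ map3 HC IA IB S.ψ = eprPairs n ψ') ∧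
  (∀ (j : Fin n) (h : Hist j) (a : Bool),
    S.alice.R j h a = ContinuousLinearMap.adjoint IA ∘L onQubit KA j (idealA a) ∘L IA) ∧
  (∀ (j : Fin n) (h : Hist j) (b : Bool),
    S.bob.R j h b = ContinuousLinearMap.adjoint IB ∘L onQubit KB j (idealB b) ∘L IB)

end Strategy

end

end CHSH

namespace CHSH

set_option linter.unusedSectionVars false

noncomputable section

/-! ### Trace norm estimates for differences of rank one operators. -/

section TraceNorm

variable {H : Type*} [NormedAddCommGroup H] [InnerProductSpace ℂ H] [CompleteSpace H]

/-! Pulling the ideal reflections back to the provers' spaces gives each prover a tree of qubits: a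
Pauli pair X, Z after every local transcript. The pairs met along one transcript commute, because
each unitary leaves the earlier qubits alone. Every measured reflection is cos θ Z + sin θ X, and
the CHSH correlation equals √2 ⟨X X' + Z Z'⟩. A structured game therefore says that the state after
the earlier measurements lies near the range of the EPR projection E of the two current qubits
(`IsStructured.sum_one_sub_epr_le`).

E commutes with the earlier measurements of its path, so this can be pulled back to the initial
state ψ. On the range of the earlier EPR projections the outcomes have an explicit law, a product of
single-game distributions, whatever the vector (`joint_run_eprPath`). It follows that ‖(1 − E)ψ‖² is
small on average over this product law, with polynomial loss (`sum_prodDist_one_sub_epr_le`).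

The law still correlates the two transcripts. But ‖(1 − E)ψ‖² is comparable to ‖Xψ − X'ψ‖² + ‖Zψ −
Z'ψ‖², where Xψ, Zψ depend on Alice's transcript only and X'ψ, Z'ψ on Bob's only. Each game's
distribution has uniform marginals and full support, so a Poincaré inequality that tensorizes
(`sum_uniform_le_sum_prodDist`) passes to independent uniform transcripts at the cost of a factor 4,
whatever the number of games. Averaging then yields transcripts gA, gB such that ψ is nearly EPR
between the qubits at gA and gB, and also between either prover's transcript-dependent qubits and
the other's fixed ones (`exists_transcripts_le`).

Let w be a unit vector near ψ that is exactly EPR at the locations gA, gB. Alice's true measurements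
on ψ are close to the same measurements on Bob's qubits at gB (`sum_run_sub_run_le`), hence close to
those on w, and there they agree exactly with Alice's measurements at gA. The roles can be exchanged
(`exists_fixed_locations`). Being stabilized by all X ⊗ X and Z ⊗ Z, w is a product of EPR pairs
(`exists_eq_eprPairs`), and closeness of the vectors bounds the trace norms. -/

theorem exists_contraction_abs_le {T : H →L[ℂ] H} (hT : IsSelfAdjoint T) {ε : ℝ} (hε : 0 < ε) :
    ∃ C : H →L[ℂ] H, ‖C‖ ≤ 1 ∧ ∀ e : H,
      (inner ℂ e (CFC.abs T e)).re ≤ (inner ℂ e (C (T e))).re + ε * ‖e‖ ^ 2 := by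
  have hpos : ∀ t : ℝ, 0 < |t| + ε := fun t => by positivity
  have hc : Continuous fun t : ℝ => t / (|t| + ε) :=
    continuous_id.div (continuous_abs.add continuous_const) fun t => (hpos t).ne'
  -- The function t / (|t| + ε) is a continuous substitute for the sign of t, so that the continuous
  -- functional calculus applies. Multiplied by t it falls short of |t| by at most ε, because
  -- t²/(|t| + ε) + ε − |t| = ε²/(|t| + ε).
  refine ⟨cfc (fun t : ℝ => t / (|t| + ε)) T, ?_, fun e => ?_⟩
  · refine norm_cfc_le zero_le_one fun t _ => ?_
    rw [Real.norm_eq_abs, abs_div, abs_of_pos (hpos t), div_le_one (hpos t)]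
    linarith
  · have h1 : cfc (fun t : ℝ => t / (|t| + ε)) T * T
        = cfc (fun t : ℝ => t / (|t| + ε) * t) T := by
      conv_lhs => rhs; rw [← cfc_id' ℝ T]
      exact (cfc_mul _ (fun t : ℝ => t) T hc.continuousOn continuousOn_id).symm
    have h2 : 0 ≤ cfc (fun t : ℝ => t / (|t| + ε)) T * T + ε • 1 - CFC.abs T := by
      rw [h1, CFC.abs_eq_cfc_norm T hT, show ε • (1 : H →L[ℂ] H) = cfc (fun _ : ℝ => ε) T by
        rw [cfc_const ε T, Algebra.algebraMap_eq_smul_one],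
        ← cfc_add (a := T) (fun t : ℝ => t / (|t| + ε) * t) (fun _ : ℝ => ε)
          (hc.mul continuous_id).continuousOn continuousOn_const,
        ← cfc_sub (fun t : ℝ => t / (|t| + ε) * t + ε) (fun t : ℝ => ‖t‖) T
          ((hc.mul continuous_id).add continuous_const).continuousOn
          continuous_norm.continuousOn]
      refine cfc_nonneg fun t _ => ?_
      have : t / (|t| + ε) * t + ε - ‖t‖ = ε ^ 2 / (|t| + ε) := by
        rw [Real.norm_eq_abs]
        have := (hpos t).ne'
        field_simp
        rw [show t ^ 2 = |t| ^ 2 from (sq_abs t).symm]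
        ring
      rw [this]
      exact div_nonneg (sq_nonneg _) (hpos t).le
    rw [ContinuousLinearMap.nonneg_iff_isPositive] at h2
    have h3 := h2.re_inner_nonneg_right e
    simp only [sub_apply, add_apply,
      smul_apply, one_apply_eq_self,
      inner_sub_right, inner_add_right, map_add, map_sub, inner_smul_right_eq_smul] at h3
    rw [RCLike.smul_re, inner_self_eq_norm_sq] at h3
    simp only [RCLike.re_to_complex] at h3
    rw [show (cfc (fun t : ℝ => t / (|t| + ε)) T * T) e
      = cfc (fun t : ℝ => t / (|t| + ε)) T (T e) from rfl] at h3
    linarith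

/-- This is a partial trace of the rank one operator |w⟩⟨z|: Cauchy–Schwarz over the family, then
Bessel's inequality for w and for z. -/
theorem sum_re_inner_mul_inner_le {m : ℕ} {e : Fin m → H} (he : Orthonormal ℂ e) (w z : H) :
    ∑ i, (inner ℂ (e i) w * inner ℂ z (e i)).re ≤ ‖w‖ * ‖z‖ := by
  calc ∑ i, (inner ℂ (e i) w * inner ℂ z (e i)).re
      ≤ ∑ i, ‖inner ℂ (e i) w‖ * ‖inner ℂ (e i) z‖ := by
        refine Finset.sum_le_sum fun i _ => (Complex.re_le_norm _).trans ?_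
        rw [norm_mul, norm_inner_symm z]
    _ ≤ √(∑ i, ‖inner ℂ (e i) w‖ ^ 2) * √(∑ i, ‖inner ℂ (e i) z‖ ^ 2) :=
        Real.sum_mul_le_sqrt_mul_sqrt _ _ _
    _ ≤ √(‖w‖ ^ 2) * √(‖z‖ ^ 2) := by
        gcongr
        · exact he.sum_inner_products_le w
        · exact he.sum_inner_products_le z
    _ = ‖w‖ * ‖z‖ := by simp

/-- A sum of differences of rank one operators has small trace norm. -/
theorem traceNorm_sum_rankOne_sub_le {X : Type*} [Fintype X] (u v : X → H) :
    traceNorm (∑ x, (InnerProductSpace.rankOne ℂ (u x) (u x) -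
      InnerProductSpace.rankOne ℂ (v x) (v x))) ≤
      ENNReal.ofReal (∑ x, ‖u x - v x‖ * (‖u x‖ + ‖v x‖)) := by
  set T : H →L[ℂ] H := ∑ x, (InnerProductSpace.rankOne ℂ (u x) (u x) -
      InnerProductSpace.rankOne ℂ (v x) (v x)) with hTdef
  have hT : IsSelfAdjoint T := by
    rw [hTdef]
    refine isSelfAdjoint_sum _ fun x _ => IsSelfAdjoint.sub ?_ ?_ <;>
    · rw [ContinuousLinearMap.isSelfAdjoint_iff']
      exact InnerProductSpace.adjoint_rankOne _ _
  -- The splitting |u⟩⟨u| − |v⟩⟨v| = |u − v⟩⟨u| + |v⟩⟨u − v| puts a factor u − v into each rank one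
  -- term.
  have hTe : ∀ e, T e = ∑ x, (inner ℂ (u x) e • (u x - v x) + inner ℂ (u x - v x) e • v x) := by
    intro e
    simp only [hTdef, sum_apply, sub_apply,
      InnerProductSpace.rankOne_apply]
    refine Finset.sum_congr rfl fun x _ => ?_
    rw [inner_sub_left, smul_sub, sub_smul]
    abel
  refine iSup_le fun m => iSup_le fun e => iSup_le fun he => ?_
  have hnn : ∀ i ∈ Finset.univ, 0 ≤ (inner ℂ (e i) (CFC.abs T (e i))).re := fun i _ =>
    ((ContinuousLinearMap.nonneg_iff_isPositive _).1 (CFC.abs_nonneg T)).re_inner_nonneg_right _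
  rw [← ENNReal.ofReal_sum_of_nonneg hnn]
  refine ENNReal.ofReal_le_ofReal (le_of_forall_pos_le_add fun ε hε => ?_)
  -- The error is paid once for each of the m vectors, so ε / (m + 1) keeps the total below ε.
  obtain ⟨C, hC, hCe⟩ := exists_contraction_abs_le hT (ε := ε / (m + 1)) (by positivity)
  have hCn : ∀ w, ‖C w‖ ≤ ‖w‖ := fun w => (C.le_of_opNorm_le hC w).trans_eq (one_mul _)
  calc ∑ i, (inner ℂ (e i) (CFC.abs T (e i))).re
      ≤ ∑ i, ((inner ℂ (e i) (C (T (e i)))).re + ε / (m + 1)) := by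
        refine Finset.sum_le_sum fun i _ => (hCe (e i)).trans_eq ?_
        rw [he.1 i]; ring
    _ = ∑ x, (∑ i, (inner ℂ (e i) (C (u x - v x)) * inner ℂ (u x) (e i)).re +
          ∑ i, (inner ℂ (e i) (C (v x)) * inner ℂ (u x - v x) (e i)).re) +
          m * (ε / (m + 1)) := by
        rw [Finset.sum_add_distrib]
        congr 1
        · simp_rw [← Finset.sum_add_distrib]
          rw [Finset.sum_comm]
          refine Finset.sum_congr rfl fun i _ => ?_
          rw [hTe, map_sum, inner_sum, Complex.re_sum]
          refine Finset.sum_congr rfl fun x _ => ?_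
          rw [map_add, inner_add_right, map_smul, map_smul, inner_smul_right, inner_smul_right,
            Complex.add_re, mul_comm, mul_comm (inner ℂ (u x - v x) (e i))]
        · simp
    _ ≤ ∑ x, (‖u x - v x‖ * ‖u x‖ + ‖v x‖ * ‖u x - v x‖) + ε := by
        refine add_le_add (Finset.sum_le_sum fun x _ => add_le_add ?_ ?_) ?_
        · exact (sum_re_inner_mul_inner_le he _ _).trans (by gcongr; exact hCn _)
        · exact (sum_re_inner_mul_inner_le he _ _).trans (by gcongr; exact hCn _)
        · have : (m : ℝ) / (m + 1) ≤ 1 := (div_le_one (by positivity)).2 (by linarith)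
          calc (m : ℝ) * (ε / (m + 1)) = m / (m + 1) * ε := by ring
            _ ≤ 1 * ε := by gcongr
            _ = ε := one_mul _
    _ = ∑ x, ‖u x - v x‖ * (‖u x‖ + ‖v x‖) + ε := by
        congr 1
        exact Finset.sum_congr rfl fun x _ => by ring

/-- The trace distance of two families of rank one operators with classical labels. -/
theorem traceNorm_blockDiag_rankOne_sub_le {X : Type*} [Fintype X] (u v : X → H) :
    traceNorm (blockDiag (fun x => InnerProductSpace.rankOne ℂ (u x) (u x)) -
      blockDiag (fun x => InnerProductSpace.rankOne ℂ (v x) (v x))) ≤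
      ENNReal.ofReal (∑ x, ‖u x - v x‖ * (‖u x‖ + ‖v x‖)) := by
  classical
  -- Placing the vectors in distinct summands turns the block diagonal operator into a sum of rank
  -- one operators without changing any norm.
  have key := traceNorm_sum_rankOne_sub_le (fun x => PiLp.single 2 (β := fun _ : X => H) x (u x))
    (fun x => PiLp.single 2 (β := fun _ : X => H) x (v x))
  have hinner : ∀ (x : X) (w : H) (e : PiLp 2 fun _ : X => H),
      inner ℂ (PiLp.single 2 (β := fun _ : X => H) x w) e = inner ℂ w (e x) := by
    intro x w e
    rw [PiLp.inner_apply, Finset.sum_eq_single x]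
    · simp
    · intro y _ hy
      simp [hy]
    · simp
  have hnorm : ∀ x, ‖PiLp.single 2 (β := fun _ : X => H) x (u x) -
      PiLp.single 2 (β := fun _ : X => H) x (v x)‖ = ‖u x - v x‖ := by
    intro x
    rw [← dist_eq_norm, PiLp.dist_single_same, dist_eq_norm]
  simp only [hnorm, PiLp.norm_single] at key
  refine le_trans (le_of_eq ?_) key
  congr 1
  ext e y
  simp only [blockDiag, sub_apply, sum_apply,
    InnerProductSpace.rankOne_apply, ContinuousLinearMap.comp_apply, PiLp.sub_apply,
    WithLp.ofLp_sum, Finset.sum_apply, PiLp.smul_apply]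
  rw [Finset.sum_eq_single y]
  · simp [hinner]
  · intro x _ hx
    simp [hx.symm]
  · simp

end TraceNorm

/-! ### Operators on the completed triple tensor product. -/

section Tensor

variable {A A' A'' B B' B'' C : Type*}
  [NormedAddCommGroup A] [InnerProductSpace ℂ A]
  [NormedAddCommGroup A'] [InnerProductSpace ℂ A']
  [NormedAddCommGroup A''] [InnerProductSpace ℂ A'']
  [NormedAddCommGroup B] [InnerProductSpace ℂ B]
  [NormedAddCommGroup B'] [InnerProductSpace ℂ B']
  [NormedAddCommGroup B''] [InnerProductSpace ℂ B'']
  [NormedAddCommGroup C] [InnerProductSpace ℂ C]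

/-- The pure tensor `a ⊗ b ⊗ c`. -/
def pure3 (a : A) (b : B) (c : C) : Hilb3 A B C :=
  ((a ⊗ₜ[ℂ] b ⊗ₜ[ℂ] c : A ⊗[ℂ] B ⊗[ℂ] C) : UniformSpace.Completion (A ⊗[ℂ] B ⊗[ℂ] C))

theorem map3_coe (f : A →L[ℂ] A') (g : B →L[ℂ] B') (t : A ⊗[ℂ] B ⊗[ℂ] C) :
    map3 C f g ((t : UniformSpace.Completion (A ⊗[ℂ] B ⊗[ℂ] C)) : Hilb3 A B C) =
      ((TensorProduct.mapL (TensorProduct.mapL f g) (ContinuousLinearMap.id ℂ C) t :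
        A' ⊗[ℂ] B' ⊗[ℂ] C) : UniformSpace.Completion (A' ⊗[ℂ] B' ⊗[ℂ] C)) :=
  (TensorProduct.mapL (TensorProduct.mapL f g) (ContinuousLinearMap.id ℂ C)).completion_apply_coe t

theorem map3_pure3 (f : A →L[ℂ] A') (g : B →L[ℂ] B') (a : A) (b : B) (c : C) :
    map3 C f g (pure3 a b c) = pure3 (f a) (g b) c := by
  rw [pure3, map3_coe]
  rfl

theorem clm_ext_pure3 {E : Type*} [NormedAddCommGroup E] [NormedSpace ℂ E]
    {f g : Hilb3 A B C →L[ℂ] E} (h : ∀ a b c, f (pure3 a b c) = g (pure3 a b c)) : f = g := by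
  ext x
  induction x using UniformSpace.Completion.induction_on with
  | hp => exact isClosed_eq f.continuous g.continuous
  | ih t =>
    induction t using TensorProduct.induction_on with
    | zero =>
      rw [UniformSpace.Completion.coe_zero]
      exact (map_zero f).trans (map_zero g).symm
    | tmul t c =>
      induction t using TensorProduct.induction_on with
      | zero =>
        rw [TensorProduct.zero_tmul, UniformSpace.Completion.coe_zero]
        exact (map_zero f).trans (map_zero g).symm
      | tmul a b => exact h a b c
      | add x y hx hy =>
        rw [TensorProduct.add_tmul, UniformSpace.Completion.coe_add]
        exact (map_add f _ _).trans ((congrArg₂ (· + ·) hx hy).trans (map_add g _ _).symm)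
    | add x y hx hy =>
      rw [UniformSpace.Completion.coe_add]
      exact (map_add f _ _).trans ((congrArg₂ (· + ·) hx hy).trans (map_add g _ _).symm)

theorem pure3_add_left (a a' : A) (b : B) (c : C) :
    pure3 (a + a') b c = pure3 a b c + pure3 a' b c := by
  simp only [pure3, TensorProduct.add_tmul, UniformSpace.Completion.coe_add]
  rfl

theorem pure3_add_mid (a : A) (b b' : B) (c : C) :
    pure3 a (b + b') c = pure3 a b c + pure3 a b' c := by
  simp only [pure3, TensorProduct.add_tmul, TensorProduct.tmul_add, UniformSpace.Completion.coe_add]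
  rfl

theorem inner_pure3 (a a' : A) (b b' : B) (c c' : C) :
    inner ℂ (pure3 a b c) (pure3 a' b' c') = inner ℂ a a' * inner ℂ b b' * inner ℂ c c' := by
  rw [← TensorProduct.inner_tmul, ← TensorProduct.inner_tmul]
  exact UniformSpace.Completion.inner_coe _ _

/-- Homogeneity follows from `inner_pure3`: the difference of the two sides has inner product zero
with itself. -/
theorem pure3_smul_left (r : ℂ) (a : A) (b : B) (c : C) :
    pure3 (r • a) b c = r • pure3 a b c := by
  rw [← sub_eq_zero, ← inner_self_eq_zero (𝕜 := ℂ)]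
  simp only [inner_sub_left, inner_sub_right, inner_smul_left, inner_smul_right, inner_pure3]
  ring

theorem pure3_smul_mid (r : ℂ) (a : A) (b : B) (c : C) :
    pure3 a (r • b) c = r • pure3 a b c := by
  rw [← sub_eq_zero, ← inner_self_eq_zero (𝕜 := ℂ)]
  simp only [inner_sub_left, inner_sub_right, inner_smul_left, inner_smul_right, inner_pure3]
  ring

theorem map3_comp (f' : A' →L[ℂ] A'') (g' : B' →L[ℂ] B'') (f : A →L[ℂ] A') (g : B →L[ℂ] B') :
    map3 C (f' ∘L f) (g' ∘L g) = map3 C f' g' ∘L map3 C f g :=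
  clm_ext_pure3 fun a b c => by simp [map3_pure3]

theorem map3_apply_apply (f' : A' →L[ℂ] A'') (g' : B' →L[ℂ] B'') (f : A →L[ℂ] A')
    (g : B →L[ℂ] B') (v : Hilb3 A B C) :
    map3 C f' g' (map3 C f g v) = map3 C (f' ∘L f) (g' ∘L g) v := by
  rw [map3_comp]; rfl

theorem map3_id : map3 C (.id ℂ A) (.id ℂ B) = .id ℂ (Hilb3 A B C) :=
  clm_ext_pure3 fun a b c => by simp [map3_pure3]

theorem map3_add_left (f f' : A →L[ℂ] A') (g : B →L[ℂ] B') :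
    map3 C (f + f') g = map3 C f g + map3 C f' g :=
  clm_ext_pure3 fun a b c => by simp [map3_pure3, pure3_add_left]

theorem map3_add_right (f : A →L[ℂ] A') (g g' : B →L[ℂ] B') :
    map3 C f (g + g') = map3 C f g + map3 C f g' :=
  clm_ext_pure3 fun a b c => by simp [map3_pure3, pure3_add_mid]

theorem map3_smul_left (r : ℂ) (f : A →L[ℂ] A') (g : B →L[ℂ] B') :
    map3 C (r • f) g = r • map3 C f g :=
  clm_ext_pure3 fun a b c => by simp [map3_pure3, pure3_smul_left]

theorem map3_smul_right (r : ℂ) (f : A →L[ℂ] A') (g : B →L[ℂ] B') :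
    map3 C f (r • g) = r • map3 C f g :=
  clm_ext_pure3 fun a b c => by simp [map3_pure3, pure3_smul_mid]

theorem map3_zero_left (g : B →L[ℂ] B') : map3 C (0 : A →L[ℂ] A') g = 0 := by
  simpa using map3_smul_left (C := C) 0 (0 : A →L[ℂ] A') g

theorem map3_zero_right (f : A →L[ℂ] A') : map3 C f (0 : B →L[ℂ] B') = 0 := by
  simpa using map3_smul_right (C := C) 0 f (0 : B →L[ℂ] B')

theorem map3_sum_left {ι : Type*} (s : Finset ι) (f : ι → A →L[ℂ] A') (g : B →L[ℂ] B') :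
    map3 C (∑ i ∈ s, f i) g = ∑ i ∈ s, map3 C (f i) g := by
  classical
  induction s using Finset.induction_on with
  | empty => simp [map3_zero_left]
  | insert i s hi ih => rw [Finset.sum_insert hi, Finset.sum_insert hi, map3_add_left, ih]

theorem map3_sum_right {ι : Type*} (s : Finset ι) (f : A →L[ℂ] A') (g : ι → B →L[ℂ] B') :
    map3 C f (∑ i ∈ s, g i) = ∑ i ∈ s, map3 C f (g i) := by
  classical
  induction s using Finset.induction_on with
  | empty => simp [map3_zero_right]
  | insert i s hi ih => rw [Finset.sum_insert hi, Finset.sum_insert hi, map3_add_right, ih]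

variable [CompleteSpace A] [CompleteSpace A'] [CompleteSpace B] [CompleteSpace B']

theorem adjoint_map3 (f : A →L[ℂ] A') (g : B →L[ℂ] B') :
    ContinuousLinearMap.adjoint (map3 C f g) =
      map3 C (ContinuousLinearMap.adjoint f) (ContinuousLinearMap.adjoint g) := by
  symm
  rw [ContinuousLinearMap.eq_adjoint_iff]
  intro x y
  have hpure : ∀ a b c (x : Hilb3 A' B' C), inner ℂ (map3 C f g (pure3 a b c)) x =
      inner ℂ (pure3 a b c)
        (map3 C (ContinuousLinearMap.adjoint f) (ContinuousLinearMap.adjoint g) x) := by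
    intro a b c x
    have : innerSL ℂ (map3 C f g (pure3 a b c)) = innerSL ℂ (pure3 a b c) ∘L
        map3 C (ContinuousLinearMap.adjoint f) (ContinuousLinearMap.adjoint g) :=
      clm_ext_pure3 fun a' b' c' => by
        simp [map3_pure3, inner_pure3, ContinuousLinearMap.adjoint_inner_right]
    exact DFunLike.congr_fun this x
  have : innerSL ℂ (map3 C (ContinuousLinearMap.adjoint f) (ContinuousLinearMap.adjoint g) x) =
      innerSL ℂ x ∘L map3 C f g :=
    clm_ext_pure3 fun a b c => by
      have := congrArg (starRingEnd ℂ) (hpure a b c x)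
      rw [inner_conj_symm, inner_conj_symm] at this
      exact this.symm
  exact DFunLike.congr_fun this y

/-- Alice's operators, acting on the shared space. -/
def aliceHom (A B C : Type*) [NormedAddCommGroup A] [InnerProductSpace ℂ A] [CompleteSpace A]
    [NormedAddCommGroup B] [InnerProductSpace ℂ B] [CompleteSpace B]
    [NormedAddCommGroup C] [InnerProductSpace ℂ C] :
    (A →L[ℂ] A) →⋆ₐ[ℂ] (Hilb3 A B C →L[ℂ] Hilb3 A B C) where
  toFun f := map3 C f (.id ℂ B)
  map_one' := map3_id
  map_mul' f g := map3_comp (A'' := A) (B'' := B) f (.id ℂ B) g (.id ℂ B)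
  map_zero' := map3_zero_left _
  map_add' f g := map3_add_left f g _
  commutes' r := by
    rw [Algebra.algebraMap_eq_smul_one, Algebra.algebraMap_eq_smul_one, map3_smul_left]
    exact congrArg (r • ·) map3_id
  map_star' f := by
    rw [ContinuousLinearMap.star_eq_adjoint, ContinuousLinearMap.star_eq_adjoint, adjoint_map3]
    congr 1
    exact (star_one (B →L[ℂ] B)).symm

/-- Bob's operators, acting on the shared space. -/
def bobHom (A B C : Type*) [NormedAddCommGroup A] [InnerProductSpace ℂ A] [CompleteSpace A]
    [NormedAddCommGroup B] [InnerProductSpace ℂ B] [CompleteSpace B]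
    [NormedAddCommGroup C] [InnerProductSpace ℂ C] :
    (B →L[ℂ] B) →⋆ₐ[ℂ] (Hilb3 A B C →L[ℂ] Hilb3 A B C) where
  toFun f := map3 C (.id ℂ A) f
  map_one' := map3_id
  map_mul' f g := map3_comp (A'' := A) (B'' := B) (.id ℂ A) f (.id ℂ A) g
  map_zero' := map3_zero_right _
  map_add' f g := map3_add_right _ f g
  commutes' r := by
    rw [Algebra.algebraMap_eq_smul_one, Algebra.algebraMap_eq_smul_one, map3_smul_right]
    exact congrArg (r • ·) map3_id
  map_star' f := by
    rw [ContinuousLinearMap.star_eq_adjoint, ContinuousLinearMap.star_eq_adjoint, adjoint_map3]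
    congr 1
    exact (star_one (A →L[ℂ] A)).symm

theorem aliceHom_apply (f : A →L[ℂ] A) : aliceHom A B C f = map3 C f (.id ℂ B) := rfl

theorem bobHom_apply (g : B →L[ℂ] B) : bobHom A B C g = map3 C (.id ℂ A) g := rfl

theorem aliceHom_mul_bobHom (f : A →L[ℂ] A) (g : B →L[ℂ] B) :
    aliceHom A B C f * bobHom A B C g = map3 C f g :=
  (map3_comp (A'' := A) (B'' := B) f (.id ℂ B) (.id ℂ A) g).symm

theorem commute_aliceHom_bobHom (f : A →L[ℂ] A) (g : B →L[ℂ] B) :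
    Commute (aliceHom A B C f) (bobHom A B C g) :=
  (aliceHom_mul_bobHom f g).trans (map3_comp (A'' := A) (B'' := B) (.id ℂ A) g f (.id ℂ B))

end Tensor

/-! ### Sums and means over transcripts. -/

section Transcripts

/-- The transcript `h` followed by one more game `p`. -/
def Hist.snoc {k : ℕ} (h : Hist k) (p : Bool × Bool) : Hist (k + 1) :=
  Fin.snoc (α := fun _ => Bool × Bool) h p

@[simp] theorem Hist.init_snoc {k : ℕ} (h : Hist k) (p : Bool × Bool) :
    (Fin.init (Hist.snoc h p) : Hist k) = h :=
  Fin.init_snoc (α := fun _ => Bool × Bool) _ _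

@[simp] theorem Hist.snoc_last {k : ℕ} (h : Hist k) (p : Bool × Bool) :
    Hist.snoc h p (Fin.last k) = p :=
  Fin.snoc_last (α := fun _ => Bool × Bool) _ _

/-- The first `k` games of a transcript. -/
def Hist.prefix {n : ℕ} (h : Hist n) (k : ℕ) : Hist k :=
  fun i => if hi : i.1 < n then h ⟨i, hi⟩ else default

@[simp] theorem Hist.prefix_self {n : ℕ} (h : Hist n) : h.prefix n = h := by
  funext i
  simp [Hist.prefix]

@[simp] theorem Hist.init_prefix {n : ℕ} (h : Hist n) (k : ℕ) :
    (Fin.init (h.prefix (k + 1)) : Hist k) = h.prefix k := rfl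

theorem Hist.prefix_snoc {n k : ℕ} (hk : k ≤ n) (h : Hist n) (p : Bool × Bool) :
    (h.snoc p).prefix k = h.prefix k := by
  funext i
  have hi : i.1 < n := i.2.trans_le hk
  simp [Hist.prefix, hi, hi.trans (Nat.lt_succ_self n), Hist.snoc, Fin.snoc]

theorem sum_hist_succ {M : Type*} [AddCommMonoid M] {k : ℕ} (f : Hist (k + 1) → M) :
    ∑ h, f h = ∑ h : Hist k, ∑ p, f (h.snoc p) := by
  rw [← Equiv.sum_comp (Fin.snocEquiv fun _ : Fin (k + 1) => Bool × Bool) f,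
    Fintype.sum_prod_type, Finset.sum_comm]
  rfl

theorem sum_hist_pair_succ {M : Type*} [AddCommMonoid M] {k : ℕ}
    (f : Hist (k + 1) → Hist (k + 1) → M) :
    ∑ hA, ∑ hB, f hA hB =
      ∑ hA : Hist k, ∑ hB : Hist k, ∑ p, ∑ q, f (hA.snoc p) (hB.snoc q) := by
  rw [sum_hist_succ]
  simp_rw [sum_hist_succ]
  exact Finset.sum_congr rfl fun hA _ => Finset.sum_comm

theorem card_hist (k : ℕ) : (Fintype.card (Hist k) : ℝ) = 4 ^ k := by
  simp [Hist]

/-- The mean over a uniformly random transcript. -/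
def mean {k : ℕ} (f : Hist k → ℝ) : ℝ := (1 / 4) ^ k * ∑ h, f h

/-- Prefixes of a uniform transcript are uniform. This lets one full transcript be chosen to serve
all games at once. -/
theorem mean_prefix {n k : ℕ} (hk : k ≤ n) (f : Hist k → ℝ) :
    mean (fun h : Hist n => f (h.prefix k)) = mean f := by
  induction n, hk using Nat.le_induction with
  | base => simp
  | succ n hn ih =>
    rw [← ih, mean, mean, sum_hist_succ]
    simp_rw [Hist.prefix_snoc hn]
    simp only [Finset.sum_const, Finset.card_univ, Fintype.card_prod, Fintype.card_bool,
      ← Finset.smul_sum, pow_succ]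
    simp only [nsmul_eq_mul]
    norm_num
    ring

theorem mean_const (k : ℕ) (c : ℝ) : mean (fun _ : Hist k => c) = c := by
  rw [mean, Finset.sum_const, Finset.card_univ, nsmul_eq_mul, card_hist, ← mul_assoc, ← mul_pow]
  norm_num

theorem mean_add {k : ℕ} (f g : Hist k → ℝ) : mean (fun h => f h + g h) = mean f + mean g := by
  simp only [mean, Finset.sum_add_distrib, mul_add]

theorem mean_sum {k : ℕ} {ι : Type*} (s : Finset ι) (f : ι → Hist k → ℝ) :
    mean (fun h => ∑ i ∈ s, f i h) = ∑ i ∈ s, mean (f i) := by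
  simp only [mean, Finset.mul_sum]
  exact Finset.sum_comm

theorem exists_le_mean {k : ℕ} (f : Hist k → ℝ) : ∃ h, f h ≤ mean f := by
  by_contra! hf
  have h1 : ∑ _h : Hist k, mean f < ∑ h, f h :=
    Finset.sum_lt_sum_of_nonempty ⟨fun _ => default, Finset.mem_univ _⟩ fun h _ => hf h
  rw [Finset.sum_const, Finset.card_univ, nsmul_eq_mul, card_hist, mean, ← mul_assoc,
    ← mul_pow] at h1
  norm_num at h1

end Transcripts

/-! ### A Poincaré inequality for correlated product distributions. -/

section Poincare

variable {E : Type*} [NormedAddCommGroup E] [InnerProductSpace ℂ E]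

/-- The average of the four values of `F`. -/
def centre (F : Bool × Bool → E) : E := (1 / 4 : ℂ) • ∑ p, F p

theorem sum_sub_centre (F : Bool × Bool → E) : ∑ p, (F p - centre F) = 0 := by
  rw [Finset.sum_sub_distrib, Finset.sum_const, centre, Finset.card_univ, Fintype.card_prod,
    Fintype.card_bool, ← Nat.cast_smul_eq_nsmul ℂ, smul_smul]
  norm_num

/-- Both marginals of `m` are uniform, so the centred parts average to zero against the constant
vector `centre F - centre G`. The correlations in `m` enter only the last term. -/
theorem sum_marginal_norm_sub_sq {m : Bool × Bool → Bool × Bool → ℝ}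
    (hl : ∀ p, ∑ q, m p q = 1 / 4) (hr : ∀ q, ∑ p, m p q = 1 / 4) (F G : Bool × Bool → E) :
    ∑ p, ∑ q, m p q * ‖F p - G q‖ ^ 2 = ‖centre F - centre G‖ ^ 2 +
      ∑ p, ∑ q, m p q * ‖(F p - centre F) - (G q - centre G)‖ ^ 2 := by
  set d := centre F - centre G with hd
  have h1 : ∀ p q, m p q * ‖F p - G q‖ ^ 2 = m p q * ‖d‖ ^ 2 +
      (2 * (m p q * (inner ℂ d (F p - centre F)).re) -
        2 * (m p q * (inner ℂ d (G q - centre G)).re)) +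
      m p q * ‖(F p - centre F) - (G q - centre G)‖ ^ 2 := by
    intro p q
    have : F p - G q = d + ((F p - centre F) - (G q - centre G)) := by rw [hd]; abel
    rw [this, @norm_add_sq ℂ, inner_sub_right]
    simp only [map_sub, RCLike.re_to_complex]
    ring
  have hm : ∑ p, ∑ q, m p q = 1 := by
    simp_rw [hl]; simp
  have h2 : ∑ p, ∑ q, m p q * (inner ℂ d (F p - centre F)).re = 0 := by
    simp_rw [← Finset.sum_mul, hl, ← Finset.mul_sum, ← Complex.re_sum, ← inner_sum,
      sum_sub_centre]
    simp
  have h3 : ∑ p, ∑ q, m p q * (inner ℂ d (G q - centre G)).re = 0 := by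
    rw [Finset.sum_comm]
    simp_rw [← Finset.sum_mul, hr, ← Finset.mul_sum, ← Complex.re_sum, ← inner_sum,
      sum_sub_centre]
    simp
  simp_rw [h1, Finset.sum_add_distrib, Finset.sum_sub_distrib, ← Finset.mul_sum, h2, h3,
    ← Finset.sum_mul, hm]
  ring

/-- The variance of the four values of `F`. -/
def spread (F : Bool × Bool → E) : ℝ := 1 / 4 * ∑ p, ‖F p - centre F‖ ^ 2

/-- Under the independent distribution the cross terms between the two centred functions vanish as
well, and only variances remain. -/
theorem sum_norm_sub_centre_sq (F G : Bool × Bool → E) :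
    ∑ p, ∑ q, 1 / 16 * ‖(F p - centre F) - (G q - centre G)‖ ^ 2 = spread F + spread G := by
  have h2 : ∀ p, ∑ q, (inner ℂ (F p - centre F) (G q - centre G)).re = 0 := by
    intro p
    rw [← Complex.re_sum, ← inner_sum, sum_sub_centre]
    simp
  have h3 : ∀ p q, 1 / 16 * ‖(F p - centre F) - (G q - centre G)‖ ^ 2 =
      1 / 16 * ‖F p - centre F‖ ^ 2 - 1 / 8 * (inner ℂ (F p - centre F) (G q - centre G)).re +
        1 / 16 * ‖G q - centre G‖ ^ 2 := by
    intro p q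
    rw [@norm_sub_sq ℂ, RCLike.re_to_complex]
    ring
  simp_rw [h3, Finset.sum_add_distrib, Finset.sum_sub_distrib, ← Finset.mul_sum, h2,
    Finset.sum_const, Finset.card_univ, Fintype.card_prod, Fintype.card_bool, nsmul_eq_mul]
  rw [← Finset.mul_sum, spread, spread]
  norm_num
  ring

/-- The product of the distributions `m` of the questions and answers of `k` independent games. -/
def prodDist (m : Bool × Bool → Bool × Bool → ℝ) : (k : ℕ) → Hist k → Hist k → ℝ
  | 0, _, _ => 1
  | k + 1, hA, hB =>
    prodDist m k (Fin.init hA) (Fin.init hB) * m (hA (Fin.last k)) (hB (Fin.last k))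

variable {m : Bool × Bool → Bool × Bool → ℝ}

theorem prodDist_snoc {k : ℕ} (hA hB : Hist k) (p q : Bool × Bool) :
    prodDist m (k + 1) (hA.snoc p) (hB.snoc q) = prodDist m k hA hB * m p q := by
  simp [prodDist]

theorem prodDist_nonneg (hm : ∀ p q, 0 ≤ m p q) (k : ℕ) (hA hB : Hist k) :
    0 ≤ prodDist m k hA hB := by
  induction k with
  | zero => simp [prodDist]
  | succ k ih => exact mul_nonneg (ih _ _) (hm _ _)

theorem sum_prodDist_right (hl : ∀ p, ∑ q, m p q = 1 / 4) (k : ℕ) (hA : Hist k) :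
    ∑ hB, prodDist m k hA hB = (1 / 4) ^ k := by
  induction k with
  | zero => simp [prodDist]
  | succ k ih =>
    rw [sum_hist_succ]
    simp only [prodDist, Hist.init_snoc, Hist.snoc_last, ← Finset.mul_sum, hl, ← Finset.sum_mul,
      ih, pow_succ]

theorem sum_prodDist_left (hr : ∀ q, ∑ p, m p q = 1 / 4) (k : ℕ) (hB : Hist k) :
    ∑ hA, prodDist m k hA hB = (1 / 4) ^ k := by
  induction k with
  | zero => simp [prodDist]
  | succ k ih =>
    rw [sum_hist_succ]
    simp only [prodDist, Hist.init_snoc, Hist.snoc_last, ← Finset.mul_sum, hr, ← Finset.sum_mul,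
      ih, pow_succ]

/-- A Poincaré inequality: two functions of the two provers' transcripts that are close under the
correlated product distribution are close under the uniform distribution. -/
theorem sum_uniform_le_sum_prodDist (hl : ∀ p, ∑ q, m p q = 1 / 4)
    (hr : ∀ q, ∑ p, m p q = 1 / 4) (hm : ∀ p q, 1 / 64 ≤ m p q) (k : ℕ) (f g : Hist k → E) :
    ∑ hA, ∑ hB, (1 / 16) ^ k * ‖f hA - g hB‖ ^ 2 ≤
      4 * ∑ hA, ∑ hB, prodDist m k hA hB * ‖f hA - g hB‖ ^ 2 := by
  induction k with
  | zero =>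
    simp only [prodDist, pow_zero]
    have : 0 ≤ ∑ hA : Hist 0, ∑ hB : Hist 0, 1 * ‖f hA - g hB‖ ^ 2 := by positivity
    linarith
  | succ k ih =>
    have hm0 : ∀ p q, 0 ≤ m p q := fun p q => le_trans (by norm_num) (hm p q)
    rw [sum_hist_pair_succ, sum_hist_pair_succ]
    set F : Hist k → Bool × Bool → E := fun h p => f (h.snoc p) with hF
    set G : Hist k → Bool × Bool → E := fun h p => g (h.snoc p) with hG
    have e1 : ∀ x y : Hist k, ∑ p, ∑ q, (1 / 16 : ℝ) ^ (k + 1) *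
        ‖f (x.snoc p) - g (y.snoc q)‖ ^ 2 =
        (1 / 16) ^ k * ‖centre (F x) - centre (G y)‖ ^ 2 +
          (1 / 16) ^ k * (spread (F x) + spread (G y)) := by
      intro x y
      rw [← sum_norm_sub_centre_sq, ← mul_add, ← sum_marginal_norm_sub_sq
        (m := fun _ _ => 1 / 16) (by simp; norm_num) (by simp; norm_num)]
      simp_rw [Finset.mul_sum, pow_succ, mul_assoc]
      rfl
    -- The bound m ≥ 1/64 = 1/4 · 1/16 compares the last game with an independent uniform one, so at
    -- least a quarter of the variances survives.
    have e2 : ∀ x y : Hist k, prodDist m k x y * ‖centre (F x) - centre (G y)‖ ^ 2 +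
        1 / 4 * (prodDist m k x y * (spread (F x) + spread (G y))) ≤
        ∑ p, ∑ q, prodDist m (k + 1) (x.snoc p) (y.snoc q) *
          ‖f (x.snoc p) - g (y.snoc q)‖ ^ 2 := by
      intro x y
      have h1 : ∑ p, ∑ q, 1 / 4 * (1 / 16 * ‖(F x p - centre (F x)) - (G y q - centre (G y))‖ ^ 2)
          ≤ ∑ p, ∑ q, m p q * ‖(F x p - centre (F x)) - (G y q - centre (G y))‖ ^ 2 := by
        refine Finset.sum_le_sum fun p _ => Finset.sum_le_sum fun q _ => ?_
        rw [← mul_assoc]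
        refine mul_le_mul_of_nonneg_right (le_trans (by norm_num) (hm p q)) (sq_nonneg _)
      simp_rw [← Finset.mul_sum (a := (1 / 4 : ℝ))] at h1
      rw [sum_norm_sub_centre_sq] at h1
      have h2 : ∑ p, ∑ q, prodDist m (k + 1) (x.snoc p) (y.snoc q) *
          ‖f (x.snoc p) - g (y.snoc q)‖ ^ 2 =
          prodDist m k x y * ∑ p, ∑ q, m p q * ‖F x p - G y q‖ ^ 2 := by
        simp_rw [prodDist_snoc, Finset.mul_sum, mul_assoc]
        rfl
      rw [h2, sum_marginal_norm_sub_sq hl hr]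
      have := mul_le_mul_of_nonneg_left h1 (prodDist_nonneg hm0 k x y)
      linarith
    -- Each variance depends on one transcript only, and `prodDist` has the same uniform marginals
    -- as the independent distribution. The variance terms therefore cost no comparison of joint
    -- laws, which is why the factor 4 does not grow with k.
    have e3 : ∑ x : Hist k, ∑ y : Hist k, (1 / 16 : ℝ) ^ k * (spread (F x) + spread (G y)) =
        ∑ x : Hist k, ∑ y : Hist k, prodDist m k x y * (spread (F x) + spread (G y)) := by
      have h16 : (1 / 16 : ℝ) ^ k * 4 ^ k = (1 / 4) ^ k := by
        rw [← mul_pow]; norm_num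
      simp_rw [mul_add, Finset.sum_add_distrib]
      congr 1
      · simp_rw [← Finset.sum_mul, sum_prodDist_right hl, Finset.sum_const, Finset.card_univ,
          nsmul_eq_mul, card_hist, mul_comm ((4 : ℝ) ^ k), h16]
      · rw [Finset.sum_comm, Finset.sum_comm (f := fun x y => prodDist m k x y * spread (G y))]
        simp_rw [← Finset.sum_mul, sum_prodDist_left hr, Finset.sum_const, Finset.card_univ,
          nsmul_eq_mul, card_hist, mul_comm ((4 : ℝ) ^ k), h16]
    simp_rw [e1]
    refine le_trans ?_ (mul_le_mul_of_nonneg_left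
      (Finset.sum_le_sum fun x _ => Finset.sum_le_sum fun y _ => e2 x y) (by norm_num))
    simp_rw [Finset.sum_add_distrib, ← Finset.mul_sum] at e3 ⊢
    simp_rw [← Finset.mul_sum] at ih
    -- The induction hypothesis is applied to the averages over the last game. The factor 4 exactly
    -- compensates the factor 1/4 in `e2`.
    have := ih (fun x => centre (F x)) (fun y => centre (G y))
    linarith

end Poincare

/-- Minkowski's inequality for weighted sums of squared norms. -/
theorem sum_norm_add_sq_le {E ι : Type*} [SeminormedAddCommGroup E] [Fintype ι] {w : ι → ℝ}
    (hw : ∀ i, 0 ≤ w i) {u v : ι → E} {a b : ℝ} (ha : 0 ≤ a) (hb : 0 ≤ b)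
    (hu : ∑ i, w i * ‖u i‖ ^ 2 ≤ a ^ 2) (hv : ∑ i, w i * ‖v i‖ ^ 2 ≤ b ^ 2) :
    ∑ i, w i * ‖u i + v i‖ ^ 2 ≤ (a + b) ^ 2 := by
  have hcs : ∑ i, w i * (‖u i‖ * ‖v i‖) ≤ a * b := by
    calc ∑ i, w i * (‖u i‖ * ‖v i‖) = ∑ i, (√(w i) * ‖u i‖) * (√(w i) * ‖v i‖) := by
          refine Finset.sum_congr rfl fun i _ => ?_
          rw [mul_mul_mul_comm, Real.mul_self_sqrt (hw i)]
      _ ≤ √(∑ i, (√(w i) * ‖u i‖) ^ 2) * √(∑ i, (√(w i) * ‖v i‖) ^ 2) :=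
          Real.sum_mul_le_sqrt_mul_sqrt _ _ _
      _ ≤ a * b := by
          simp_rw [mul_pow, Real.sq_sqrt (hw _)]
          exact mul_le_mul (Real.sqrt_le_iff.2 ⟨ha, hu⟩) (Real.sqrt_le_iff.2 ⟨hb, hv⟩)
            (Real.sqrt_nonneg _) ha
  calc ∑ i, w i * ‖u i + v i‖ ^ 2
      ≤ ∑ i, (w i * ‖u i‖ ^ 2 + 2 * (w i * (‖u i‖ * ‖v i‖)) + w i * ‖v i‖ ^ 2) := by
        refine Finset.sum_le_sum fun i _ => ?_
        have : ‖u i + v i‖ ^ 2 ≤ (‖u i‖ + ‖v i‖) ^ 2 := by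
          gcongr
          exact norm_add_le _ _
        nlinarith [mul_le_mul_of_nonneg_left this (hw i)]
    _ ≤ (a + b) ^ 2 := by
        rw [Finset.sum_add_distrib, Finset.sum_add_distrib, ← Finset.mul_sum]
        nlinarith

/-! ### Reflections and their spectral projections. -/

section Reflection

variable {𝓐 : Type*} [Ring 𝓐] [StarRing 𝓐]

/-- A self-adjoint involution. -/
structure IsReflection (r : 𝓐) : Prop where
  isSelfAdjoint : IsSelfAdjoint r
  mul_self : r * r = 1

theorem IsReflection.mul {r s : 𝓐} (hr : IsReflection r) (hs : IsReflection s)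
    (h : Commute r s) : IsReflection (r * s) where
  isSelfAdjoint := (hr.isSelfAdjoint.commute_iff hs.isSelfAdjoint).1 h
  mul_self := by rw [h.symm.mul_mul_mul_comm, hr.mul_self, hs.mul_self, one_mul]

theorem IsReflection.neg {r : 𝓐} (hr : IsReflection r) : IsReflection (-r) where
  isSelfAdjoint := hr.isSelfAdjoint.neg
  mul_self := by rw [neg_mul_neg, hr.mul_self]

variable [Algebra ℂ 𝓐] [StarModule ℂ 𝓐]

/-- The projection `½ (1 + r)` onto the fixed vectors of a reflection `r`. -/
def halfProj (r : 𝓐) : 𝓐 := (1 / 2 : ℂ) • (1 + r)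

theorem one_sub_halfProj (r : 𝓐) : 1 - halfProj r = halfProj (-r) := by
  simp only [halfProj]
  module

theorem IsReflection.isStarProjection {r : 𝓐} (hr : IsReflection r) :
    IsStarProjection (halfProj r) where
  isIdempotentElem := by
    simp only [IsIdempotentElem, halfProj, smul_mul_smul_comm, mul_add, add_mul, one_mul, mul_one,
      hr.mul_self]
    module
  isSelfAdjoint := by
    refine IsSelfAdjoint.smul ?_ ((IsSelfAdjoint.one 𝓐).add hr.isSelfAdjoint)
    rw [isSelfAdjoint_iff]
    simp

/-- An operator anticommuting with `r` maps each eigenspace of `r` into the other one. -/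
theorem halfProj_mul_mul_halfProj {r q : 𝓐} (hr : IsReflection r) (h : q * r = -(r * q)) :
    halfProj r * q * halfProj r = 0 := by
  have h1 : q * halfProj r = (1 - halfProj r) * q := by
    simp only [halfProj, mul_smul_comm, mul_add, mul_one, h, sub_mul, one_mul, smul_mul_assoc,
      add_mul]
    module
  rw [mul_assoc, h1, ← mul_assoc, mul_sub, mul_one, hr.isStarProjection.isIdempotentElem.eq,
    sub_self, zero_mul]

theorem commute_halfProj {r y : 𝓐} (h : Commute y r) : Commute y (halfProj r) :=
  ((Commute.one_right y).add_right h).smul_right _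

end Reflection

/-! ### Algebra of Pauli pairs and EPR projections. -/

section PauliPair

/-- The Pauli operators `X` and `Z` of a qubit. -/
structure IsPauliPair {𝓐 : Type*} [Ring 𝓐] [StarRing 𝓐] (x z : 𝓐) : Prop where
  isReflection_x : IsReflection x
  isReflection_z : IsReflection z
  anticomm : x * z = -(z * x)

variable {𝓐 : Type*} [Ring 𝓐] [StarRing 𝓐] [Algebra ℂ 𝓐] [StarModule ℂ 𝓐]

/-- The reflection `cos t Z + sin t X`. -/
def pauliRefl (x z : 𝓐) (t : ℝ) : 𝓐 := ((Real.cos t : ℝ) : ℂ) • z + ((Real.sin t : ℝ) : ℂ) • x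

/-- The projection onto an eigenspace of `cos t Z + sin t X`. -/
def pauliProj (x z : 𝓐) (t : ℝ) (b : Bool) : 𝓐 :=
  halfProj (((sgn b : ℝ) : ℂ) • pauliRefl x z t)

theorem pauliRefl_mul_pauliRefl {x z : 𝓐} (h : IsPauliPair x z) (t t' : ℝ) :
    pauliRefl x z t * pauliRefl x z t' = ((Real.cos (t - t') : ℝ) : ℂ) • (1 : 𝓐) +
      ((Real.sin (t' - t) : ℝ) : ℂ) • (z * x) := by
  simp only [pauliRefl, mul_add, add_mul, smul_mul_smul_comm, h.isReflection_x.mul_self,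
    h.isReflection_z.mul_self, h.anticomm, Real.cos_sub, Real.sin_sub]
  push_cast
  module

theorem isReflection_pauliRefl {x z : 𝓐} (h : IsPauliPair x z) (t : ℝ) :
    IsReflection (pauliRefl x z t) where
  isSelfAdjoint := by
    refine IsSelfAdjoint.add (IsSelfAdjoint.smul ?_ h.isReflection_z.isSelfAdjoint)
      (IsSelfAdjoint.smul ?_ h.isReflection_x.isSelfAdjoint) <;>
    · rw [isSelfAdjoint_iff]
      exact Complex.conj_ofReal _
  mul_self := by
    rw [pauliRefl_mul_pauliRefl h]
    simp

theorem isReflection_sgn_smul {r : 𝓐} (h : IsReflection r) (b : Bool) :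
    IsReflection (((sgn b : ℝ) : ℂ) • r) := by
  cases b
  · simpa [sgn] using h
  · simpa [sgn] using h.neg

theorem isStarProjection_pauliProj {x z : 𝓐} (h : IsPauliPair x z) (t : ℝ) (b : Bool) :
    IsStarProjection (pauliProj x z t b) :=
  (isReflection_sgn_smul (isReflection_pauliRefl h t) b).isStarProjection

theorem pauliProj_true (x z : 𝓐) (t : ℝ) :
    pauliProj x z t true = 1 - pauliProj x z t false := by
  rw [pauliProj, pauliProj, one_sub_halfProj]
  simp [sgn]

theorem commute_pauliRefl {x z y : 𝓐} (hx : Commute y x) (hz : Commute y z) (t : ℝ) :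
    Commute y (pauliRefl x z t) :=
  (hz.smul_right _).add_right (hx.smul_right _)

theorem commute_pauliProj {x z y : 𝓐} (hx : Commute y x) (hz : Commute y z) (t : ℝ) (b : Bool) :
    Commute y (pauliProj x z t b) :=
  commute_halfProj ((commute_pauliRefl hx hz t).smul_right _)

/-- The projection onto the EPR state of two qubits. -/
def eprProj (x z x' z' : 𝓐) : 𝓐 := halfProj (x * x') * halfProj (z * z')

/-- Two commuting qubits. -/
structure IsQubitPair (x z x' z' : 𝓐) : Prop where
  left : IsPauliPair x z
  right : IsPauliPair x' z'
  xx : Commute x x'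
  xz : Commute x z'
  zx : Commute z x'
  zz : Commute z z'

theorem commute_eprProj {x z x' z' y : 𝓐} (hx : Commute y x) (hz : Commute y z)
    (hx' : Commute y x') (hz' : Commute y z') : Commute y (eprProj x z x' z') :=
  (commute_halfProj (hx.mul_right hx')).mul_right (commute_halfProj (hz.mul_right hz'))

namespace IsQubitPair

variable {x z x' z' : 𝓐} (h : IsQubitPair x z x' z')
include h

theorem isReflection_xx : IsReflection (x * x') :=
  h.left.isReflection_x.mul h.right.isReflection_x h.xx

theorem isReflection_zz : IsReflection (z * z') :=
  h.left.isReflection_z.mul h.right.isReflection_z h.zz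

theorem z_mul_xx : z * (x * x') = -(x * x' * z) := by
  rw [← mul_assoc, mul_assoc x, ← h.zx.eq, ← mul_assoc, h.left.anticomm, neg_mul, neg_neg]

theorem x_mul_zz : x * (z * z') = -(z * z' * x) := by
  rw [← mul_assoc, h.left.anticomm, neg_mul, mul_assoc z z' x, ← h.xz.eq, mul_assoc]

theorem zx_mul_xx : z * x * (x * x') = -(x * x' * (z * x)) := by
  have h1 : Commute x (x * x') := (Commute.refl x).mul_right h.xx
  rw [mul_assoc, h1.eq, ← mul_assoc, h.z_mul_xx, neg_mul, mul_assoc]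

theorem commute_xx_zz : Commute (x * x') (z * z') := by
  have h1 : x' * z' = -(z' * x') := h.right.anticomm
  change x * x' * (z * z') = z * z' * (x * x')
  calc x * x' * (z * z') = x * (x' * z) * z' := by noncomm_ring
    _ = x * z * (x' * z') := by rw [← h.zx.eq]; noncomm_ring
    _ = z * (x * z') * x' := by rw [h.left.anticomm, h1]; noncomm_ring
    _ = z * z' * (x * x') := by rw [h.xz.eq]; noncomm_ring

theorem commute_halfProj_xx_zz : Commute (halfProj (x * x')) (halfProj (z * z')) :=
  commute_halfProj (commute_halfProj h.commute_xx_zz.symm).symm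

theorem isStarProjection_eprProj : IsStarProjection (eprProj x z x' z') :=
  h.isReflection_xx.isStarProjection.mul h.isReflection_zz.isStarProjection
    h.commute_halfProj_xx_zz

/-- On the range of the EPR projection x x' = 1, and x is its own inverse. Consequently any
measurement in the real x, z plane may be moved from one prover to the other. -/
theorem x_mul_eprProj : x * eprProj x z x' z' = x' * eprProj x z x' z' := by
  have h1 : x * halfProj (x * x') = x' * halfProj (x * x') := by
    simp only [halfProj, mul_smul_comm, mul_add, mul_one, ← mul_assoc, h.left.isReflection_x.mul_self]
    rw [h.xx.eq.symm, mul_assoc, h.right.isReflection_x.mul_self, one_mul, mul_one, add_comm]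
  rw [eprProj, ← mul_assoc, h1, mul_assoc]

theorem z_mul_eprProj : z * eprProj x z x' z' = z' * eprProj x z x' z' := by
  have h1 : z * halfProj (z * z') = z' * halfProj (z * z') := by
    simp only [halfProj, mul_smul_comm, mul_add, mul_one, ← mul_assoc, h.left.isReflection_z.mul_self]
    rw [h.zz.eq.symm, mul_assoc, h.right.isReflection_z.mul_self, one_mul, mul_one, add_comm]
  rw [eprProj, h.commute_halfProj_xx_zz.eq, ← mul_assoc, h1, mul_assoc]

theorem pauliRefl_mul_eprProj (t : ℝ) :
    pauliRefl x z t * eprProj x z x' z' = pauliRefl x' z' t * eprProj x z x' z' := by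
  simp only [pauliRefl, add_mul, smul_mul_assoc, h.x_mul_eprProj, h.z_mul_eprProj]

theorem pauliProj_mul_eprProj (t : ℝ) (b : Bool) :
    pauliProj x z t b * eprProj x z x' z' = pauliProj x' z' t b * eprProj x z x' z' := by
  simp only [pauliProj, halfProj, add_mul, smul_mul_assoc, h.pauliRefl_mul_eprProj]

/-- An operator that anticommutes with a stabilizer of the EPR state takes it to an orthogonal
state. All outcome probabilities below come from this and its counterpart for z z'. -/
theorem eprProj_mul_mul_eprProj_of_xx {q : 𝓐} (hq : q * (x * x') = -(x * x' * q)) :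
    eprProj x z x' z' * q * eprProj x z x' z' = 0 := by
  have h1 := halfProj_mul_mul_halfProj h.isReflection_xx hq
  have : eprProj x z x' z' * q * eprProj x z x' z' =
      halfProj (z * z') * (halfProj (x * x') * q * halfProj (x * x')) * halfProj (z * z') := by
    rw [eprProj]
    nth_rw 1 [h.commute_halfProj_xx_zz.eq]
    simp only [mul_assoc]
  rw [this, h1, mul_zero, zero_mul]

theorem eprProj_mul_mul_eprProj_of_zz {q : 𝓐} (hq : q * (z * z') = -(z * z' * q)) :
    eprProj x z x' z' * q * eprProj x z x' z' = 0 := by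
  have h1 := halfProj_mul_mul_halfProj h.isReflection_zz hq
  have : eprProj x z x' z' * q * eprProj x z x' z' =
      halfProj (x * x') * (halfProj (z * z') * q * halfProj (z * z')) * halfProj (x * x') := by
    rw [eprProj]
    nth_rw 2 [h.commute_halfProj_xx_zz.eq]
    simp only [mul_assoc]
  rw [this, h1, mul_zero, zero_mul]

theorem eprProj_mul_pauliRefl_mul_eprProj (t : ℝ) :
    eprProj x z x' z' * pauliRefl x z t * eprProj x z x' z' = 0 := by
  rw [pauliRefl, mul_add, add_mul, mul_smul_comm, mul_smul_comm, smul_mul_assoc, smul_mul_assoc,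
    h.eprProj_mul_mul_eprProj_of_xx h.z_mul_xx, h.eprProj_mul_mul_eprProj_of_zz h.x_mul_zz]
  simp

theorem eprProj_mul_pauliProj_mul_eprProj (t : ℝ) (b : Bool) :
    eprProj x z x' z' * pauliProj x z t b * eprProj x z x' z' =
      (1 / 2 : ℂ) • eprProj x z x' z' := by
  rw [pauliProj, halfProj, mul_smul_comm, smul_mul_assoc, mul_add, add_mul, mul_one,
    mul_smul_comm, smul_mul_assoc, h.eprProj_mul_pauliRefl_mul_eprProj,
    h.isStarProjection_eprProj.isIdempotentElem.eq, smul_zero, add_zero]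

/-- The second reflection is moved to the first qubit. The product of two reflections there is a
rotation, a combination of 1 and z x, and z x anticommutes with x x'. -/
theorem eprProj_mul_pauliRefl_mul_pauliRefl_mul_eprProj (t t' : ℝ) :
    eprProj x z x' z' * (pauliRefl x z t * pauliRefl x' z' t') * eprProj x z x' z' =
      ((Real.cos (t - t') : ℝ) : ℂ) • eprProj x z x' z' := by
  rw [mul_assoc, mul_assoc, ← h.pauliRefl_mul_eprProj, ← mul_assoc (pauliRefl x z t),
    ← mul_assoc, pauliRefl_mul_pauliRefl h.left, mul_add, add_mul, mul_smul_comm, mul_smul_comm,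
    smul_mul_assoc, smul_mul_assoc, h.eprProj_mul_mul_eprProj_of_xx h.zx_mul_xx, mul_one,
    h.isStarProjection_eprProj.isIdempotentElem.eq, smul_zero, add_zero]

theorem symm : IsQubitPair x' z' x z where
  left := h.right
  right := h.left
  xx := h.xx.symm
  xz := h.zx.symm
  zx := h.xz.symm
  zz := h.zz.symm

theorem eprProj_symm : eprProj x' z' x z = eprProj x z x' z' := by
  rw [eprProj, eprProj, h.xx.eq, h.zz.eq]

/-- The scalar is the joint probability of the two answers on an EPR pair. As the compression is a
multiple of the EPR projection, it does not depend on the rest of the state. -/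
theorem eprProj_mul_pauliProj_mul_pauliProj_mul_eprProj (t t' : ℝ) (b b' : Bool) :
    eprProj x z x' z' * (pauliProj x z t b * pauliProj x' z' t' b') * eprProj x z x' z' =
      ((1 / 4 * (1 + sgn b * sgn b' * Real.cos (t - t')) : ℝ) : ℂ) • eprProj x z x' z' := by
  have h1 := h.eprProj_mul_pauliRefl_mul_eprProj t
  have h2 := h.symm.eprProj_mul_pauliRefl_mul_eprProj t'
  have h3 := h.eprProj_mul_pauliRefl_mul_pauliRefl_mul_eprProj t t'
  have h4 := h.isStarProjection_eprProj.isIdempotentElem.eq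
  rw [h.eprProj_symm] at h2
  simp only [pauliProj, halfProj, mul_smul_comm, smul_mul_assoc, mul_add,
    add_mul, mul_one, one_mul, h1, h2, h3, h4, smul_zero, add_zero]
  push_cast
  module

end IsQubitPair

end PauliPair

/-! ### Norm estimates near the EPR subspace. -/

section Vectors

variable {H : Type*} [NormedAddCommGroup H] [InnerProductSpace ℂ H] [CompleteSpace H]

theorem clm_mul_apply (f g : H →L[ℂ] H) (v : H) : (f * g) v = f (g v) := rfl

theorem inner_isSelfAdjoint {r : H →L[ℂ] H} (hr : IsSelfAdjoint r) (v w : H) :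
    inner ℂ (r v) w = inner ℂ v (r w) := by
  rw [← ContinuousLinearMap.adjoint_inner_right, ← ContinuousLinearMap.star_eq_adjoint,
    hr.star_eq]

theorem IsReflection.norm_apply {r : H →L[ℂ] H} (hr : IsReflection r) (v : H) :
    ‖r v‖ = ‖v‖ := by
  rw [← sq_eq_sq₀ (norm_nonneg _) (norm_nonneg _), ← inner_self_eq_norm_sq (𝕜 := ℂ),
    ← inner_self_eq_norm_sq (𝕜 := ℂ), inner_isSelfAdjoint hr.isSelfAdjoint,
    ← clm_mul_apply, hr.mul_self]
  rfl

theorem norm_sq_starProjection {p : H →L[ℂ] H} (hp : IsStarProjection p) (v : H) :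
    ‖p v‖ ^ 2 = (inner ℂ v (p v)).re := by
  rw [← inner_self_eq_norm_sq (𝕜 := ℂ), inner_isSelfAdjoint hp.isSelfAdjoint,
    ← clm_mul_apply, hp.isIdempotentElem.eq]
  rfl

theorem norm_sq_add_norm_sq_one_sub {p : H →L[ℂ] H} (hp : IsStarProjection p) (v : H) :
    ‖p v‖ ^ 2 + ‖(1 - p) v‖ ^ 2 = ‖v‖ ^ 2 := by
  rw [norm_sq_starProjection hp, norm_sq_starProjection hp.one_sub, ← Complex.add_re,
    ← inner_add_right, ← add_apply, add_sub_cancel, ← inner_self_eq_norm_sq (𝕜 := ℂ)]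
  rfl

theorem norm_starProjection_le {p : H →L[ℂ] H} (hp : IsStarProjection p) (v : H) :
    ‖p v‖ ≤ ‖v‖ := by
  refine abs_le_of_sq_le_sq' ?_ (norm_nonneg _) |>.2
  nlinarith [norm_sq_add_norm_sq_one_sub hp v, sq_nonneg ‖(1 - p) v‖]

/-- Pythagoras for the orthogonal decomposition 1 − p q = (1 − q) + (1 − p) q. -/
theorem norm_sq_one_sub_mul {p q : H →L[ℂ] H} (hq : IsStarProjection q)
    (h : Commute p q) (v : H) :
    ‖(1 - p * q) v‖ ^ 2 = ‖(1 - q) v‖ ^ 2 + ‖(1 - p) (q v)‖ ^ 2 := by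
  have h1 : q * (1 - p * q) = (1 - p) * q := by
    rw [mul_sub, ← mul_assoc, ← h.eq, mul_assoc, hq.isIdempotentElem.eq, sub_mul, mul_one, one_mul]
  have h2 : (1 - q) * (1 - p * q) = 1 - q := by
    rw [sub_mul, h1, sub_mul, one_mul, one_mul]
    abel
  rw [← norm_sq_add_norm_sq_one_sub hq, ← clm_mul_apply q,
    ← clm_mul_apply (1 - q), h1, h2, add_comm]
  rfl

/-- A scalar compression means that the outcome probability `c` is the same for all vectors in the
range of `e`. -/
theorem norm_sq_mul_eq_of_compress {e a : H →L[ℂ] H} {c : ℝ} (he : IsStarProjection e)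
    (ha : IsStarProjection a) (h : e * a * e = (c : ℂ) • e) (v : H) :
    ‖a (e v)‖ ^ 2 = c * ‖e v‖ ^ 2 := by
  have h1 : inner ℂ (e v) (a (e v)) = inner ℂ v ((e * a * e) v) :=
    inner_isSelfAdjoint he.isSelfAdjoint v (a (e v))
  rw [norm_sq_starProjection ha, h1, h, norm_sq_starProjection he, smul_apply, inner_smul_right,
    Complex.re_ofReal_mul]

variable {x z x' z' : H →L[ℂ] H}

theorem norm_sq_pauliProj_add (h : IsPauliPair x z) (t : ℝ) (v : H) :
    ‖pauliProj x z t false v‖ ^ 2 + ‖pauliProj x z t true v‖ ^ 2 = ‖v‖ ^ 2 := by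
  rw [pauliProj_true, norm_sq_add_norm_sq_one_sub (isStarProjection_pauliProj h t false)]

theorem sum_norm_sq_pauliProj (h : IsPauliPair x z) (θ : Bool → ℝ) (v : H) :
    ∑ p : Bool × Bool, 1 / 2 * ‖pauliProj x z (θ p.1) p.2 v‖ ^ 2 = ‖v‖ ^ 2 := by
  rw [Fintype.sum_prod_type]
  simp only [Fintype.sum_bool]
  have h1 := norm_sq_pauliProj_add h (θ true) v
  have h2 := norm_sq_pauliProj_add h (θ false) v
  linarith

theorem sum_sum_norm_sq_pauliProj (h : IsQubitPair x z x' z') (θ θ' : Bool → ℝ) (v : H) :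
    ∑ p : Bool × Bool, ∑ q : Bool × Bool, 1 / 4 *
      ‖pauliProj x z (θ p.1) p.2 (pauliProj x' z' (θ' q.1) q.2 v)‖ ^ 2 = ‖v‖ ^ 2 := by
  rw [Finset.sum_comm, ← sum_norm_sq_pauliProj h.right θ']
  refine Finset.sum_congr rfl fun q _ => ?_
  rw [← sum_norm_sq_pauliProj h.left θ, Finset.mul_sum]
  refine Finset.sum_congr rfl fun p _ => ?_
  ring

namespace IsQubitPair

variable (h : IsQubitPair x z x' z')
include h

theorem norm_one_sub_halfProj_xx (v : H) : ‖(1 - halfProj (x * x')) v‖ = 1 / 2 * ‖(x - x') v‖ := by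
  have h1 : (x - x') v = (2 : ℂ) • x ((1 - halfProj (x * x')) v) := by
    have : x - x' = (2 : ℂ) • (x * (1 - halfProj (x * x'))) := by
      simp only [halfProj, mul_sub, mul_one, mul_smul_comm, mul_add, ← mul_assoc,
        h.left.isReflection_x.mul_self, one_mul]
      module
    rw [this]
    rfl
  rw [h1, norm_smul, h.left.isReflection_x.norm_apply]
  simp

theorem norm_one_sub_halfProj_zz (v : H) : ‖(1 - halfProj (z * z')) v‖ = 1 / 2 * ‖(z - z') v‖ := by
  have h1 : (z - z') v = (2 : ℂ) • z ((1 - halfProj (z * z')) v) := by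
    have : z - z' = (2 : ℂ) • (z * (1 - halfProj (z * z'))) := by
      simp only [halfProj, mul_sub, mul_one, mul_smul_comm, mul_add, ← mul_assoc,
        h.left.isReflection_z.mul_self, one_mul]
      module
    rw [this]
    rfl
  rw [h1, norm_smul, h.left.isReflection_z.norm_apply]
  simp

theorem norm_sq_one_sub_eprProj (v : H) :
    ‖(1 - eprProj x z x' z') v‖ ^ 2 = ‖(1 - halfProj (z * z')) v‖ ^ 2 +
      ‖(1 - halfProj (x * x')) (halfProj (z * z') v)‖ ^ 2 :=
  norm_sq_one_sub_mul h.isReflection_zz.isStarProjection h.commute_halfProj_xx_zz v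

theorem norm_sq_one_sub_eprProj_le_add (v : H) :
    ‖(1 - eprProj x z x' z') v‖ ^ 2 ≤ ‖(1 - halfProj (z * z')) v‖ ^ 2 +
      ‖(1 - halfProj (x * x')) v‖ ^ 2 := by
  rw [h.norm_sq_one_sub_eprProj]
  have h1 : (1 - halfProj (x * x')) (halfProj (z * z') v) =
      halfProj (z * z') ((1 - halfProj (x * x')) v) := by
    have : Commute (1 - halfProj (x * x')) (halfProj (z * z')) :=
      (Commute.one_left _).sub_left h.commute_halfProj_xx_zz
    exact DFunLike.congr_fun this.eq v
  rw [h1]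
  gcongr
  exact norm_starProjection_le h.isReflection_zz.isStarProjection _

/-- Together with `norm_sq_z_sub_le` and `norm_sq_x_sub_le` this trades the distance to the EPR
subspace for differences of operators of the two provers. In those the dependence on the two
transcripts is separated, as the Poincaré inequality requires. -/
theorem norm_sq_one_sub_eprProj_le (v : H) :
    ‖(1 - eprProj x z x' z') v‖ ^ 2 ≤ 1 / 4 * (‖(x - x') v‖ ^ 2 + ‖(z - z') v‖ ^ 2) := by
  refine (h.norm_sq_one_sub_eprProj_le_add v).trans_eq ?_
  rw [h.norm_one_sub_halfProj_xx, h.norm_one_sub_halfProj_zz]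
  ring

theorem norm_sq_z_sub_le (v : H) : ‖(z - z') v‖ ^ 2 ≤ 4 * ‖(1 - eprProj x z x' z') v‖ ^ 2 := by
  rw [h.norm_sq_one_sub_eprProj, h.norm_one_sub_halfProj_zz]
  nlinarith [sq_nonneg ‖(1 - halfProj (x * x')) (halfProj (z * z') v)‖]

theorem norm_sq_x_sub_le (v : H) : ‖(x - x') v‖ ^ 2 ≤ 4 * ‖(1 - eprProj x z x' z') v‖ ^ 2 := by
  rw [eprProj, h.commute_halfProj_xx_zz.eq,
    norm_sq_one_sub_mul h.isReflection_xx.isStarProjection h.commute_halfProj_xx_zz.symm,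
    h.norm_one_sub_halfProj_xx]
  nlinarith [sq_nonneg ‖(1 - halfProj (z * z')) (halfProj (x * x') v)‖]

theorem sum_norm_sq_pauliProj_sub_le (θ : Bool → ℝ) (v : H) :
    ∑ p : Bool × Bool, 1 / 2 *
      ‖pauliProj x z (θ p.1) p.2 v - pauliProj x' z' (θ p.1) p.2 v‖ ^ 2 ≤
      4 * ‖(1 - eprProj x z x' z') v‖ ^ 2 := by
  set w := (1 - eprProj x z x' z') v with hw
  -- On the EPR component the two measurements agree, so only the defect `w` contributes.
  have h1 : ∀ p : Bool × Bool, pauliProj x z (θ p.1) p.2 v - pauliProj x' z' (θ p.1) p.2 v =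
      pauliProj x z (θ p.1) p.2 w - pauliProj x' z' (θ p.1) p.2 w := by
    intro p
    have := DFunLike.congr_fun (h.pauliProj_mul_eprProj (θ p.1) p.2) v
    simp only [clm_mul_apply] at this
    rw [hw, sub_apply, one_apply_eq_self, map_sub, map_sub, this]
    abel
  simp_rw [h1]
  calc ∑ p : Bool × Bool, 1 / 2 *
        ‖pauliProj x z (θ p.1) p.2 w - pauliProj x' z' (θ p.1) p.2 w‖ ^ 2
      ≤ ∑ p : Bool × Bool, (2 * (1 / 2 * ‖pauliProj x z (θ p.1) p.2 w‖ ^ 2) +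
          2 * (1 / 2 * ‖pauliProj x' z' (θ p.1) p.2 w‖ ^ 2)) := by
        refine Finset.sum_le_sum fun p _ => ?_
        have := pow_le_pow_left₀ (norm_nonneg _) (norm_sub_le (pauliProj x z (θ p.1) p.2 w)
          (pauliProj x' z' (θ p.1) p.2 w)) 2
        nlinarith [sq_nonneg (‖pauliProj x z (θ p.1) p.2 w‖ - ‖pauliProj x' z' (θ p.1) p.2 w‖)]
    _ = 4 * ‖w‖ ^ 2 := by
        rw [Finset.sum_add_distrib, ← Finset.mul_sum Finset.univ _ (2 : ℝ), ← Finset.mul_sum Finset.univ _ (2 : ℝ),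
          sum_norm_sq_pauliProj h.left, sum_norm_sq_pauliProj h.right]
        ring

/-- A vector with nearly maximal CHSH correlation is close to the range of the EPR projection. -/
theorem norm_sq_one_sub_eprProj_le_of_correlation {v : H} {ε : ℝ} (hε : 0 ≤ ε)
    (hv : (2 * √2 - ε) * ‖v‖ ^ 2 ≤ √2 * (inner ℂ v ((x * x' + z * z') v)).re) :
    ‖(1 - eprProj x z x' z') v‖ ^ 2 ≤ ε * ‖v‖ ^ 2 := by
  have key : ∀ r : H →L[ℂ] H, IsReflection r →
      ‖(1 - halfProj r) v‖ ^ 2 = 1 / 2 * (‖v‖ ^ 2 - (inner ℂ v (r v)).re) := by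
    intro r hr
    rw [norm_sq_starProjection hr.isStarProjection.one_sub, ← inner_self_eq_norm_sq (𝕜 := ℂ),
      RCLike.re_to_complex, ← Complex.sub_re, ← inner_sub_right]
    have : (1 - halfProj r) v = ((1 / 2 : ℝ) : ℂ) • (v - r v) := by
      have : 1 - halfProj r = ((1 / 2 : ℝ) : ℂ) • (1 - r) := by
        simp only [halfProj]
        push_cast
        module
      rw [this]
      rfl
    rw [this, inner_smul_right, Complex.re_ofReal_mul]
  refine (h.norm_sq_one_sub_eprProj_le_add v).trans ?_
  rw [key _ h.isReflection_xx, key _ h.isReflection_zz]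
  rw [add_apply, inner_add_right, Complex.add_re] at hv
  -- The argument would give the constant ε / (2√2); the cruder ε suffices.
  have h2 : (1 : ℝ) ≤ √2 := Real.one_le_sqrt.2 (by norm_num)
  have h3 : √2 * (2 * ‖v‖ ^ 2 - ((inner ℂ v ((x * x') v)).re + (inner ℂ v ((z * z') v)).re)) ≤
      √2 * (2 * (ε * ‖v‖ ^ 2)) := by
    have : 0 ≤ ε * ‖v‖ ^ 2 := by positivity
    nlinarith
  have := le_of_mul_le_mul_left h3 (by linarith)
  linarith

end IsQubitPair

end Vectors

/-! ### Trees of qubits whose locations depend on the transcript. -/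

section Trees

/-- The Pauli operators encountered before game `k` along the transcript `h`. -/
def pathGens {𝓐 : Type*} (X Z : (k : ℕ) → Hist k → 𝓐) : (k : ℕ) → Hist k → Set 𝓐
  | 0, _ => ∅
  | k + 1, h => {X k (Fin.init h), Z k (Fin.init h)} ∪ pathGens X Z k (Fin.init h)

theorem exists_of_mem_pathGens {𝓐 : Type*} {X Z : (k : ℕ) → Hist k → 𝓐} {k : ℕ} {h : Hist k}
    {g : 𝓐} (hg : g ∈ pathGens X Z k h) : ∃ j h', g = X j h' ∨ g = Z j h' := by
  induction k with
  | zero => exact hg.elim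
  | succ k ih =>
    rcases hg with (hg | hg) | hg
    · exact ⟨k, _, Or.inl hg⟩
    · exact ⟨k, _, Or.inr hg⟩
    · exact ih hg

/-- The qubits of one prover, where the location of each qubit depends on the transcript of the
earlier games, and the qubits along one transcript commute. -/
structure PauliTree (n : ℕ) (𝓐 : Type*) [Ring 𝓐] [StarRing 𝓐] where
  X : (k : ℕ) → Hist k → 𝓐
  Z : (k : ℕ) → Hist k → 𝓐
  isPauliPair : ∀ k, k < n → ∀ h, IsPauliPair (X k h) (Z k h)
  commute_path : ∀ k, k < n → ∀ h, ∀ g ∈ pathGens X Z k h,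
    Commute g (X k h) ∧ Commute g (Z k h)

namespace PauliTree

variable {n : ℕ} {𝓐 : Type*} [Ring 𝓐] [StarRing 𝓐]

theorem pathGens_fix (X Z : (k : ℕ) → Hist k → 𝓐) (g : Hist n) (k : ℕ) (h : Hist k) :
    pathGens (fun k _ => X k (g.prefix k)) (fun k _ => Z k (g.prefix k)) k h =
      pathGens X Z k (g.prefix k) := by
  induction k with
  | zero => rfl
  | succ k ih => rw [pathGens, pathGens, ih, Hist.init_prefix]

/-- The tree of qubits whose locations are fixed to be those along the transcript `g`. -/
def fix (T : PauliTree n 𝓐) (g : Hist n) : PauliTree n 𝓐 where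
  X k _ := T.X k (g.prefix k)
  Z k _ := T.Z k (g.prefix k)
  isPauliPair k hk _ := T.isPauliPair k hk _
  commute_path k hk h y hy := T.commute_path k hk _ y (by rwa [pathGens_fix] at hy)

/-- The qubits of two provers commute. -/
structure Independent (A B : PauliTree n 𝓐) : Prop where
  xx : ∀ j k hA hB, Commute (A.X j hA) (B.X k hB)
  xz : ∀ j k hA hB, Commute (A.X j hA) (B.Z k hB)
  zx : ∀ j k hA hB, Commute (A.Z j hA) (B.X k hB)
  zz : ∀ j k hA hB, Commute (A.Z j hA) (B.Z k hB)

theorem Independent.symm {A B : PauliTree n 𝓐} (h : A.Independent B) : B.Independent A where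
  xx _ _ _ _ := (h.xx _ _ _ _).symm
  xz _ _ _ _ := (h.zx _ _ _ _).symm
  zx _ _ _ _ := (h.xz _ _ _ _).symm
  zz _ _ _ _ := (h.zz _ _ _ _).symm

theorem Independent.fix_left {A B : PauliTree n 𝓐} (h : A.Independent B) (g : Hist n) :
    (A.fix g).Independent B where
  xx _ _ _ _ := h.xx _ _ _ _
  xz _ _ _ _ := h.xz _ _ _ _
  zx _ _ _ _ := h.zx _ _ _ _
  zz _ _ _ _ := h.zz _ _ _ _

theorem Independent.fix_right {A B : PauliTree n 𝓐} (h : A.Independent B) (g : Hist n) :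
    A.Independent (B.fix g) := (h.symm.fix_left g).symm

theorem Independent.isQubitPair {A B : PauliTree n 𝓐} (h : A.Independent B) {k : ℕ} (hk : k < n)
    (hA hB : Hist k) : IsQubitPair (A.X k hA) (A.Z k hA) (B.X k hB) (B.Z k hB) where
  left := A.isPauliPair k hk hA
  right := B.isPauliPair k hk hB
  xx := h.xx _ _ _ _
  xz := h.xz _ _ _ _
  zx := h.zx _ _ _ _
  zz := h.zz _ _ _ _

/-- `y` commutes with the qubits along the transcript `h`. -/
def CommutesAlong (T : PauliTree n 𝓐) (k : ℕ) (h : Hist k) (y : 𝓐) : Prop :=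
  ∀ g ∈ pathGens T.X T.Z k h, Commute g y

theorem CommutesAlong.of_forall {T : PauliTree n 𝓐} {y : 𝓐}
    (hX : ∀ j h, Commute (T.X j h) y) (hZ : ∀ j h, Commute (T.Z j h) y) (k : ℕ) (h : Hist k) :
    T.CommutesAlong k h y := by
  intro g hg
  obtain ⟨j, h', rfl | rfl⟩ := exists_of_mem_pathGens hg
  · exact hX _ _
  · exact hZ _ _

variable [Algebra ℂ 𝓐] [StarModule ℂ 𝓐]

/-- The projection for question `p.1` and answer `p.2` in game `k`, if the questions are measured
along the directions `θ`. -/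
def proj (T : PauliTree n 𝓐) (θ : Bool → ℝ) (k : ℕ) (h : Hist k) (p : Bool × Bool) : 𝓐 :=
  pauliProj (T.X k h) (T.Z k h) (θ p.1) p.2

/-- The product of the projections along a transcript. -/
def run (T : PauliTree n 𝓐) (θ : Bool → ℝ) : (k : ℕ) → Hist k → 𝓐
  | 0, _ => 1
  | k + 1, h => T.proj θ k (Fin.init h) (h (Fin.last k)) * T.run θ k (Fin.init h)

theorem run_snoc (T : PauliTree n 𝓐) (θ : Bool → ℝ) (k : ℕ) (h : Hist k) (p : Bool × Bool) :
    T.run θ (k + 1) (h.snoc p) = T.proj θ k h p * T.run θ k h := by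
  simp [run]

/-- The EPR projection for the two provers' qubits in game `k`. -/
def eprAt (A B : PauliTree n 𝓐) (k : ℕ) (hA hB : Hist k) : 𝓐 :=
  eprProj (A.X k hA) (A.Z k hA) (B.X k hB) (B.Z k hB)

/-- The product of the EPR projections for the first `k` games along a pair of transcripts. -/
def eprPath (A B : PauliTree n 𝓐) : (k : ℕ) → Hist k → Hist k → 𝓐
  | 0, _, _ => 1
  | k + 1, hA, hB =>
    eprAt A B k (Fin.init hA) (Fin.init hB) * eprPath A B k (Fin.init hA) (Fin.init hB)

theorem eprPath_snoc (A B : PauliTree n 𝓐) (k : ℕ) (hA hB : Hist k) (p q : Bool × Bool) :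
    eprPath A B (k + 1) (hA.snoc p) (hB.snoc q) = eprAt A B k hA hB * eprPath A B k hA hB := by
  simp [eprPath]

theorem CommutesAlong.commute_run {T : PauliTree n 𝓐} {k : ℕ} {h : Hist k} {y : 𝓐}
    (hy : T.CommutesAlong k h y) (θ : Bool → ℝ) : Commute (T.run θ k h) y := by
  induction k with
  | zero => exact Commute.one_left y
  | succ k ih =>
    refine Commute.mul_left ?_ (ih fun g hg => hy g (Or.inr hg))
    exact (commute_pauliProj (hy _ (Or.inl (Or.inl rfl))).symm
      (hy _ (Or.inl (Or.inr rfl))).symm _ _).symm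

theorem CommutesAlong.commute_eprPath {A B : PauliTree n 𝓐} {k : ℕ} {hA hB : Hist k} {y : 𝓐}
    (hyA : A.CommutesAlong k hA y) (hyB : B.CommutesAlong k hB y) :
    Commute (eprPath A B k hA hB) y := by
  induction k with
  | zero => exact Commute.one_left y
  | succ k ih =>
    refine Commute.mul_left ?_ (ih (fun g hg => hyA g (Or.inr hg)) fun g hg => hyB g (Or.inr hg))
    exact (commute_eprProj (hyA _ (Or.inl (Or.inl rfl))).symm (hyA _ (Or.inl (Or.inr rfl))).symm
      (hyB _ (Or.inl (Or.inl rfl))).symm (hyB _ (Or.inl (Or.inr rfl))).symm).symm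

theorem commutesAlong_X (T : PauliTree n 𝓐) {k : ℕ} (hk : k < n) (h : Hist k) :
    T.CommutesAlong k h (T.X k h) := fun g hg => (T.commute_path k hk h g hg).1

theorem commutesAlong_Z (T : PauliTree n 𝓐) {k : ℕ} (hk : k < n) (h : Hist k) :
    T.CommutesAlong k h (T.Z k h) := fun g hg => (T.commute_path k hk h g hg).2

namespace Independent

variable {A B : PauliTree n 𝓐} (hAB : A.Independent B)
include hAB

theorem commutesAlong_X (k j : ℕ) (h : Hist k) (h' : Hist j) :
    A.CommutesAlong k h (B.X j h') :=
  .of_forall (fun _ _ => hAB.xx _ _ _ _) (fun _ _ => hAB.zx _ _ _ _) k h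

theorem commutesAlong_Z (k j : ℕ) (h : Hist k) (h' : Hist j) :
    A.CommutesAlong k h (B.Z j h') :=
  .of_forall (fun _ _ => hAB.xz _ _ _ _) (fun _ _ => hAB.zz _ _ _ _) k h

theorem epr_symm {k : ℕ} (hk : k < n) (hA hB : Hist k) : eprAt B A k hB hA = eprAt A B k hA hB :=
  (hAB.isQubitPair hk hA hB).eprProj_symm

theorem commute_run_epr (θ : Bool → ℝ) {k : ℕ} (hk : k < n) (hA hB : Hist k) :
    Commute (A.run θ k hA) (eprAt A B k hA hB) :=
  commute_eprProj ((A.commutesAlong_X hk hA).commute_run θ)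
    ((A.commutesAlong_Z hk hA).commute_run θ)
    ((hAB.commutesAlong_X k k hA hB).commute_run θ) ((hAB.commutesAlong_Z k k hA hB).commute_run θ)

theorem commute_run_proj (θ θ' : Bool → ℝ) (k j : ℕ) (hA : Hist k) (hB : Hist j)
    (q : Bool × Bool) : Commute (A.run θ k hA) (B.proj θ' j hB q) :=
  commute_pauliProj ((hAB.commutesAlong_X k j hA hB).commute_run θ)
    ((hAB.commutesAlong_Z k j hA hB).commute_run θ) _ _

theorem commute_eprPath_epr {k : ℕ} (hk : k < n) (hA hB : Hist k) :
    Commute (eprPath A B k hA hB) (eprAt A B k hA hB) :=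
  commute_eprProj
    ((A.commutesAlong_X hk hA).commute_eprPath (hAB.symm.commutesAlong_X k k hB hA))
    ((A.commutesAlong_Z hk hA).commute_eprPath (hAB.symm.commutesAlong_Z k k hB hA))
    ((hAB.commutesAlong_X k k hA hB).commute_eprPath (B.commutesAlong_X hk hB))
    ((hAB.commutesAlong_Z k k hA hB).commute_eprPath (B.commutesAlong_Z hk hB))

theorem isStarProjection_epr {k : ℕ} (hk : k < n) (hA hB : Hist k) :
    IsStarProjection (eprAt A B k hA hB) :=
  (hAB.isQubitPair hk hA hB).isStarProjection_eprProj

theorem isStarProjection_eprPath {k : ℕ} (hk : k ≤ n) (hA hB : Hist k) :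
    IsStarProjection (eprPath A B k hA hB) := by
  induction k with
  | zero => exact IsStarProjection.one _
  | succ k ih =>
    exact (hAB.isStarProjection_epr hk _ _).mul (ih (Nat.le_of_succ_le hk) _ _)
      (hAB.commute_eprPath_epr hk _ _).symm

end Independent

end PauliTree

end Trees

/-! ### Both provers play: from the true transcript law to independent uniform transcripts. -/

section Joint

open PauliTree

theorem sum_sum_norm_add_sq_le {E ι κ : Type*} [SeminormedAddCommGroup E] [Fintype ι] [Fintype κ]
    {w : ι → κ → ℝ} (hw : ∀ i j, 0 ≤ w i j) {u v : ι → κ → E} {a b : ℝ} (ha : 0 ≤ a) (hb : 0 ≤ b)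
    (hu : ∑ i, ∑ j, w i j * ‖u i j‖ ^ 2 ≤ a ^ 2) (hv : ∑ i, ∑ j, w i j * ‖v i j‖ ^ 2 ≤ b ^ 2) :
    ∑ i, ∑ j, w i j * ‖u i j + v i j‖ ^ 2 ≤ (a + b) ^ 2 := by
  have := sum_norm_add_sq_le (ι := ι × κ) (w := fun p => w p.1 p.2) (u := fun p => u p.1 p.2)
    (v := fun p => v p.1 p.2) (fun p => hw _ _) ha hb
    (by rwa [Fintype.sum_prod_type]) (by rwa [Fintype.sum_prod_type])
  rwa [Fintype.sum_prod_type] at this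

variable {n : ℕ} {H : Type*} [NormedAddCommGroup H] [InnerProductSpace ℂ H] [CompleteSpace H]
  {A B : PauliTree n (H →L[ℂ] H)} (θ θ' : Bool → ℝ)

/-- The distribution of the questions and answers `p`, `q` of one game on an EPR state. -/
def gameDist (p q : Bool × Bool) : ℝ :=
  1 / 16 * (1 + sgn p.2 * sgn q.2 * Real.cos (θ p.1 - θ' q.1))

theorem sum_gameDist_right (p : Bool × Bool) : ∑ q, gameDist θ θ' p q = 1 / 4 := by
  obtain ⟨a, x⟩ := p
  cases x <;> simp [gameDist, Fintype.sum_prod_type, sgn] <;> ring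

theorem sum_gameDist_left (q : Bool × Bool) : ∑ p, gameDist θ θ' p q = 1 / 4 := by
  obtain ⟨b, y⟩ := q
  cases y <;> simp [gameDist, Fintype.sum_prod_type, sgn] <;> ring

theorem abs_sgn (b : Bool) : |sgn b| = 1 := by
  cases b <;> simp [sgn]

/-- If some cosine were ±1, certain pairs of answers would never occur and no Poincaré inequality
would be available. The bound 3/4 leaves 1/16 · 1/4. -/
theorem le_gameDist (hθ : ∀ a b, |Real.cos (θ a - θ' b)| ≤ 3 / 4) (p q : Bool × Bool) :
    1 / 64 ≤ gameDist θ θ' p q := by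
  have h1 : |sgn p.2 * sgn q.2 * Real.cos (θ p.1 - θ' q.1)| ≤ 3 / 4 := by
    rw [abs_mul, abs_mul, abs_sgn, abs_sgn, one_mul, one_mul]
    exact hθ _ _
  have := neg_le_of_abs_le h1
  rw [gameDist]
  linarith

variable {θ θ'} (hAB : A.Independent B)
include hAB

theorem joint_run_snoc {k : ℕ} (hA hB : Hist k) (p q : Bool × Bool) (v : H) :
    A.run θ (k + 1) (hA.snoc p) (B.run θ' (k + 1) (hB.snoc q) v) =
      A.proj θ k hA p (B.proj θ' k hB q (A.run θ k hA (B.run θ' k hB v))) := by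
  rw [run_snoc, run_snoc]
  have := DFunLike.congr_fun (hAB.commute_run_proj θ θ' k k hA hB q).eq (B.run θ' k hB v)
  simp only [clm_mul_apply] at this ⊢
  rw [this]

/-- The vector may depend on the transcript of the earlier games: summing over the last game only
uses that its projections resolve the identity for each question. -/
theorem sum_joint_run_succ {k : ℕ} (hk : k < n) (v : Hist k → Hist k → H) :
    ∑ hA : Hist (k + 1), ∑ hB : Hist (k + 1), (1 / 4) ^ (k + 1) *
        ‖A.run θ (k + 1) hA (B.run θ' (k + 1) hB (v (Fin.init hA) (Fin.init hB)))‖ ^ 2 =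
      ∑ hA, ∑ hB, (1 / 4) ^ k * ‖A.run θ k hA (B.run θ' k hB (v hA hB))‖ ^ 2 := by
  rw [sum_hist_pair_succ]
  refine Finset.sum_congr rfl fun hA _ => Finset.sum_congr rfl fun hB _ => ?_
  rw [← sum_sum_norm_sq_pauliProj (hAB.isQubitPair hk hA hB) θ θ']
  simp_rw [Finset.mul_sum, joint_run_snoc hAB, Hist.init_snoc, pow_succ, mul_assoc]
  rfl

theorem sum_joint_run {k : ℕ} (hk : k ≤ n) (v : H) :
    ∑ hA, ∑ hB, (1 / 4) ^ k * ‖A.run θ k hA (B.run θ' k hB v)‖ ^ 2 = ‖v‖ ^ 2 := by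
  induction k with
  | zero => simp [run]
  | succ k ih =>
    rw [sum_joint_run_succ hAB hk fun _ _ => v, ih (Nat.le_of_succ_le hk)]

theorem commute_epr_joint {k : ℕ} (hk : k < n) (hA hB : Hist k) :
    Commute (A.run θ k hA * B.run θ' k hB) (eprAt A B k hA hB) := by
  refine Commute.mul_left (hAB.commute_run_epr θ hk hA hB) ?_
  rw [← hAB.epr_symm hk]
  exact hAB.symm.commute_run_epr θ' hk hB hA

theorem joint_run_epr {k : ℕ} (hk : k < n) (hA hB : Hist k) (v : H) :
    A.run θ k hA (B.run θ' k hB (eprAt A B k hA hB v)) =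
      eprAt A B k hA hB (A.run θ k hA (B.run θ' k hB v)) :=
  DFunLike.congr_fun (commute_epr_joint hAB hk hA hB).eq v

theorem eprPath_epr {k : ℕ} (hk : k < n) (hA hB : Hist k) (v : H) :
    eprPath A B k hA hB (eprAt A B k hA hB v) = eprAt A B k hA hB (eprPath A B k hA hB v) :=
  DFunLike.congr_fun (hAB.commute_eprPath_epr hk hA hB).eq v

/-- The EPR projection of each game commutes with all earlier measurements, so it still acts as a
constraint when that game is played. The answers then have the exact EPR law, and the probabilities
multiply. -/
theorem joint_run_eprPath {k : ℕ} (hk : k ≤ n) (hA hB : Hist k) (w : H) :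
    (1 / 4) ^ k * ‖A.run θ k hA (B.run θ' k hB (eprPath A B k hA hB w))‖ ^ 2 =
      prodDist (gameDist θ θ') k hA hB * ‖eprPath A B k hA hB w‖ ^ 2 := by
  induction k generalizing w with
  | zero => simp [run, eprPath, prodDist]
  | succ k ih =>
    obtain ⟨hA, p, rfl⟩ : ∃ h p, hA = Hist.snoc h p :=
      ⟨Fin.init hA, hA (Fin.last k), (Fin.snoc_init_self hA).symm⟩
    obtain ⟨hB, q, rfl⟩ : ∃ h p, hB = Hist.snoc h p :=
      ⟨Fin.init hB, hB (Fin.last k), (Fin.snoc_init_self hB).symm⟩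
    have hp := hAB.isQubitPair hk hA hB
    rw [joint_run_snoc hAB, eprPath_snoc, prodDist_snoc, clm_mul_apply, joint_run_epr hAB hk]
    set u := A.run θ k hA (B.run θ' k hB (eprPath A B k hA hB w)) with hu
    -- `gameDist` includes the probability 1/4 of the pair of questions; the factor 4 conditions on
    -- them.
    have h1 : ‖A.proj θ k hA p (B.proj θ' k hB q (eprAt A B k hA hB u))‖ ^ 2 =
        4 * gameDist θ θ' p q * ‖eprAt A B k hA hB u‖ ^ 2 := by
      have hc : Commute (pauliProj (A.X k hA) (A.Z k hA) (θ p.1) p.2)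
          (pauliProj (B.X k hB) (B.Z k hB) (θ' q.1) q.2) :=
        commute_pauliProj (commute_pauliProj hp.xx.symm hp.zx.symm _ _).symm
          (commute_pauliProj hp.xz.symm hp.zz.symm _ _).symm _ _
      have := norm_sq_mul_eq_of_compress hp.isStarProjection_eprProj
        ((isStarProjection_pauliProj hp.left (θ p.1) p.2).mul
          (isStarProjection_pauliProj hp.right (θ' q.1) q.2) hc)
        (hp.eprProj_mul_pauliProj_mul_pauliProj_mul_eprProj (θ p.1) (θ' q.1) p.2 q.2) u
      refine Eq.trans this ?_
      rw [gameDist, eprAt]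
      ring
    have h2 : eprAt A B k hA hB u =
        A.run θ k hA (B.run θ' k hB (eprPath A B k hA hB (eprAt A B k hA hB w))) := by
      rw [eprPath_epr hAB hk, joint_run_epr hAB hk]
    have h3 := ih (Nat.le_of_succ_le hk) hA hB (eprAt A B k hA hB w)
    rw [← h2, eprPath_epr hAB hk] at h3
    rw [h1, pow_succ]
    linear_combination gameDist θ θ' p q * h3

variable {ψ : H} {a : ℝ} (ha : 0 ≤ a)
  (hS : ∀ k < n, ∑ hA, ∑ hB, (1 / 4) ^ k *
    ‖(1 - eprAt A B k hA hB) (A.run θ k hA (B.run θ' k hB ψ))‖ ^ 2 ≤ a ^ 2)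
include ha hS

/-- Telescoping: with R the measurements so far, E the EPR projection of game k and Q the product of
the earlier ones, R(1 − E Q) = E R(1 − Q) + (1 − E)R. Each game adds at most `a` to the L² error. -/
theorem sum_joint_run_one_sub_eprPath_le {k : ℕ} (hk : k ≤ n) :
    ∑ hA, ∑ hB, (1 / 4) ^ k *
      ‖A.run θ k hA (B.run θ' k hB ((1 - eprPath A B k hA hB) ψ))‖ ^ 2 ≤ (k * a) ^ 2 := by
  induction k with
  | zero => simp [run, eprPath]
  | succ k ih =>
    have h0 := sum_joint_run_succ hAB (θ := θ) (θ' := θ') hk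
      (fun hA hB => (1 - eprAt A B k hA hB * eprPath A B k hA hB) ψ)
    refine (le_of_eq h0).trans ?_
    have h1 : ∀ hA hB, A.run θ k hA (B.run θ' k hB
        ((1 - eprAt A B k hA hB * eprPath A B k hA hB) ψ)) =
        eprAt A B k hA hB (A.run θ k hA (B.run θ' k hB ((1 - eprPath A B k hA hB) ψ))) +
          (1 - eprAt A B k hA hB) (A.run θ k hA (B.run θ' k hB ψ)) := by
      intro hA hB
      rw [← joint_run_epr hAB hk]
      simp only [sub_apply, one_apply_eq_self, clm_mul_apply, map_sub]
      rw [← joint_run_epr hAB hk]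
      abel
    simp_rw [h1]
    refine (sum_sum_norm_add_sq_le (fun _ _ => by positivity) (by positivity : 0 ≤ k * a) ha
      (le_trans ?_ (ih (Nat.le_of_succ_le hk))) (hS k hk)).trans_eq ?_
    · gcongr
      exact norm_starProjection_le (hAB.isStarProjection_epr hk _ _) _
    · push_cast
      ring

/-- By `joint_run_eprPath` the weight `prodDist` can be replaced by the measurements themselves.
Replacing Q ψ by ψ inside them costs k a, and the hypothesis on game k costs a. -/
theorem sum_prodDist_one_sub_epr_eprPath_le {k : ℕ} (hk : k < n) :
    ∑ hA, ∑ hB, prodDist (gameDist θ θ') k hA hB *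
      ‖(1 - eprAt A B k hA hB) (eprPath A B k hA hB ψ)‖ ^ 2 ≤ ((k + 1) * a) ^ 2 := by
  have h1 : ∀ hA hB, prodDist (gameDist θ θ') k hA hB *
      ‖(1 - eprAt A B k hA hB) (eprPath A B k hA hB ψ)‖ ^ 2 =
      (1 / 4) ^ k * ‖(eprAt A B k hA hB - 1)
        (A.run θ k hA (B.run θ' k hB ((1 - eprPath A B k hA hB) ψ))) +
        (1 - eprAt A B k hA hB) (A.run θ k hA (B.run θ' k hB ψ))‖ ^ 2 := by
    intro hA hB
    have e1 : (1 - eprAt A B k hA hB) (eprPath A B k hA hB ψ) =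
        eprPath A B k hA hB ((1 - eprAt A B k hA hB) ψ) := by
      simp only [sub_apply, one_apply_eq_self, map_sub, eprPath_epr hAB hk]
    rw [e1, ← joint_run_eprPath hAB hk.le]
    congr 3
    simp only [sub_apply, one_apply_eq_self, map_sub, eprPath_epr hAB hk, joint_run_epr hAB hk]
    abel
  simp_rw [h1]
  refine (sum_sum_norm_add_sq_le (fun _ _ => by positivity) (by positivity : 0 ≤ k * a) ha
      (le_trans ?_ (sum_joint_run_one_sub_eprPath_le hAB ha hS hk.le)) (hS k hk)).trans_eq ?_
  · gcongr with hA _ hB _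
    rw [← neg_sub, neg_apply, norm_neg]
    exact norm_starProjection_le (hAB.isStarProjection_epr hk _ _).one_sub _
  · ring

variable (hθ : ∀ a b, |Real.cos (θ a - θ' b)| ≤ 3 / 4)
include hθ

/-- Here no measurement acts on ψ any more. By Pythagoras the squared errors of the games add, and
k³ + (k + 1)² ≤ (k + 1)³. -/
theorem sum_prodDist_one_sub_eprPath_le {k : ℕ} (hk : k ≤ n) :
    ∑ hA, ∑ hB, prodDist (gameDist θ θ') k hA hB * ‖(1 - eprPath A B k hA hB) ψ‖ ^ 2 ≤
      k ^ 3 * a ^ 2 := by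
  induction k with
  | zero => simp [eprPath]
  | succ k ih =>
    rw [sum_hist_pair_succ]
    have h1 : ∀ hA hB : Hist k, ∑ p, ∑ q, prodDist (gameDist θ θ') (k + 1) (hA.snoc p) (hB.snoc q) *
        ‖(1 - eprPath A B (k + 1) (hA.snoc p) (hB.snoc q)) ψ‖ ^ 2 =
        prodDist (gameDist θ θ') k hA hB * ‖(1 - eprPath A B k hA hB) ψ‖ ^ 2 +
        prodDist (gameDist θ θ') k hA hB *
          ‖(1 - eprAt A B k hA hB) (eprPath A B k hA hB ψ)‖ ^ 2 := by
      intro hA hB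
      have hm : ∑ p, ∑ q, gameDist θ θ' p q = 1 := by
        simp_rw [sum_gameDist_right]
        simp
      simp_rw [prodDist_snoc, eprPath_snoc,
        norm_sq_one_sub_mul (hAB.isStarProjection_eprPath (Nat.le_of_succ_le hk) hA hB)
          (hAB.commute_eprPath_epr hk hA hB).symm ψ, ← Finset.sum_mul, ← Finset.mul_sum, hm]
      ring
    simp_rw [h1, Finset.sum_add_distrib]
    refine (add_le_add (ih (Nat.le_of_succ_le hk))
      (sum_prodDist_one_sub_epr_eprPath_le hAB ha hS hk)).trans ?_
    push_cast
    have : (0 : ℝ) ≤ (2 * k ^ 2 + k) * a ^ 2 := by positivity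
    linarith

/-- Leaving the range of one EPR projection entails leaving the range of its product with the
earlier ones, and the latter defect splits by Pythagoras. -/
theorem sum_prodDist_one_sub_epr_le {k : ℕ} (hk : k < n) :
    ∑ hA, ∑ hB, prodDist (gameDist θ θ') k hA hB * ‖(1 - eprAt A B k hA hB) ψ‖ ^ 2 ≤
      (k + 1) ^ 3 * a ^ 2 := by
  have h0 : ∀ p q, 0 ≤ gameDist θ θ' p q := fun p q =>
    le_trans (by norm_num) (le_gameDist θ θ' hθ p q)
  have h1 : ∀ hA hB : Hist k, prodDist (gameDist θ θ') k hA hB * ‖(1 - eprAt A B k hA hB) ψ‖ ^ 2 ≤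
      prodDist (gameDist θ θ') k hA hB * ‖(1 - eprPath A B k hA hB) ψ‖ ^ 2 +
        prodDist (gameDist θ θ') k hA hB *
          ‖(1 - eprAt A B k hA hB) (eprPath A B k hA hB ψ)‖ ^ 2 := by
    intro hA hB
    rw [← mul_add]
    refine mul_le_mul_of_nonneg_left ?_ (prodDist_nonneg h0 _ _ _)
    have hc := hAB.commute_eprPath_epr hk hA hB
    rw [← norm_sq_one_sub_mul (hAB.isStarProjection_eprPath hk.le hA hB) hc.symm ψ, hc.symm.eq,
      norm_sq_one_sub_mul (hAB.isStarProjection_epr hk hA hB) hc ψ]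
    linarith [sq_nonneg ‖(1 - eprPath A B k hA hB) (eprAt A B k hA hB ψ)‖]
  refine (Finset.sum_le_sum fun hA _ => Finset.sum_le_sum fun hB _ => h1 hA hB).trans ?_
  simp_rw [Finset.sum_add_distrib]
  refine (add_le_add (sum_prodDist_one_sub_eprPath_le hAB ha hS hθ hk.le)
      (sum_prodDist_one_sub_epr_eprPath_le hAB ha hS hk)).trans ?_
  have : (0 : ℝ) ≤ (2 * k ^ 2 + k) * a ^ 2 := by positivity
  linarith

/-- The Poincaré inequality applies to Xψ − X'ψ and Zψ − Z'ψ separately. Each gives the constant 4 ·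
4, and recombining gives 1/4 · (16 + 16) = 8. -/
theorem sum_uniform_one_sub_epr_le {k : ℕ} (hk : k < n) :
    ∑ hA, ∑ hB, (1 / 16) ^ k * ‖(1 - eprAt A B k hA hB) ψ‖ ^ 2 ≤ 8 * ((k + 1) ^ 3 * a ^ 2) := by
  have h0 : ∀ p q, 0 ≤ gameDist θ θ' p q := fun p q =>
    le_trans (by norm_num) (le_gameDist θ θ' hθ p q)
  have hbase := sum_prodDist_one_sub_epr_le hAB ha hS hθ hk
  have hbound : ∀ f g : Hist k → H →L[ℂ] H,
      (∀ hA hB, ‖(f hA - g hB) ψ‖ ^ 2 ≤ 4 * ‖(1 - eprAt A B k hA hB) ψ‖ ^ 2) →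
      ∑ hA, ∑ hB, (1 / 16) ^ k * ‖(f hA - g hB) ψ‖ ^ 2 ≤ 16 * ((k + 1) ^ 3 * a ^ 2) := by
    intro f g hfg
    refine (sum_uniform_le_sum_prodDist (sum_gameDist_right θ θ') (sum_gameDist_left θ θ')
      (le_gameDist θ θ' hθ) k (fun h => f h ψ) (fun h => g h ψ)).trans ?_
    have : ∑ hA, ∑ hB, prodDist (gameDist θ θ') k hA hB * ‖f hA ψ - g hB ψ‖ ^ 2 ≤
        ∑ hA, ∑ hB, 4 * (prodDist (gameDist θ θ') k hA hB *
          ‖(1 - eprAt A B k hA hB) ψ‖ ^ 2) := by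
      refine Finset.sum_le_sum fun hA _ => Finset.sum_le_sum fun hB _ => ?_
      have := mul_le_mul_of_nonneg_left (hfg hA hB) (prodDist_nonneg h0 k hA hB)
      rw [sub_apply] at this
      linarith
    simp_rw [← Finset.mul_sum] at this
    linarith
  have hX := hbound (A.X k) (B.X k) fun hA hB => (hAB.isQubitPair hk hA hB).norm_sq_x_sub_le ψ
  have hZ := hbound (A.Z k) (B.Z k) fun hA hB => (hAB.isQubitPair hk hA hB).norm_sq_z_sub_le ψ
  have : ∑ hA, ∑ hB, (1 / 16 : ℝ) ^ k * ‖(1 - eprAt A B k hA hB) ψ‖ ^ 2 ≤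
      ∑ hA, ∑ hB, (1 / 4 * ((1 / 16) ^ k * ‖(A.X k hA - B.X k hB) ψ‖ ^ 2) +
        1 / 4 * ((1 / 16) ^ k * ‖(A.Z k hA - B.Z k hB) ψ‖ ^ 2)) := by
    refine Finset.sum_le_sum fun hA _ => Finset.sum_le_sum fun hB _ => ?_
    have := mul_le_mul_of_nonneg_left
      ((hAB.isQubitPair hk hA hB).norm_sq_one_sub_eprProj_le ψ)
      (by positivity : (0 : ℝ) ≤ (1 / 16) ^ k)
    refine this.trans_eq ?_
    ring
  simp_rw [Finset.sum_add_distrib, ← Finset.mul_sum] at this hX hZ ⊢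
  linarith

end Joint

/-! ### One prover plays: transferring measurements across EPR pairs. -/

section Single

open PauliTree

variable {n : ℕ} {H : Type*} [NormedAddCommGroup H] [InnerProductSpace ℂ H] [CompleteSpace H]
  {A B : PauliTree n (H →L[ℂ] H)} {θ : Bool → ℝ}

theorem run_snoc_apply (T : PauliTree n (H →L[ℂ] H)) {k : ℕ} (h : Hist k) (p : Bool × Bool)
    (v : H) : T.run θ (k + 1) (h.snoc p) v = T.proj θ k h p (T.run θ k h v) := by
  rw [run_snoc, clm_mul_apply]

theorem sum_run_succ (T : PauliTree n (H →L[ℂ] H)) {k : ℕ} (hk : k < n) (v : Hist k → H) :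
    ∑ h : Hist (k + 1), (1 / 2) ^ (k + 1) * ‖T.run θ (k + 1) h (v (Fin.init h))‖ ^ 2 =
      ∑ h, (1 / 2) ^ k * ‖T.run θ k h (v h)‖ ^ 2 := by
  rw [sum_hist_succ]
  refine Finset.sum_congr rfl fun h _ => ?_
  rw [← sum_norm_sq_pauliProj (T.isPauliPair k hk h) θ]
  simp_rw [Finset.mul_sum, run_snoc_apply, Hist.init_snoc, pow_succ, mul_assoc]
  rfl

theorem sum_run (T : PauliTree n (H →L[ℂ] H)) (θ : Bool → ℝ) {k : ℕ} (hk : k ≤ n) (v : H) :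
    ∑ h, (1 / 2) ^ k * ‖T.run θ k h v‖ ^ 2 = ‖v‖ ^ 2 := by
  induction k with
  | zero => simp [run]
  | succ k ih => rw [sum_run_succ T hk fun _ => v, ih (Nat.le_of_succ_le hk)]

variable (hAB : A.Independent B)
include hAB

theorem run_epr {k : ℕ} (hk : k < n) (hA hB : Hist k) (v : H) :
    A.run θ k hA (eprAt A B k hA hB v) = eprAt A B k hA hB (A.run θ k hA v) :=
  DFunLike.congr_fun (hAB.commute_run_epr θ hk hA hB).eq v

/-- Each half of an EPR pair gives unbiased answers, so one prover's transcript is uniform on the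
EPR subspace. This makes a uniform mean the right hypothesis in the estimates that follow. -/
theorem run_eprPath {k : ℕ} (hk : k ≤ n) (h g : Hist k) (w : H) :
    (1 / 2) ^ k * ‖A.run θ k h (eprPath A B k h g w)‖ ^ 2 =
      (1 / 4) ^ k * ‖eprPath A B k h g w‖ ^ 2 := by
  induction k generalizing w with
  | zero => simp [run, eprPath]
  | succ k ih =>
    obtain ⟨h, p, rfl⟩ : ∃ h' p, h = Hist.snoc h' p :=
      ⟨Fin.init h, h (Fin.last k), (Fin.snoc_init_self h).symm⟩
    obtain ⟨g, q, rfl⟩ : ∃ h' p, g = Hist.snoc h' p :=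
      ⟨Fin.init g, g (Fin.last k), (Fin.snoc_init_self g).symm⟩
    have hp := hAB.isQubitPair hk h g
    rw [run_snoc_apply, eprPath_snoc, clm_mul_apply, run_epr hAB hk]
    set u := A.run θ k h (eprPath A B k h g w) with hu
    have h1 : ‖A.proj θ k h p (eprAt A B k h g u)‖ ^ 2 = 1 / 2 * ‖eprAt A B k h g u‖ ^ 2 :=
      norm_sq_mul_eq_of_compress (c := 1 / 2) hp.isStarProjection_eprProj
        (isStarProjection_pauliProj hp.left (θ p.1) p.2)
        (by simpa using hp.eprProj_mul_pauliProj_mul_eprProj (θ p.1) p.2) u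
    have h2 : eprAt A B k h g u = A.run θ k h (eprPath A B k h g (eprAt A B k h g w)) := by
      rw [eprPath_epr hAB hk, run_epr hAB hk]
    have h3 := ih (Nat.le_of_succ_le hk) h g (eprAt A B k h g w)
    rw [← h2, eprPath_epr hAB hk] at h3
    rw [h1, pow_succ, pow_succ]
    linear_combination 1 / 4 * h3

variable {ψ : H} {b : ℝ} (hb : 0 ≤ b)
  (hD : ∀ k < n, mean (fun h : Hist k => ‖(1 - eprAt A B k h h) ψ‖ ^ 2) ≤ b ^ 2)
include hb hD

theorem sum_run_epr_eprPath_le {k : ℕ} (hk : k < n) :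
    ∑ h, (1 / 2) ^ k * ‖A.run θ k h (eprPath A B k h h ((1 - eprAt A B k h h) ψ))‖ ^ 2 ≤ b ^ 2 := by
  simp_rw [run_eprPath hAB hk.le]
  refine le_trans ?_ (hD k hk)
  rw [mean, Finset.mul_sum]
  gcongr
  exact norm_starProjection_le (hAB.isStarProjection_eprPath hk.le _ _) _

/-- Telescoping via 1 − E Q = (1 − Q) + Q(1 − E). The factor Q to the left of 1 − E makes
`run_eprPath` applicable. -/
theorem sum_run_one_sub_eprPath_le {k : ℕ} (hk : k ≤ n) :
    ∑ h, (1 / 2) ^ k * ‖A.run θ k h ((1 - eprPath A B k h h) ψ)‖ ^ 2 ≤ (k * b) ^ 2 := by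
  induction k with
  | zero => simp [run, eprPath]
  | succ k ih =>
    refine (le_of_eq (sum_run_succ A hk
      (fun h => (1 - eprAt A B k h h * eprPath A B k h h) ψ))).trans ?_
    have h1 : ∀ h, A.run θ k h ((1 - eprAt A B k h h * eprPath A B k h h) ψ) =
        A.run θ k h ((1 - eprPath A B k h h) ψ) +
          A.run θ k h (eprPath A B k h h ((1 - eprAt A B k h h) ψ)) := by
      intro h
      rw [← map_add]
      congr 1
      simp only [sub_apply, one_apply_eq_self, clm_mul_apply, map_sub, eprPath_epr hAB hk]
      abel
    simp_rw [h1]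
    refine (sum_norm_add_sq_le (fun _ => by positivity) (by positivity : 0 ≤ k * b) hb
      (ih (Nat.le_of_succ_le hk)) (sum_run_epr_eprPath_le hAB hb hD hk)).trans_eq ?_
    push_cast
    ring

theorem sum_one_sub_epr_run_le {k : ℕ} (hk : k < n) :
    ∑ h, (1 / 2) ^ k * ‖(1 - eprAt A B k h h) (A.run θ k h ψ)‖ ^ 2 ≤ ((k + 1) * b) ^ 2 := by
  have h1 : ∀ h, (1 - eprAt A B k h h) (A.run θ k h ψ) =
      (1 - eprAt A B k h h) (A.run θ k h ((1 - eprPath A B k h h) ψ)) +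
        A.run θ k h (eprPath A B k h h ((1 - eprAt A B k h h) ψ)) := by
    intro h
    simp only [sub_apply, one_apply_eq_self, map_sub, eprPath_epr hAB hk, run_epr hAB hk]
    abel
  simp_rw [h1]
  refine (sum_norm_add_sq_le (fun _ => by positivity) (by positivity : 0 ≤ k * b) hb
    (le_trans ?_ (sum_run_one_sub_eprPath_le (θ := θ) hAB hb hD hk.le))
    (sum_run_epr_eprPath_le hAB hb hD hk)).trans_eq ?_
  · gcongr
    exact norm_starProjection_le (hAB.isStarProjection_epr hk _ _).one_sub _
  · ring

/-- If the two provers' qubits are nearly in the EPR state, then the measurements of one prover can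
be carried out on the other prover's qubits. -/
theorem sum_run_sub_run_le {k : ℕ} (hk : k ≤ n) :
    ∑ h, (1 / 2) ^ k * ‖A.run θ k h ψ - B.run θ k h ψ‖ ^ 2 ≤ (2 * k ^ 2 * b) ^ 2 := by
  induction k with
  | zero => simp [run]
  | succ k ih =>
    rw [sum_hist_succ]
    -- The last measurement by B does not increase the previous error. Exchanging it for that of A
    -- costs twice the EPR defect of the state measured so far, and 2k² + 2(k + 1) ≤ 2(k + 1)².
    have h1 : ∀ h p, A.run θ (k + 1) (Hist.snoc h p) ψ - B.run θ (k + 1) (Hist.snoc h p) ψ =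
        B.proj θ k h p (A.run θ k h ψ - B.run θ k h ψ) +
          (A.proj θ k h p (A.run θ k h ψ) - B.proj θ k h p (A.run θ k h ψ)) := by
      intro h p
      rw [run_snoc_apply, run_snoc_apply, map_sub]
      abel
    simp_rw [h1]
    refine (sum_sum_norm_add_sq_le (fun _ _ => by positivity)
      (by positivity : 0 ≤ 2 * k ^ 2 * b) (by positivity : 0 ≤ 2 * ((k + 1) * b))
      (le_trans (le_of_eq ?_) (ih (Nat.le_of_succ_le hk))) ?_).trans ?_
    · refine Finset.sum_congr rfl fun h _ => ?_
      rw [← sum_norm_sq_pauliProj (B.isPauliPair k hk h) θ]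
      simp_rw [Finset.mul_sum, pow_succ, mul_assoc]
      rfl
    · have h2 : ∀ h : Hist k, ∑ p, (1 / 2) ^ (k + 1) *
          ‖A.proj θ k h p (A.run θ k h ψ) - B.proj θ k h p (A.run θ k h ψ)‖ ^ 2 ≤
          4 * ((1 / 2) ^ k * ‖(1 - eprAt A B k h h) (A.run θ k h ψ)‖ ^ 2) := by
        intro h
        have := mul_le_mul_of_nonneg_left
          ((hAB.isQubitPair hk h h).sum_norm_sq_pauliProj_sub_le θ (A.run θ k h ψ))
          (by positivity : (0 : ℝ) ≤ (1 / 2) ^ k)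
        rw [Finset.mul_sum] at this
        simp_rw [← mul_assoc, ← pow_succ] at this
        refine this.trans_eq ?_
        rw [eprAt]
        ring
      refine (Finset.sum_le_sum fun h _ => h2 h).trans ?_
      rw [← Finset.mul_sum]
      have := sum_one_sub_epr_run_le (θ := θ) hAB hb hD hk
      linarith
    · push_cast
      have : 2 * k ^ 2 * b + 2 * ((k + 1) * b) ≤ 2 * (k + 1) ^ 2 * b := by
        have : (0 : ℝ) ≤ k * b := by positivity
        linarith
      gcongr

end Single

/-! ### Unit vectors that are exactly EPR along given transcripts. -/

section Stabilized

open PauliTree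

variable {n : ℕ} {H : Type*} [NormedAddCommGroup H] [InnerProductSpace ℂ H] [CompleteSpace H]
  {A B : PauliTree n (H →L[ℂ] H)} (hAB : A.Independent B)

/-- If v has no component in the +1 eigenspace of r, then r v = −v and q flips v into that
eigenspace, while `e` still fixes the result. The EPR subspace is therefore nonzero even when ψ is
orthogonal to it. -/
theorem exists_halfProj_fixed {e r q : H →L[ℂ] H} (hr : IsReflection r) (hq : IsReflection q)
    (hqr : q * r = -(r * q)) (her : Commute e r) (heq : Commute e q) {v : H} (hv : v ≠ 0)
    (hev : e v = v) : ∃ w, w ≠ 0 ∧ e w = w ∧ halfProj r w = w := by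
  by_cases h0 : halfProj r v = 0
  · refine ⟨q v, ?_, ?_, ?_⟩
    · rw [← norm_ne_zero_iff, hq.norm_apply]
      exact norm_ne_zero_iff.2 hv
    · rw [← clm_mul_apply, heq.eq, clm_mul_apply, hev]
    · have h1 : halfProj r * q = q - q * halfProj r := by
        simp only [halfProj, mul_smul_comm, mul_add, mul_one, hqr, one_mul, smul_mul_assoc,
          add_mul]
        module
      rw [← clm_mul_apply, h1, sub_apply, clm_mul_apply, h0, map_zero, sub_zero]
  · refine ⟨halfProj r v, h0, ?_, ?_⟩
    · rw [← clm_mul_apply, (commute_halfProj her).eq, clm_mul_apply, hev]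
    · rw [← clm_mul_apply, hr.isStarProjection.isIdempotentElem.eq]

include hAB

theorem exists_ne_zero_eprPath_fixed {ψ : H} (hψ : ψ ≠ 0) {k : ℕ} (hk : k ≤ n) (hA hB : Hist k) :
    ∃ w, w ≠ 0 ∧ eprPath A B k hA hB w = w := by
  induction k with
  | zero => exact ⟨ψ, hψ, rfl⟩
  | succ k ih =>
    obtain ⟨v, hv, hev⟩ := ih (Nat.le_of_succ_le hk) (Fin.init hA) (Fin.init hB)
    set gA : Hist k := Fin.init hA
    set gB : Hist k := Fin.init hB
    have hp := hAB.isQubitPair hk gA gB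
    have cx : Commute (eprPath A B k gA gB) (A.X k gA) :=
      (A.commutesAlong_X hk gA).commute_eprPath (hAB.symm.commutesAlong_X k k gB gA)
    have cz : Commute (eprPath A B k gA gB) (A.Z k gA) :=
      (A.commutesAlong_Z hk gA).commute_eprPath (hAB.symm.commutesAlong_Z k k gB gA)
    have cx' : Commute (eprPath A B k gA gB) (B.X k gB) :=
      (hAB.commutesAlong_X k k gA gB).commute_eprPath (B.commutesAlong_X hk gB)
    have cz' : Commute (eprPath A B k gA gB) (B.Z k gB) :=
      (hAB.commutesAlong_Z k k gA gB).commute_eprPath (B.commutesAlong_Z hk gB)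
    obtain ⟨v₁, hv₁, hev₁, hqv₁⟩ := exists_halfProj_fixed hp.isReflection_zz
      hp.left.isReflection_x hp.x_mul_zz (cz.mul_right cz') cx hv hev
    have c1 : Commute (halfProj (A.Z k gA * B.Z k gB) * eprPath A B k gA gB)
        (A.X k gA * B.X k gB) :=
      (commute_halfProj hp.commute_xx_zz).symm.mul_left (cx.mul_right cx')
    have c2 : Commute (halfProj (A.Z k gA * B.Z k gB) * eprPath A B k gA gB) (A.Z k gA) :=
      (commute_halfProj ((Commute.refl (A.Z k gA)).mul_right hp.zz)).symm.mul_left cz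
    obtain ⟨w, hw, hew, hpw⟩ := exists_halfProj_fixed hp.isReflection_xx
      hp.left.isReflection_z hp.z_mul_xx c1 c2 hv₁ (by rw [clm_mul_apply, hev₁, hqv₁])
    refine ⟨w, hw, ?_⟩
    rw [eprPath, eprAt, eprProj, mul_assoc, clm_mul_apply, hew, hpw]

/-- The normalized projection of a unit vector onto the EPR states. -/
theorem exists_unit_eprPath_fixed {ψ : H} (hψ : ‖ψ‖ = 1) {k : ℕ} (hk : k ≤ n) (hA hB : Hist k) :
    ∃ w, ‖w‖ = 1 ∧ eprPath A B k hA hB w = w ∧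
      ‖ψ - w‖ ≤ 2 * ‖(1 - eprPath A B k hA hB) ψ‖ := by
  set e := eprPath A B k hA hB with he
  have hpr : IsStarProjection e := hAB.isStarProjection_eprPath hk hA hB
  have hunit : ∀ v : H, v ≠ 0 → ‖((‖v‖⁻¹ : ℝ) : ℂ) • v‖ = 1 := by
    intro v hv
    rw [norm_smul, Complex.norm_real, norm_inv, norm_norm,
      inv_mul_cancel₀ (norm_ne_zero_iff.2 hv)]
  by_cases h0 : e ψ = 0
  -- When ψ is orthogonal to the EPR subspace, any unit vector in it is admissible: the distance is
  -- at most 2, and ‖(1 − e)ψ‖ = 1.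
  · obtain ⟨v, hv, hev⟩ := exists_ne_zero_eprPath_fixed hAB
      (norm_ne_zero_iff.1 (by rw [hψ]; exact one_ne_zero)) hk hA hB
    refine ⟨((‖v‖⁻¹ : ℝ) : ℂ) • v, hunit v hv, by rw [map_smul, hev], ?_⟩
    refine (norm_sub_le _ _).trans ?_
    rw [hunit v hv, sub_apply, h0, sub_zero, one_apply_eq_self, hψ]
    norm_num
  · refine ⟨((‖e ψ‖⁻¹ : ℝ) : ℂ) • e ψ, hunit _ h0, ?_, ?_⟩
    · rw [map_smul, ← clm_mul_apply, hpr.isIdempotentElem.eq]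
    · have h1 : ‖e ψ - ((‖e ψ‖⁻¹ : ℝ) : ℂ) • e ψ‖ = 1 - ‖e ψ‖ := by
        have hle : ‖e ψ‖ ≤ 1 := hψ ▸ norm_starProjection_le hpr ψ
        have hpos : 0 < ‖e ψ‖ := norm_pos_iff.2 h0
        have : e ψ - ((‖e ψ‖⁻¹ : ℝ) : ℂ) • e ψ = ((1 - ‖e ψ‖⁻¹ : ℝ) : ℂ) • e ψ := by
          push_cast
          module
        rw [this, norm_smul, Complex.norm_real, Real.norm_eq_abs, abs_sub_comm, abs_of_nonneg
          (sub_nonneg.2 ((one_le_inv₀ hpos).2 hle)), sub_mul, inv_mul_cancel₀ hpos.ne', one_mul]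
      have h2 : 1 - ‖e ψ‖ ≤ ‖(1 - e) ψ‖ := by
        have := norm_sub_norm_le ψ (e ψ)
        rwa [hψ] at this
      calc ‖ψ - ((‖e ψ‖⁻¹ : ℝ) : ℂ) • e ψ‖
          = ‖(1 - e) ψ + (e ψ - ((‖e ψ‖⁻¹ : ℝ) : ℂ) • e ψ)‖ := by
            congr 1
            rw [sub_apply, one_apply_eq_self]
            abel
        _ ≤ ‖(1 - e) ψ‖ + (1 - ‖e ψ‖) := (norm_add_le _ _).trans_eq (by rw [h1])
        _ ≤ 2 * ‖(1 - e) ψ‖ := by linarith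

theorem epr_fixed_of_eprPath_fixed {w : H} {k : ℕ} (hk : k ≤ n) (hA hB : Hist n)
    (hw : eprPath A B k (hA.prefix k) (hB.prefix k) w = w) {j : ℕ} (hj : j < k) :
    eprAt A B j (hA.prefix j) (hB.prefix j) w = w := by
  induction k with
  | zero => exact absurd hj (Nat.not_lt_zero j)
  | succ k ih =>
    -- A vanishing total defect forces both Pythagorean summands to vanish.
    have hz := norm_sq_one_sub_mul
      (hAB.isStarProjection_eprPath (Nat.le_of_succ_le hk) (hA.prefix k) (hB.prefix k))
      (hAB.commute_eprPath_epr hk (hA.prefix k) (hB.prefix k)).symm w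
    rw [eprPath, Hist.init_prefix, Hist.init_prefix] at hw
    rw [sub_apply, hw, one_apply_eq_self, sub_self, norm_zero] at hz
    have hz1 : (1 - eprPath A B k (hA.prefix k) (hB.prefix k)) w = 0 := by
      rw [← norm_eq_zero, ← sq_eq_zero_iff]
      nlinarith [sq_nonneg ‖(1 - eprPath A B k (hA.prefix k) (hB.prefix k)) w‖,
        sq_nonneg ‖(1 - eprAt A B k (hA.prefix k) (hB.prefix k))
          (eprPath A B k (hA.prefix k) (hB.prefix k) w)‖]
    have hz2 : eprPath A B k (hA.prefix k) (hB.prefix k) w = w := by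
      rw [sub_apply, one_apply_eq_self, sub_eq_zero] at hz1
      exact hz1.symm
    rcases Nat.lt_succ_iff_lt_or_eq.1 hj with hj | rfl
    · exact ih (Nat.le_of_succ_le hk) hz2 hj
    · rwa [clm_mul_apply, hz2] at hw

theorem norm_sq_one_sub_eprPath_le {ψ : H} {c : ℝ} {k : ℕ} (hk : k ≤ n) (hA hB : Hist n)
    (hc : ∀ j < n, ‖(1 - eprAt A B j (hA.prefix j) (hB.prefix j)) ψ‖ ^ 2 ≤ c) :
    ‖(1 - eprPath A B k (hA.prefix k) (hB.prefix k)) ψ‖ ^ 2 ≤ k * c := by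
  induction k with
  | zero => simp [eprPath]
  | succ k ih =>
    have h1 := ih (Nat.le_of_succ_le hk)
    have hcm := hAB.commute_eprPath_epr hk (hA.prefix k) (hB.prefix k)
    rw [eprPath, Hist.init_prefix, Hist.init_prefix, hcm.symm.eq,
      norm_sq_one_sub_mul (hAB.isStarProjection_epr hk _ _) hcm]
    have h2 : ‖(1 - eprPath A B k (hA.prefix k) (hB.prefix k))
        (eprAt A B k (hA.prefix k) (hB.prefix k) ψ)‖ ≤
        ‖(1 - eprPath A B k (hA.prefix k) (hB.prefix k)) ψ‖ := by
      have : (1 - eprPath A B k (hA.prefix k) (hB.prefix k))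
          (eprAt A B k (hA.prefix k) (hB.prefix k) ψ) =
          eprAt A B k (hA.prefix k) (hB.prefix k)
            ((1 - eprPath A B k (hA.prefix k) (hB.prefix k)) ψ) := by
        simp only [sub_apply, one_apply_eq_self, map_sub, eprPath_epr hAB hk]
      rw [this]
      exact norm_starProjection_le (hAB.isStarProjection_epr hk _ _) _
    have h3 := pow_le_pow_left₀ (norm_nonneg _) h2 2
    have h4 := hc k hk
    rw [Nat.cast_succ]
    linarith

theorem X_eq_of_epr_fixed {w : H} {k : ℕ} (hk : k < n) {hA hB : Hist k}
    (hw : eprAt A B k hA hB w = w) : A.X k hA w = B.X k hB w := by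
  have := DFunLike.congr_fun (hAB.isQubitPair hk hA hB).x_mul_eprProj w
  rw [clm_mul_apply, clm_mul_apply] at this
  change A.X k hA (eprAt A B k hA hB w) = B.X k hB (eprAt A B k hA hB w) at this
  rwa [hw] at this

theorem Z_eq_of_epr_fixed {w : H} {k : ℕ} (hk : k < n) {hA hB : Hist k}
    (hw : eprAt A B k hA hB w = w) : A.Z k hA w = B.Z k hB w := by
  have := DFunLike.congr_fun (hAB.isQubitPair hk hA hB).z_mul_eprProj w
  rw [clm_mul_apply, clm_mul_apply] at this
  change A.Z k hA (eprAt A B k hA hB w) = B.Z k hB (eprAt A B k hA hB w) at this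
  rwa [hw] at this

end Stabilized

/-! ### Choice of the fixed transcripts and the main estimate. -/

section FixedLocations

open PauliTree

variable {n : ℕ} {H : Type*} [NormedAddCommGroup H] [InnerProductSpace ℂ H] [CompleteSpace H]
  {A B : PauliTree n (H →L[ℂ] H)} {θ θ' : Bool → ℝ} (hAB : A.Independent B)

theorem mean_comm {k l : ℕ} (f : Hist k → Hist l → ℝ) :
    mean (fun x => mean (fun y => f x y)) = mean (fun y => mean (fun x => f x y)) := by
  simp only [mean, Finset.mul_sum]
  rw [Finset.sum_comm]
  refine Finset.sum_congr rfl fun y _ => Finset.sum_congr rfl fun x _ => ?_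
  ring

theorem mean_nonneg {k : ℕ} {f : Hist k → ℝ} (hf : ∀ h, 0 ≤ f h) : 0 ≤ mean f :=
  mul_nonneg (by positivity) (Finset.sum_nonneg fun h _ => hf h)

/-- If the functions `f k` of pairs of transcripts have small means, then there is one pair of
transcripts along which they and their partial means are small. -/
theorem exists_transcripts_le {f : (k : ℕ) → Hist k → Hist k → ℝ} (hf : ∀ k x y, 0 ≤ f k x y)
    {d : ℝ} (hd : ∀ k < n, mean (fun x => mean (fun y => f k x y)) ≤ d) :
    ∃ gA gB : Hist n, ∀ k < n, f k (gA.prefix k) (gB.prefix k) ≤ 3 * n * d ∧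
      mean (fun x => f k x (gB.prefix k)) ≤ 3 * n * d ∧
      mean (fun y => f k (gA.prefix k) y) ≤ 3 * n * d := by
  -- All 3n nonnegative quantities are added up, so that a single averaging argument controls each
  -- of them. The mean of the sum is at most 3 n d.
  set F : Hist n → Hist n → ℝ := fun gA gB => ∑ k ∈ Finset.range n,
    (f k (gA.prefix k) (gB.prefix k) + mean (fun x => f k x (gB.prefix k)) +
      mean (fun y => f k (gA.prefix k) y)) with hF
  have hmean : mean (fun gA => mean (fun gB => F gA gB)) ≤ 3 * n * d := by
    have h1 : mean (fun gA => mean (fun gB => F gA gB)) =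
        ∑ k ∈ Finset.range n, 3 * mean (fun x => mean (fun y => f k x y)) := by
      simp only [hF, mean_sum, mean_add]
      refine Finset.sum_congr rfl fun k hk => ?_
      have hkn : k ≤ n := (Finset.mem_range.1 hk).le
      have e1 : mean (fun gA : Hist n => mean fun gB : Hist n =>
          f k (gA.prefix k) (gB.prefix k)) = mean (fun x => mean (fun y => f k x y)) := by
        simp_rw [fun gA : Hist n => mean_prefix hkn (f k (gA.prefix k))]
        exact mean_prefix hkn fun x => mean (f k x)
      have e2 : mean (fun _ : Hist n => mean fun gB : Hist n =>
          mean fun x => f k x (gB.prefix k)) = mean (fun x => mean (fun y => f k x y)) := by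
        rw [mean_const, mean_prefix hkn fun y => mean fun x => f k x y, mean_comm]
      have e3 : mean (fun gA : Hist n => mean fun _ : Hist n =>
          mean fun y => f k (gA.prefix k) y) = mean (fun x => mean (fun y => f k x y)) := by
        simp_rw [mean_const]
        exact mean_prefix hkn fun x => mean (f k x)
      rw [e1, e2, e3]
      ring
    rw [h1]
    refine (Finset.sum_le_sum fun k hk =>
      mul_le_mul_of_nonneg_left (hd k (Finset.mem_range.1 hk)) (by norm_num)).trans_eq ?_
    rw [Finset.sum_const, Finset.card_range, nsmul_eq_mul]
    ring
  obtain ⟨gA, hgA⟩ := exists_le_mean fun gA => mean fun gB => F gA gB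
  obtain ⟨gB, hgB⟩ := exists_le_mean (F gA)
  refine ⟨gA, gB, fun k hk => ?_⟩
  have n1 := hf k (gA.prefix k) (gB.prefix k)
  have n2 := mean_nonneg fun x => hf k x (gB.prefix k)
  have n3 := mean_nonneg fun y => hf k (gA.prefix k) y
  have hle : f k (gA.prefix k) (gB.prefix k) + mean (fun x => f k x (gB.prefix k)) +
      mean (fun y => f k (gA.prefix k) y) ≤ 3 * n * d := by
    refine le_trans ?_ ((hgB.trans hgA).trans hmean)
    exact Finset.single_le_sum (f := fun k => f k (gA.prefix k) (gB.prefix k) +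
      mean (fun x => f k x (gB.prefix k)) + mean (fun y => f k (gA.prefix k) y))
      (fun j _ => add_nonneg (add_nonneg (hf _ _ _) (mean_nonneg fun _ => hf _ _ _))
        (mean_nonneg fun _ => hf _ _ _)) (Finset.mem_range.2 hk)
  exact ⟨by linarith, by linarith, by linarith⟩

include hAB

/-- The comparison passes through Bob's fixed qubits: A on ψ is close to B at `gB` on ψ, which is
close to B at `gB` on w, which equals A at `gA` on w. Since Bob's locations are fixed, the defect
has to be averaged over Alice's transcript only. -/
theorem sum_run_sub_run_fix_le {ψ w : H} {b c : ℝ} (hb : 0 ≤ b) (gA gB : Hist n)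
    (hD : ∀ k < n, mean (fun h : Hist k => ‖(1 - eprAt A B k h (gB.prefix k)) ψ‖ ^ 2) ≤ b ^ 2)
    (hw : ∀ k < n, eprAt A B k (gA.prefix k) (gB.prefix k) w = w) (hc : ‖ψ - w‖ ≤ c)
    {k : ℕ} (hk : k ≤ n) :
    ∑ h, (1 / 2) ^ k * ‖A.run θ k h ψ - (A.fix gA).run θ k h w‖ ^ 2 ≤ (2 * k ^ 2 * b + c) ^ 2 := by
  have hc0 : 0 ≤ c := (norm_nonneg _).trans hc
  have h1 := sum_run_sub_run_le (θ := θ) (hAB.fix_right gB) hb hD hk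
  -- The transfer estimate with error b = 0 is an exact identity, as w is fixed by all EPR
  -- projections between the fixed locations.
  have h2 : ∀ h : Hist k, (A.fix gA).run θ k h w = (B.fix gB).run θ k h w := by
    have h0 := sum_run_sub_run_le (θ := θ) (ψ := w) ((hAB.fix_left gA).fix_right gB) le_rfl
      (fun j hj => by
        have : ∀ h : Hist j, (1 - eprAt (A.fix gA) (B.fix gB) j h h) w = 0 := fun h => by
          rw [sub_apply, one_apply_eq_self, sub_eq_zero]
          exact (hw j hj).symm
        simp_rw [this]
        simp [mean]) hk
    intro h
    have h3 : (1 / 2 : ℝ) ^ k * ‖(A.fix gA).run θ k h w - (B.fix gB).run θ k h w‖ ^ 2 ≤ 0 := by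
      refine le_trans ?_ (h0.trans_eq (by ring))
      exact Finset.single_le_sum (f := fun h => (1 / 2 : ℝ) ^ k *
        ‖(A.fix gA).run θ k h w - (B.fix gB).run θ k h w‖ ^ 2)
        (fun _ _ => by positivity) (Finset.mem_univ h)
    have h4 : ‖(A.fix gA).run θ k h w - (B.fix gB).run θ k h w‖ ^ 2 ≤ 0 := by
      by_contra! hcon
      exact absurd h3 (not_le.2 (by positivity))
    rw [← sub_eq_zero, ← norm_eq_zero, ← sq_eq_zero_iff]
    exact le_antisymm h4 (sq_nonneg _)
  have h5 : ∀ h : Hist k, A.run θ k h ψ - (A.fix gA).run θ k h w =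
      (A.run θ k h ψ - (B.fix gB).run θ k h ψ) + (B.fix gB).run θ k h (ψ - w) := by
    intro h
    rw [h2, map_sub]
    abel
  simp_rw [h5]
  refine sum_norm_add_sq_le (fun _ => by positivity) (by positivity) hc0 h1 ?_
  rw [sum_run _ θ hk]
  gcongr

/-- The main estimate: the qubit locations can be taken independent of the transcript. -/
theorem exists_fixed_locations {ψ : H} (hψ : ‖ψ‖ = 1) {a : ℝ} (ha : 0 ≤ a)
    (hS : ∀ k < n, ∑ hA, ∑ hB, (1 / 4) ^ k *
      ‖(1 - eprAt A B k hA hB) (A.run θ k hA (B.run θ' k hB ψ))‖ ^ 2 ≤ a ^ 2)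
    (hθ : ∀ a b, |Real.cos (θ a - θ' b)| ≤ 3 / 4) :
    ∃ gA gB : Hist n, ∃ w : H, ‖w‖ = 1 ∧
      (∀ k < n, A.X k (gA.prefix k) w = B.X k (gB.prefix k) w ∧
        A.Z k (gA.prefix k) w = B.Z k (gB.prefix k) w) ∧
      (∀ k ≤ n, ∑ h, (1 / 2) ^ k * ‖A.run θ k h ψ - (A.fix gA).run θ k h w‖ ^ 2 ≤
        (20 * n ^ 4 * a) ^ 2) ∧
      ∀ k ≤ n, ∑ h, (1 / 2) ^ k * ‖B.run θ' k h ψ - (B.fix gB).run θ' k h w‖ ^ 2 ≤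
        (20 * n ^ 4 * a) ^ 2 := by
  have hd : ∀ k < n, mean (fun x => mean (fun y => ‖(1 - eprAt A B k x y) ψ‖ ^ 2)) ≤
      8 * (n ^ 3 * a ^ 2) := by
    intro k hk
    have h1 : mean (fun x => mean (fun y => ‖(1 - eprAt A B k x y) ψ‖ ^ 2)) =
        ∑ x, ∑ y, (1 / 16) ^ k * ‖(1 - eprAt A B k x y) ψ‖ ^ 2 := by
      simp_rw [mean, Finset.mul_sum, ← mul_assoc, ← mul_pow]
      norm_num
    rw [h1]
    refine (sum_uniform_one_sub_epr_le hAB ha hS hθ hk).trans ?_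
    have : (k : ℝ) + 1 ≤ n := by exact_mod_cast hk
    gcongr
  obtain ⟨gA, gB, hg⟩ := exists_transcripts_le (f := fun k x y => ‖(1 - eprAt A B k x y) ψ‖ ^ 2)
    (fun _ _ _ => sq_nonneg _) hd
  -- The averaged bound is 3n · 8n³a² = 24 n⁴a², below (5n²a)². In the end 2n²b + 2nb ≤ 4n²b = 20
  -- n⁴a.
  set b : ℝ := 5 * n ^ 2 * a with hb
  have hb0 : 0 ≤ b := by positivity
  have hdb : 3 * n * (8 * (n ^ 3 * a ^ 2)) ≤ b ^ 2 := by
    rw [hb]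
    have : 0 ≤ (n : ℝ) ^ 4 * a ^ 2 := by positivity
    linarith
  obtain ⟨w, hw1, hwf, hwd⟩ := exists_unit_eprPath_fixed hAB hψ le_rfl (gA.prefix n) (gB.prefix n)
  have hfix : ∀ k < n, eprAt A B k (gA.prefix k) (gB.prefix k) w = w := fun k hk =>
    epr_fixed_of_eprPath_fixed hAB le_rfl gA gB hwf hk
  have hcl : ‖(1 - eprPath A B n (gA.prefix n) (gB.prefix n)) ψ‖ ≤ n * b := by
    refine abs_le_of_sq_le_sq' ?_ (by positivity) |>.2
    refine (norm_sq_one_sub_eprPath_le hAB le_rfl gA gB (c := b ^ 2)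
      fun j hj => ((hg j hj).1).trans hdb).trans ?_
    rw [mul_pow (n : ℝ) b 2]
    exact mul_le_mul_of_nonneg_right (by exact_mod_cast Nat.le_self_pow two_ne_zero n)
      (sq_nonneg b)
  have hc : ‖ψ - w‖ ≤ 2 * (n * b) := hwd.trans (by gcongr)
  have hfin : ∀ k ≤ n, (2 * k ^ 2 * b + 2 * (n * b)) ^ 2 ≤ (20 * n ^ 4 * a) ^ 2 := by
    intro k hk
    have hk' : (k : ℝ) ≤ n := by exact_mod_cast hk
    have hn' : (n : ℝ) ≤ n ^ 2 := by exact_mod_cast Nat.le_self_pow two_ne_zero n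
    have : 2 * k ^ 2 * b + 2 * (n * b) ≤ 20 * n ^ 4 * a := by
      calc 2 * k ^ 2 * b + 2 * (n * b) ≤ 2 * n ^ 2 * b + 2 * (n ^ 2 * b) := by gcongr
        _ = 20 * n ^ 4 * a := by rw [hb]; ring
    gcongr
  refine ⟨gA, gB, w, hw1, fun k hk => ⟨X_eq_of_epr_fixed hAB hk (hfix k hk),
    Z_eq_of_epr_fixed hAB hk (hfix k hk)⟩, fun k hk => ?_, fun k hk => ?_⟩
  · exact (sum_run_sub_run_fix_le hAB hb0 gA gB (fun j hj => ((hg j hj).2.1).trans hdb) hfix hc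
      hk).trans (hfin k hk)
  · refine (sum_run_sub_run_fix_le hAB.symm hb0 gB gA (fun j hj => ?_) (fun j hj => ?_) hc
      hk).trans (hfin k hk)
    · simp_rw [hAB.epr_symm hj]
      exact ((hg j hj).2.2).trans hdb
    · rw [hAB.epr_symm hj]
      exact hfix j hj

end FixedLocations

/-! ### Operators on qubit registers. -/

section Registers

variable {ι : Type} [Fintype ι] [DecidableEq ι] {K : Type*} [NormedAddCommGroup K]
  [InnerProductSpace ℂ K] [CompleteSpace K]

theorem onQubit_apply (j : ι) (G : Matrix Bool Bool ℂ) (v : Reg ι K) (x : ι → Bool) :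
    onQubit K j G v x = ∑ c : Bool, G (x j) c • v (Function.update x j c) := by
  simp [onQubit]

theorem onQubit_mul (j : ι) (G G' : Matrix Bool Bool ℂ) :
    onQubit K j (G * G') = onQubit K j G * onQubit K j G' := by
  ext v x
  rw [clm_mul_apply, onQubit_apply, onQubit_apply]
  simp only [onQubit_apply, Matrix.mul_apply, Function.update_self, Function.update_idem,
    Finset.sum_smul, Finset.smul_sum, mul_smul]
  rw [Finset.sum_comm]

theorem onQubit_one (j : ι) : onQubit K j 1 = 1 := by
  ext v x
  rw [onQubit_apply, Finset.sum_eq_single (x j)]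
  · simp
  · intro c _ hc
    simp [Matrix.one_apply_ne hc.symm]
  · simp

theorem onQubit_add (j : ι) (G G' : Matrix Bool Bool ℂ) :
    onQubit K j (G + G') = onQubit K j G + onQubit K j G' := by
  ext v x
  rw [add_apply, PiLp.add_apply, onQubit_apply, onQubit_apply, onQubit_apply]
  simp only [Matrix.add_apply, add_smul, Finset.sum_add_distrib]

theorem onQubit_smul (j : ι) (r : ℂ) (G : Matrix Bool Bool ℂ) :
    onQubit K j (r • G) = r • onQubit K j G := by
  ext v x
  rw [smul_apply, PiLp.smul_apply, onQubit_apply, onQubit_apply]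
  simp only [Matrix.smul_apply, smul_eq_mul, mul_smul, Finset.smul_sum]

theorem commute_onQubit {i j : ι} (hij : i ≠ j) (G G' : Matrix Bool Bool ℂ) :
    Commute (onQubit K i G) (onQubit K j G') := by
  refine ContinuousLinearMap.ext fun v => PiLp.ext fun x => ?_
  rw [clm_mul_apply, clm_mul_apply, onQubit_apply, onQubit_apply]
  simp only [onQubit_apply, Function.update_of_ne hij, Function.update_of_ne hij.symm,
    Finset.smul_sum]
  rw [Finset.sum_comm]
  refine Finset.sum_congr rfl fun c _ => Finset.sum_congr rfl fun d _ => ?_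
  rw [smul_comm, Function.update_comm hij]

theorem star_onQubit (j : ι) (G : Matrix Bool Bool ℂ) :
    star (onQubit K j G) = onQubit K j (star G) := by
  rw [ContinuousLinearMap.star_eq_adjoint]
  symm
  rw [ContinuousLinearMap.eq_adjoint_iff]
  intro v w
  simp only [PiLp.inner_apply, onQubit_apply, sum_inner, inner_sum, inner_smul_left,
    inner_smul_right, Matrix.star_apply]
  rw [← Fintype.sum_prod_type' fun x c => (starRingEnd ℂ) (star (G c (x j))) *
      inner ℂ (v (Function.update x j c)) (w x),
    ← Fintype.sum_prod_type' fun x c => G (x j) c * inner ℂ (v x) (w (Function.update x j c))]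
  -- The bijection exchanges the j-th bit of the string with the summation bit.
  refine Fintype.sum_bijective
    (fun p : (ι → Bool) × Bool => (Function.update p.1 j p.2, p.1 j)) ?_ _ _ ?_
  · refine Function.Involutive.bijective fun p => ?_
    simp
  · intro p
    simp

variable {n : ℕ}

theorem onLast_apply (j : Fin n)
    (U : Reg {i : Fin n // j ≤ i} K →L[ℂ] Reg {i : Fin n // j ≤ i} K) (v : Reg (Fin n) K)
    (x : Fin n → Bool) :
    onLast j U v x = U (WithLp.toLp 2 fun y => v (glue j x y)) (fun i => x i) := by
  simp only [onLast]
  rfl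

theorem glue_restrict (j : Fin n) (x : Fin n → Bool) : glue j x (fun i => x i) = x := by
  funext i
  simp [glue]

theorem glue_glue (j : Fin n) (x : Fin n → Bool) (y z : {i : Fin n // j ≤ i} → Bool) :
    glue j (glue j x y) z = glue j x z := by
  funext i
  by_cases h : j ≤ i <;> simp [glue, h]

theorem restrict_glue (j : Fin n) (x : Fin n → Bool) (y : {i : Fin n // j ≤ i} → Bool) :
    (fun i : {i : Fin n // j ≤ i} => glue j x y i) = y := by
  funext i
  simp [glue, i.2]

theorem onLast_comp (j : Fin n)
    (U V : Reg {i : Fin n // j ≤ i} K →L[ℂ] Reg {i : Fin n // j ≤ i} K) :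
    onLast j U ∘L onLast j V = onLast j (U ∘L V) := by
  ext v x
  rw [ContinuousLinearMap.comp_apply, onLast_apply, onLast_apply, ContinuousLinearMap.comp_apply]
  refine congrArg (fun w : Reg {i : Fin n // j ≤ i} K => U w fun i => x i) (PiLp.ext fun y => ?_)
  change onLast j V v (glue j x y) = _
  rw [onLast_apply, restrict_glue]
  simp only [glue_glue]

theorem onLast_id (j : Fin n) :
    onLast j (.id ℂ (Reg {i : Fin n // j ≤ i} K)) = .id ℂ (Reg (Fin n) K) := by
  ext v x
  rw [onLast_apply]
  change v (glue j x fun i => x i) = v x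
  rw [glue_restrict]

theorem commute_onLast_onQubit (j : Fin n)
    (U : Reg {i : Fin n // j ≤ i} K →L[ℂ] Reg {i : Fin n // j ≤ i} K) {i : Fin n} (hij : i < j)
    (G : Matrix Bool Bool ℂ) : Commute (onLast j U) (onQubit K i G) := by
  have hglue : ∀ (x : Fin n → Bool) c y,
      Function.update (glue j x y) i c = glue j (Function.update x i c) y := by
    intro x c y
    funext l
    by_cases hl : l = i
    · subst hl
      simp [glue, hij.not_ge]
    · simp [glue, Function.update_of_ne hl]
  refine ContinuousLinearMap.ext fun v => PiLp.ext fun x => ?_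
  rw [clm_mul_apply, clm_mul_apply, onLast_apply, onQubit_apply]
  simp only [onLast_apply]
  have h1 : (WithLp.toLp 2 fun y => onQubit K i G v (glue j x y)) =
      ∑ c : Bool, G (x i) c • WithLp.toLp 2 fun y => v (glue j (Function.update x i c) y) := by
    ext y
    simp only [onQubit_apply, WithLp.ofLp_sum, WithLp.ofLp_smul, Finset.sum_apply, Pi.smul_apply]
    refine Finset.sum_congr rfl fun c _ => ?_
    rw [hglue]
    simp [glue, hij.not_ge]
  have h2 : ∀ c : Bool, (fun l : {l : Fin n // j ≤ l} => Function.update x i c l) =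
      fun l : {l : Fin n // j ≤ l} => x l := by
    intro c
    funext l
    rw [Function.update_of_ne]
    rintro h
    exact absurd l.2 (h ▸ hij.not_ge)
  rw [h1, map_sum]
  simp only [map_smul, WithLp.ofLp_sum, WithLp.ofLp_smul, Finset.sum_apply, Pi.smul_apply, h2]

theorem norm_onLast (j : Fin n)
    {U : Reg {i : Fin n // j ≤ i} K →L[ℂ] Reg {i : Fin n // j ≤ i} K} (hU : ∀ v, ‖U v‖ = ‖v‖)
    (v : Reg (Fin n) K) : ‖onLast j U v‖ = ‖v‖ := by
  rw [← sq_eq_sq₀ (norm_nonneg _) (norm_nonneg _), PiLp.norm_sq_eq_of_L2, PiLp.norm_sq_eq_of_L2]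
  -- The register splits into slices with the bits before j held fixed, and the operator acts on
  -- each slice as the isometry `U`.
  set e := (Equiv.piEquivPiSubtypeProd (fun i : Fin n => j ≤ i) (fun _ => Bool)).symm with he
  have hglue : ∀ s, ∃ x, ∀ y, e (y, s) = glue j x y := fun s => ⟨e (fun _ => false, s), fun y => by
    funext i
    by_cases h : j ≤ i <;> simp [he, glue, h, Equiv.piEquivPiSubtypeProd]⟩
  rw [← Equiv.sum_comp e, ← Equiv.sum_comp e, Fintype.sum_prod_type_right,
    Fintype.sum_prod_type_right]
  refine Finset.sum_congr rfl fun s _ => ?_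
  obtain ⟨x, hx⟩ := hglue s
  have h1 := hU (WithLp.toLp 2 fun y => v (glue j x y))
  rw [← sq_eq_sq₀ (norm_nonneg _) (norm_nonneg _), PiLp.norm_sq_eq_of_L2,
    PiLp.norm_sq_eq_of_L2] at h1
  simp_rw [hx, onLast_apply, glue_glue, restrict_glue]
  exact h1

end Registers

/-! ### Unitary maps and conjugation. -/

section Conjugation

variable {E F G : Type*} [NormedAddCommGroup E] [InnerProductSpace ℂ E] [CompleteSpace E]
  [NormedAddCommGroup F] [InnerProductSpace ℂ F] [CompleteSpace F]
  [NormedAddCommGroup G] [InnerProductSpace ℂ G] [CompleteSpace G]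

/-- `M` is a unitary map. -/
structure IsUnitaryMap (M : E →L[ℂ] F) : Prop where
  adjoint_comp : ContinuousLinearMap.adjoint M ∘L M = .id ℂ E
  comp_adjoint : M ∘L ContinuousLinearMap.adjoint M = .id ℂ F

/-- For an isometry the adjoint is a left inverse, so it coincides with any right inverse. -/
theorem IsUnitaryMap.of_norm_of_comp {M : E →L[ℂ] F} (h : ∀ v, ‖M v‖ = ‖v‖) {R : F →L[ℂ] E}
    (hR : M ∘L R = .id ℂ F) : IsUnitaryMap M := by
  have h1 : ContinuousLinearMap.adjoint M ∘L M = .id ℂ E :=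
    M.norm_map_iff_adjoint_comp_self.1 h
  have h2 : ContinuousLinearMap.adjoint M = R := by
    calc ContinuousLinearMap.adjoint M = ContinuousLinearMap.adjoint M ∘L (M ∘L R) := by
          rw [hR]; rfl
      _ = (ContinuousLinearMap.adjoint M ∘L M) ∘L R := rfl
      _ = R := by rw [h1]; rfl
  exact ⟨h1, by rw [h2, hR]⟩

theorem IsUnitaryMap.norm_apply {M : E →L[ℂ] F} (h : IsUnitaryMap M) (v : E) : ‖M v‖ = ‖v‖ :=
  M.norm_map_iff_adjoint_comp_self.2 h.adjoint_comp v

theorem IsUnitaryMap.comp {M : E →L[ℂ] F} {N : F →L[ℂ] G} (hN : IsUnitaryMap N)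
    (hM : IsUnitaryMap M) : IsUnitaryMap (N ∘L M) := by
  refine .of_norm_of_comp (fun v => (hN.norm_apply _).trans (hM.norm_apply _))
    (R := ContinuousLinearMap.adjoint M ∘L ContinuousLinearMap.adjoint N) ?_
  calc (N ∘L M) ∘L (ContinuousLinearMap.adjoint M ∘L ContinuousLinearMap.adjoint N)
      = N ∘L (M ∘L ContinuousLinearMap.adjoint M) ∘L ContinuousLinearMap.adjoint N := rfl
    _ = N ∘L ContinuousLinearMap.adjoint N := by rw [hM.comp_adjoint]; rfl
    _ = _ := hN.comp_adjoint

/-- The operator `M† a M`. -/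
def conjBy (M : E →L[ℂ] F) (a : F →L[ℂ] F) : E →L[ℂ] E :=
  ContinuousLinearMap.adjoint M ∘L a ∘L M

theorem conjBy_comp (N : F →L[ℂ] G) (M : E →L[ℂ] F) (a : G →L[ℂ] G) :
    conjBy (N ∘L M) a = conjBy M (conjBy N a) := by
  rw [conjBy, conjBy, conjBy, ContinuousLinearMap.adjoint_comp]
  rfl

theorem conjBy_of_commute {M : E →L[ℂ] E} (hM : IsUnitaryMap M) {a : E →L[ℂ] E}
    (h : Commute M a) : conjBy M a = a := by
  calc conjBy M a = ContinuousLinearMap.adjoint M ∘L (a * M) := rfl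
    _ = (ContinuousLinearMap.adjoint M ∘L M) ∘L a := by rw [← h.eq]; rfl
    _ = a := by rw [hM.adjoint_comp]; rfl

theorem conjBy_mul {M : E →L[ℂ] F} (hM : IsUnitaryMap M) (a b : F →L[ℂ] F) :
    conjBy M (a * b) = conjBy M a * conjBy M b := by
  calc conjBy M (a * b) = ContinuousLinearMap.adjoint M ∘L a ∘L (.id ℂ F) ∘L b ∘L M := rfl
    _ = conjBy M a * conjBy M b := by rw [← hM.comp_adjoint]; rfl

theorem comp_conjBy {M : E →L[ℂ] F} (hM : IsUnitaryMap M) (a : F →L[ℂ] F) :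
    M ∘L conjBy M a = a ∘L M := by
  calc M ∘L conjBy M a = (M ∘L ContinuousLinearMap.adjoint M) ∘L a ∘L M := rfl
    _ = a ∘L M := by rw [hM.comp_adjoint]; rfl

theorem conjBy_one {M : E →L[ℂ] F} (hM : IsUnitaryMap M) : conjBy M 1 = 1 := hM.adjoint_comp

theorem conjBy_add (M : E →L[ℂ] F) (a b : F →L[ℂ] F) :
    conjBy M (a + b) = conjBy M a + conjBy M b := by
  simp [conjBy]

theorem conjBy_smul (M : E →L[ℂ] F) (r : ℂ) (a : F →L[ℂ] F) :
    conjBy M (r • a) = r • conjBy M a := by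
  simp [conjBy]

theorem conjBy_neg (M : E →L[ℂ] F) (a : F →L[ℂ] F) : conjBy M (-a) = -conjBy M a := by
  simp [conjBy]

theorem star_conjBy (M : E →L[ℂ] F) (a : F →L[ℂ] F) : star (conjBy M a) = conjBy M (star a) := by
  simp only [conjBy, ContinuousLinearMap.star_eq_adjoint, ContinuousLinearMap.adjoint_comp,
    ContinuousLinearMap.adjoint_adjoint]
  rfl

theorem IsReflection.conjBy {M : E →L[ℂ] F} (hM : IsUnitaryMap M) {r : F →L[ℂ] F}
    (hr : IsReflection r) : IsReflection (conjBy M r) where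
  isSelfAdjoint := by rw [isSelfAdjoint_iff, star_conjBy, hr.isSelfAdjoint.star_eq]
  mul_self := by rw [← conjBy_mul hM, hr.mul_self, conjBy_one hM]

theorem IsPauliPair.conjBy {M : E →L[ℂ] F} (hM : IsUnitaryMap M) {x z : F →L[ℂ] F}
    (h : IsPauliPair x z) : IsPauliPair (conjBy M x) (conjBy M z) where
  isReflection_x := h.isReflection_x.conjBy hM
  isReflection_z := h.isReflection_z.conjBy hM
  anticomm := by rw [← conjBy_mul hM, ← conjBy_mul hM, ← conjBy_neg, h.anticomm]

theorem commute_conjBy {M : E →L[ℂ] F} (hM : IsUnitaryMap M) {a b : F →L[ℂ] F}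
    (h : Commute a b) : Commute (conjBy M a) (conjBy M b) := by
  rw [commute_iff_eq, ← conjBy_mul hM, ← conjBy_mul hM, h.eq]

theorem conjBy_pauliRefl (M : E →L[ℂ] F) (x z : F →L[ℂ] F) (t : ℝ) :
    conjBy M (pauliRefl x z t) = pauliRefl (conjBy M x) (conjBy M z) t := by
  simp only [pauliRefl, conjBy_add, conjBy_smul]

end Conjugation

/-! ### The ideal CHSH measurements as directions in the X, Z plane. -/

section Matrices

/-- The Pauli matrix `X`. -/
def matX : Matrix Bool Bool ℂ := fun i j => if i = j then 0 else 1

/-- The Pauli matrix `Z`. -/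
def matZ : Matrix Bool Bool ℂ := fun i j => if i = j then ((sgn i : ℝ) : ℂ) else 0

theorem matX_mul_self : matX * matX = 1 := by
  ext i j
  cases i <;> cases j <;> simp [matX, Matrix.mul_apply]

theorem matZ_mul_self : matZ * matZ = 1 := by
  ext i j
  cases i <;> cases j <;> simp [matZ, Matrix.mul_apply, sgn]

theorem matX_mul_matZ : matX * matZ = (-1 : ℂ) • (matZ * matX) := by
  ext i j
  cases i <;> cases j <;> simp [matX, matZ, Matrix.mul_apply, sgn]

theorem star_matX : star matX = matX := by
  ext i j
  cases i <;> cases j <;> simp [matX]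

theorem star_matZ : star matZ = matZ := by
  ext i j
  cases i <;> cases j <;> simp [matZ, sgn]

/-- The measurement directions of Alice. -/
def angleA (a : Bool) : ℝ := if a then Real.pi / 2 else 0

/-- The measurement directions of Bob. -/
def angleB (b : Bool) : ℝ := sgn b * (Real.pi / 4)

theorem idealA_eq (a : Bool) : idealA a =
    ((Real.cos (angleA a) : ℝ) : ℂ) • matZ + ((Real.sin (angleA a) : ℝ) : ℂ) • matX := by
  have h2 : (√2 : ℂ) ^ 2 = 2 := by
    rw [← Complex.ofReal_pow, Real.sq_sqrt (by norm_num)]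
    norm_num
  have h3 : (√2 : ℂ) ≠ 0 := by
    intro h
    rw [h] at h2
    norm_num at h2
  ext i j
  cases a <;> cases i <;> cases j <;>
    simp [idealA, reflOf, ketA, angleA, matX, matZ, sgn, Matrix.vecMulVec_apply,
      -Complex.ofReal_cos, -Complex.ofReal_sin] <;>
    field_simp <;> simp [h2] <;> norm_num

theorem idealB_eq (b : Bool) : idealB b =
    ((Real.cos (angleB b) : ℝ) : ℂ) • matZ + ((Real.sin (angleB b) : ℝ) : ℂ) • matX := by
  have hc : Real.cos (Real.pi / 4) =
      Real.cos (Real.pi / 8) ^ 2 - Real.sin (Real.pi / 8) ^ 2 := by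
    rw [← Real.cos_two_mul']
    congr 1
    ring
  have hs : Real.sin (Real.pi / 4) = 2 * Real.sin (Real.pi / 8) * Real.cos (Real.pi / 8) := by
    rw [← Real.sin_two_mul]
    congr 1
    ring
  have hcb : Real.cos (angleB b) = Real.cos (Real.pi / 4) := by
    cases b <;> simp [angleB, sgn]
  have hsb : Real.sin (angleB b) = sgn b * Real.sin (Real.pi / 4) := by
    cases b <;> simp [angleB, sgn]
  rw [hcb, hsb, hc, hs]
  unfold idealB ketB
  generalize Real.cos (Real.pi / 8) = c
  generalize Real.sin (Real.pi / 8) = s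
  ext i j
  cases b <;> cases i <;> cases j <;>
    simp [reflOf, matX, matZ, sgn, Matrix.vecMulVec_apply] <;> ring

theorem abs_cos_angle_sub_le (a b : Bool) : |Real.cos (angleA a - angleB b)| ≤ 3 / 4 := by
  have h2 : √2 ≤ 3 / 2 := Real.sqrt_le_iff.2 ⟨by norm_num, by norm_num⟩
  have h0 := Real.sqrt_nonneg 2
  rw [Real.cos_sub]
  cases a <;> cases b <;>
    simp [angleA, angleB, sgn, Real.cos_pi_div_four, Real.sin_pi_div_four, abs_of_nonneg h0,
      abs_div, abs_neg] <;> linarith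

end Matrices

/-! ### The tree of qubits described by a frame. -/

section Frames

variable {n : ℕ} {K : Type*} [NormedAddCommGroup K] [InnerProductSpace ℂ K] [CompleteSpace K]

theorem isPauliPair_onQubit (j : Fin n) :
    IsPauliPair (onQubit K j matX) (onQubit K j matZ) where
  isReflection_x := ⟨by rw [isSelfAdjoint_iff, star_onQubit, star_matX],
    by rw [← onQubit_mul, matX_mul_self, onQubit_one]⟩
  isReflection_z := ⟨by rw [isSelfAdjoint_iff, star_onQubit, star_matZ],
    by rw [← onQubit_mul, matZ_mul_self, onQubit_one]⟩
  anticomm := by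
    rw [← onQubit_mul, matX_mul_matZ, onQubit_smul, onQubit_mul]
    ext v
    simp

theorem onQubit_pauli (j : Fin n) (t : ℝ) :
    onQubit K j (((Real.cos t : ℝ) : ℂ) • matZ + ((Real.sin t : ℝ) : ℂ) • matX) =
      pauliRefl (onQubit K j matX) (onQubit K j matZ) t := by
  rw [onQubit_add, onQubit_smul, onQubit_smul, pauliRefl]

namespace QubitFrame

variable {H : Type*} [NormedAddCommGroup H] [InnerProductSpace ℂ H] [CompleteSpace H]
  (F : QubitFrame n H K)

theorem isUnitaryMap_step (j : Fin n) (h : Hist j) : IsUnitaryMap (F.step j h) := by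
  refine .of_norm_of_comp (norm_onLast j fun v => (F.U j h).norm_map v)
    (R := onLast j (F.U j h).symm.toContinuousLinearEquiv.toContinuousLinearMap) ?_
  rw [step, onLast_comp, ← onLast_id]
  congr 1
  ext1 v
  exact (F.U j h).apply_symm_apply v

theorem isUnitaryMap_location {k : ℕ} (hk : k ≤ n) (h : Hist k) :
    IsUnitaryMap (F.location k hk h) := by
  induction k with
  | zero =>
    refine .of_norm_of_comp (fun v => F.Y.norm_map v)
      (R := F.Y.symm.toContinuousLinearEquiv.toContinuousLinearMap) ?_
    ext1 v
    exact F.Y.apply_symm_apply v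
  | succ k ih => exact (F.isUnitaryMap_step _ _).comp (ih _ _)

/-- The map that locates the qubit of game `k` along the transcript `h` of the earlier games. -/
def locate (k : Fin n) (h : Hist k) : H →L[ℂ] Reg (Fin n) K :=
  F.step k h ∘L F.location k k.isLt.le h

theorem isUnitaryMap_locate (k : Fin n) (h : Hist k) : IsUnitaryMap (F.locate k h) :=
  (F.isUnitaryMap_step _ _).comp (F.isUnitaryMap_location _ _)

/-- A qubit that has been located is not moved by later unitaries. Hence earlier and later qubits on
a path can be expressed through the same unitary, which gives their commutation and, along a full
transcript, a common location map. -/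
theorem conjBy_step_onQubit {i j : Fin n} (hij : i < j) (h : Hist j) (G : Matrix Bool Bool ℂ) :
    conjBy (F.step j h) (onQubit K i G) = onQubit K i G :=
  conjBy_of_commute (F.isUnitaryMap_step j h) (commute_onLast_onQubit j _ hij G)

/-- The operator `G` on the qubit of game `k`, as located along the transcript `h`. -/
def qubitOp (G : Matrix Bool Bool ℂ) (k : ℕ) (h : Hist k) : H →L[ℂ] H :=
  if hk : k < n then conjBy (F.locate ⟨k, hk⟩ h) (onQubit K ⟨k, hk⟩ G) else 0

theorem qubitOp_of_lt (G : Matrix Bool Bool ℂ) (k : Fin n) (h : Hist k) :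
    F.qubitOp G k h = conjBy (F.locate k h) (onQubit K k G) := by
  rw [qubitOp, dif_pos k.isLt]

theorem exists_eq_conjBy_location {k : ℕ} (hk : k ≤ n) {h : Hist k} {g : H →L[ℂ] H}
    (hg : g ∈ pathGens (F.qubitOp matX) (F.qubitOp matZ) k h) :
    ∃ i : Fin n, i.1 < k ∧ ∃ G, g = conjBy (F.location k hk h) (onQubit K i G) := by
  induction k with
  | zero => exact hg.elim
  | succ k ih =>
    rcases hg with (hg | hg) | hg
    · exact ⟨⟨k, hk⟩, Nat.lt_succ_self k, matX, hg.trans (F.qubitOp_of_lt matX ⟨k, hk⟩ _)⟩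
    · exact ⟨⟨k, hk⟩, Nat.lt_succ_self k, matZ, hg.trans (F.qubitOp_of_lt matZ ⟨k, hk⟩ _)⟩
    · obtain ⟨i, hi, G, rfl⟩ := ih (Nat.le_of_succ_le hk) hg
      refine ⟨i, hi.trans (Nat.lt_succ_self k), G, ?_⟩
      rw [location, conjBy_comp, F.conjBy_step_onQubit (j := ⟨k, hk⟩) hi]

theorem commute_qubitOp {k : ℕ} (hk : k < n) {h : Hist k} {g : H →L[ℂ] H}
    (hg : g ∈ pathGens (F.qubitOp matX) (F.qubitOp matZ) k h) (G : Matrix Bool Bool ℂ) :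
    Commute g (F.qubitOp G k h) := by
  obtain ⟨i, hi, G', rfl⟩ := F.exists_eq_conjBy_location hk.le hg
  have h1 := F.qubitOp_of_lt G ⟨k, hk⟩ h
  simp only at h1
  rw [h1, ← F.conjBy_step_onQubit (j := ⟨k, hk⟩) (i := i) hi h, ← conjBy_comp]
  exact commute_conjBy (F.isUnitaryMap_locate ⟨k, hk⟩ h) (commute_onQubit (Fin.ne_of_lt hi) _ _)

/-- The tree of qubits of a frame. -/
def tree : PauliTree n (H →L[ℂ] H) where
  X := F.qubitOp matX
  Z := F.qubitOp matZ
  isPauliPair k hk h := by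
    have h1 := F.qubitOp_of_lt matX ⟨k, hk⟩ h
    have h2 := F.qubitOp_of_lt matZ ⟨k, hk⟩ h
    simp only at h1 h2
    rw [h1, h2]
    exact (isPauliPair_onQubit _).conjBy (F.isUnitaryMap_locate ⟨k, hk⟩ h)
  commute_path k hk h g hg := ⟨F.commute_qubitOp hk hg _, F.commute_qubitOp hk hg _⟩

theorem qubitOp_prefix (G : Matrix Bool Bool ℂ) (g : Hist n) (k : Fin n) :
    F.qubitOp G k (g.prefix k) = conjBy (F.location n le_rfl g) (onQubit K k G) := by
  have key : ∀ m (hm : m ≤ n), k.1 < m → F.qubitOp G k (g.prefix k) =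
      conjBy (F.location m hm (g.prefix m)) (onQubit K k G) := by
    intro m
    induction m with
    | zero => exact fun _ h => absurd h (Nat.not_lt_zero _)
    | succ m ih =>
      intro hm hkm
      rcases Nat.lt_succ_iff_lt_or_eq.1 hkm with h | h
      · rw [ih (Nat.le_of_succ_le hm) h, location, conjBy_comp,
          F.conjBy_step_onQubit (j := ⟨m, hm⟩) h]
        rfl
      · subst h
        rw [qubitOp_of_lt]
        rfl
  rw [key n le_rfl k.isLt, Hist.prefix_self]

/-- The reflections `S` measure the qubits of the tree `T` along the directions `θ`. -/
def _root_.CHSH.Reflections.Measures (S : Reflections n H) (T : PauliTree n (H →L[ℂ] H))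
    (θ : Bool → ℝ) : Prop :=
  ∀ (j : Fin n) (h : Hist j) (a : Bool), S.R j h a = pauliRefl (T.X j h) (T.Z j h) (θ a)

theorem _root_.CHSH.Reflections.Measures.proj_eq {S : Reflections n H}
    {T : PauliTree n (H →L[ℂ] H)} {θ : Bool → ℝ} (hS : S.Measures T θ) (j : Fin n)
    (h : Hist (j + 1)) : S.proj j h = T.proj θ j (Fin.init h) (h (Fin.last j)) := by
  rw [Reflections.proj, hS]
  rfl

theorem _root_.CHSH.Reflections.Measures.seqProj_eq {S : Reflections n H}
    {T : PauliTree n (H →L[ℂ] H)} {θ : Bool → ℝ} (hS : S.Measures T θ) {k : ℕ} (hk : k ≤ n)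
    (h : Hist k) : S.seqProj k hk h = T.run θ k h := by
  induction k with
  | zero => rfl
  | succ k ih => rw [Reflections.seqProj, PauliTree.run, ih, hS.proj_eq ⟨k, hk⟩]

theorem Describes.measures {G : Bool → Matrix Bool Bool ℂ} {θ : Bool → ℝ}
    (hG : ∀ a, G a = ((Real.cos (θ a) : ℝ) : ℂ) • matZ + ((Real.sin (θ a) : ℝ) : ℂ) • matX)
    {F : QubitFrame n H K} {S : Reflections n H} (h : F.Describes G S) :
    S.Measures F.tree θ := by
  intro j h' a
  rw [h, hG, onQubit_pauli]
  change conjBy (F.locate j h') _ = pauliRefl (F.qubitOp matX j h') (F.qubitOp matZ j h') _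
  rw [conjBy_pauliRefl, qubitOp_of_lt, qubitOp_of_lt]

/-- The reflections on the qubits whose locations are those along the transcript `g`. -/
def fixedReflections (g : Hist n) (θ : Bool → ℝ) : Reflections n H where
  R j _ a := pauliRefl (F.qubitOp matX j (g.prefix j)) (F.qubitOp matZ j (g.prefix j)) (θ a)
  selfAdjoint j _ _ :=
    (isReflection_pauliRefl (F.tree.isPauliPair j j.isLt (g.prefix j)) _).isSelfAdjoint
  mul_self j _ _ := (isReflection_pauliRefl (F.tree.isPauliPair j j.isLt (g.prefix j)) _).mul_self

theorem measures_fixedReflections (g : Hist n) (θ : Bool → ℝ) :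
    (F.fixedReflections g θ).Measures (F.tree.fix g) θ := fun _ _ _ => rfl

theorem fixedReflections_R {G : Bool → Matrix Bool Bool ℂ} {θ : Bool → ℝ}
    (hG : ∀ a, G a = ((Real.cos (θ a) : ℝ) : ℂ) • matZ + ((Real.sin (θ a) : ℝ) : ℂ) • matX)
    (g : Hist n) (j : Fin n) (h : Hist j) (a : Bool) :
    (F.fixedReflections g θ).R j h a =
      conjBy (F.location n le_rfl g) (onQubit K j (G a)) := by
  rw [hG, onQubit_pauli, conjBy_pauliRefl, ← qubitOp_prefix, ← qubitOp_prefix]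
  rfl

end QubitFrame

end Frames

/-! ### Computational basis components of a register. -/

section Components

variable {ι : Type} [Fintype ι] [DecidableEq ι] {K : Type*} [NormedAddCommGroup K]
  [InnerProductSpace ℂ K] [CompleteSpace K]

/-- The component `⟨x|` of a register. -/
def braL (K : Type*) [NormedAddCommGroup K] [InnerProductSpace ℂ K] (x : ι → Bool) :
    Reg ι K →L[ℂ] K :=
  PiLp.proj 2 (fun _ : ι → Bool => K) x

theorem braL_apply (x : ι → Bool) (v : Reg ι K) : braL K x v = v x := rfl

theorem ketL_apply (x y : ι → Bool) (v : K) : ketL K x v y = if y = x then v else 0 := by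
  by_cases h : y = x <;> simp [ketL, h]

theorem sum_ketL_comp_braL : ∑ x, ketL K x ∘L braL K x = .id ℂ (Reg ι K) := by
  refine ContinuousLinearMap.ext fun v => PiLp.ext fun y => ?_
  simp [ketL_apply, braL_apply]

theorem adjoint_ketL (x : ι → Bool) :
    ContinuousLinearMap.adjoint (ketL K x) = braL K x := by
  symm
  rw [ContinuousLinearMap.eq_adjoint_iff]
  intro v w
  rw [PiLp.inner_apply, Finset.sum_eq_single x]
  · simp [ketL_apply, braL_apply]
  · intro y _ hy
    simp [ketL_apply, hy]
  · simp

theorem braL_comp_onQubit_matZ (x : ι → Bool) (j : ι) :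
    braL K x ∘L onQubit K j matZ = ((sgn (x j) : ℝ) : ℂ) • braL K x := by
  ext v
  change onQubit K j matZ v x = ((sgn (x j) : ℝ) : ℂ) • v x
  rw [onQubit_apply, Finset.sum_eq_single (x j)]
  · simp [matZ]
  · intro c _ hc
    simp [matZ, hc.symm]
  · simp

theorem braL_comp_onQubit_matX (x : ι → Bool) (j : ι) :
    braL K x ∘L onQubit K j matX = braL K (Function.update x j (!x j)) := by
  ext v
  change onQubit K j matX v x = v (Function.update x j (!x j))
  rw [onQubit_apply, Finset.sum_eq_single (!x j)]
  · simp [matX]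
  · intro c _ hc
    have : c = x j := by revert hc; cases c <;> cases x j <;> simp
    simp [matX, this]
  · simp

/-- Any two bit strings are joined by flipping one bit at a time. -/
theorem eq_of_forall_flip {E : Type*} {f : (ι → Bool) → E}
    (hf : ∀ x j, f (Function.update x j (!x j)) = f x) (x y : ι → Bool) : f x = f y := by
  have hf' : ∀ x j b, f (Function.update x j b) = f x := by
    intro x j b
    by_cases hb : b = x j
    · rw [hb, Function.update_eq_self]
    · rw [show b = !x j by revert hb; cases b <;> cases x j <;> simp, hf]
  have key : ∀ s : Finset ι, f (s.piecewise x y) = f y := by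
    intro s
    induction s using Finset.induction_on with
    | empty => rw [Finset.piecewise_empty]
    | insert j s _ ih => rw [Finset.piecewise_insert, hf', ih]
  rw [← key Finset.univ, Finset.piecewise_univ]

end Components

/-! ### States stabilized by all pairs of Pauli operators. -/

section Extraction

variable {n : ℕ} {KA KB HC : Type*}
  [NormedAddCommGroup KA] [InnerProductSpace ℂ KA] [CompleteSpace KA]
  [NormedAddCommGroup KB] [InnerProductSpace ℂ KB] [CompleteSpace KB]
  [NormedAddCommGroup HC] [InnerProductSpace ℂ HC]

theorem prod_epr (x y : Fin n → Bool) :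
    ∏ i, epr (x i) (y i) = if x = y then (((1 / √2) ^ n : ℝ) : ℂ) else 0 := by
  by_cases h : x = y
  · subst h
    simp [epr]
  · rw [if_neg h]
    obtain ⟨i, hi⟩ := Function.ne_iff.1 h
    exact Finset.prod_eq_zero (Finset.mem_univ i) (if_neg hi)

/-- The components of a vector with respect to the computational bases of both registers. -/
def component (χ : Hilb3 (Reg (Fin n) KA) (Reg (Fin n) KB) HC) (x y : Fin n → Bool) :
    Hilb3 KA KB HC :=
  map3 HC (braL KA x) (braL KB y) χ

theorem sum_map3_ketL_component (χ : Hilb3 (Reg (Fin n) KA) (Reg (Fin n) KB) HC) :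
    ∑ x, ∑ y, map3 HC (ketL KA x) (ketL KB y) (component χ x y) = χ := by
  have h : ∑ x, ∑ y, map3 HC (ketL KA x ∘L braL KA x) (ketL KB y ∘L braL KB y) =
      .id ℂ (Hilb3 (Reg (Fin n) KA) (Reg (Fin n) KB) HC) := by
    simp only [← map3_sum_right, ← map3_sum_left, sum_ketL_comp_braL, map3_id]
  have := DFunLike.congr_fun h χ
  simpa only [component, map3_apply_apply, sum_apply,
    ContinuousLinearMap.id_apply] using this

theorem sum_norm_component_sq (χ : Hilb3 (Reg (Fin n) KA) (Reg (Fin n) KB) HC) :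
    ∑ x, ∑ y, ‖component χ x y‖ ^ 2 = ‖χ‖ ^ 2 := by
  have h : (inner ℂ χ χ : ℂ) = ∑ x, ∑ y, inner ℂ (component χ x y) (component χ x y) := by
    conv_lhs => rw [← sum_map3_ketL_component χ]
    simp only [sum_inner]
    conv_lhs => rw [sum_map3_ketL_component χ]
    refine Finset.sum_congr rfl fun x _ => Finset.sum_congr rfl fun y _ => ?_
    rw [← ContinuousLinearMap.adjoint_inner_right, adjoint_map3, adjoint_ketL, adjoint_ketL]
    rfl
  simp only [inner_self_eq_norm_sq_to_K] at h
  exact_mod_cast h.symm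

variable {χ : Hilb3 (Reg (Fin n) KA) (Reg (Fin n) KB) HC}

/-- Where x and y differ in bit j, the two sides of the Z relation give this component opposite
signs. -/
theorem component_eq_zero
    (hZ : ∀ j, map3 HC (onQubit KA j matZ) (.id ℂ _) χ = map3 HC (.id ℂ _) (onQubit KB j matZ) χ)
    {x y : Fin n → Bool} (hxy : x ≠ y) : component χ x y = 0 := by
  obtain ⟨j, hj⟩ := Function.ne_iff.1 hxy
  have h := congrArg (map3 HC (braL KA x) (braL KB y)) (hZ j)
  rw [map3_apply_apply, map3_apply_apply, braL_comp_onQubit_matZ, braL_comp_onQubit_matZ,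
    ContinuousLinearMap.comp_id, ContinuousLinearMap.comp_id, map3_smul_left,
    map3_smul_right] at h
  change ((sgn (x j) : ℝ) : ℂ) • component χ x y = ((sgn (y j) : ℝ) : ℂ) • component χ x y at h
  rw [← sub_eq_zero, ← sub_smul, smul_eq_zero] at h
  refine h.resolve_left fun h => hj ?_
  rw [sub_eq_zero, Complex.ofReal_inj] at h
  revert h
  cases x j <;> cases y j <;> simp [sgn] <;> norm_num

/-- Applied with y already flipped at j, this makes the diagonal components invariant under bit
flips, hence all equal. -/
theorem component_flip
    (hX : ∀ j, map3 HC (onQubit KA j matX) (.id ℂ _) χ = map3 HC (.id ℂ _) (onQubit KB j matX) χ)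
    (x y : Fin n → Bool) (j : Fin n) :
    component χ (Function.update x j (!x j)) y = component χ x (Function.update y j (!y j)) := by
  have h := congrArg (map3 HC (braL KA x) (braL KB y)) (hX j)
  rwa [map3_apply_apply, map3_apply_apply, braL_comp_onQubit_matX, braL_comp_onQubit_matX,
    ContinuousLinearMap.comp_id, ContinuousLinearMap.comp_id] at h

/-- A state stabilized by `X ⊗ X` and `Z ⊗ Z` on each pair of qubits consists of EPR pairs. -/
theorem exists_eq_eprPairs
    (hX : ∀ j, map3 HC (onQubit KA j matX) (.id ℂ _) χ = map3 HC (.id ℂ _) (onQubit KB j matX) χ)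
    (hZ : ∀ j, map3 HC (onQubit KA j matZ) (.id ℂ _) χ = map3 HC (.id ℂ _) (onQubit KB j matZ) χ)
    (hχ : ‖χ‖ = 1) : ∃ ψ', ‖ψ'‖ = 1 ∧ χ = Strategy.eprPairs n ψ' := by
  obtain ⟨c, hc⟩ : ∃ c, ∀ x, component χ x x = c := by
    refine ⟨component χ (fun _ => false) (fun _ => false), fun x => ?_⟩
    refine eq_of_forall_flip (f := fun x => component χ x x) (fun x j => ?_) x _
    have := component_flip hX x (Function.update x j (!x j)) j
    simpa using this
  have hcomp : ∀ x y, component χ x y = if x = y then c else 0 := by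
    intro x y
    by_cases h : x = y
    · rw [if_pos h, ← h, hc]
    · rw [if_neg h, component_eq_zero hZ h]
  have h2 : (0 : ℝ) < √2 := by positivity
  -- There are 2^n equal diagonal components c, so ‖χ‖ = 1 gives ‖c‖² = 2^{-n}; the factor (√2)^n
  -- makes the residual state a unit vector.
  refine ⟨(((√2) ^ n : ℝ) : ℂ) • c, ?_, ?_⟩
  · have h := sum_norm_component_sq χ
    have hsum : ∀ x : Fin n → Bool, ∑ y, ‖component χ x y‖ ^ 2 = ‖c‖ ^ 2 := by
      intro x
      rw [Finset.sum_eq_single x]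
      · rw [hc]
      · intro y _ hy
        rw [component_eq_zero hZ hy.symm]
        simp
      · simp
    simp only [hsum, hχ, Finset.sum_const, Finset.card_univ, Fintype.card_fun, Fintype.card_bool,
      Fintype.card_fin, nsmul_eq_mul] at h
    rw [norm_smul, Complex.norm_real, Real.norm_of_nonneg (by positivity)]
    rw [← sq_eq_sq₀ (by positivity) zero_le_one, mul_pow, ← pow_mul, mul_comm n 2, pow_mul,
      Real.sq_sqrt (by norm_num)]
    push_cast at h
    rw [h]
  · conv_lhs => rw [← sum_map3_ketL_component χ]
    refine Finset.sum_congr rfl fun x _ => Finset.sum_congr rfl fun y _ => ?_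
    rw [hcomp, prod_epr]
    by_cases h : x = y
    · rw [if_pos h, if_pos h, map_smul, smul_smul, ← Complex.ofReal_mul, ← mul_pow,
        one_div_mul_cancel h2.ne', one_pow, Complex.ofReal_one, one_smul]
    · rw [if_neg h, if_neg h, map_zero, zero_smul]

end Extraction

/-! ### Transport of trees along star homomorphisms. -/

section MapTree

variable {𝓐 𝓑 : Type*} [Ring 𝓐] [StarRing 𝓐] [Algebra ℂ 𝓐] [StarModule ℂ 𝓐]
  [Ring 𝓑] [StarRing 𝓑] [Algebra ℂ 𝓑] [StarModule ℂ 𝓑] (φ : 𝓐 →⋆ₐ[ℂ] 𝓑)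

theorem IsReflection.map {r : 𝓐} (h : IsReflection r) : IsReflection (φ r) where
  isSelfAdjoint := by rw [isSelfAdjoint_iff, ← map_star, h.isSelfAdjoint.star_eq]
  mul_self := by rw [← map_mul, h.mul_self, map_one]

theorem IsPauliPair.map {x z : 𝓐} (h : IsPauliPair x z) : IsPauliPair (φ x) (φ z) where
  isReflection_x := h.isReflection_x.map φ
  isReflection_z := h.isReflection_z.map φ
  anticomm := by rw [← map_mul, h.anticomm, map_neg, map_mul]

theorem map_pauliRefl (x z : 𝓐) (t : ℝ) :
    φ (pauliRefl x z t) = pauliRefl (φ x) (φ z) t := by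
  simp only [pauliRefl, map_add, map_smul]

theorem map_pauliProj (x z : 𝓐) (t : ℝ) (b : Bool) :
    φ (pauliProj x z t b) = pauliProj (φ x) (φ z) t b := by
  simp only [pauliProj, halfProj, map_smul, map_add, map_one, map_pauliRefl]

theorem pathGens_map (X Z : (k : ℕ) → Hist k → 𝓐) (k : ℕ) (h : Hist k) :
    pathGens (fun k h => φ (X k h)) (fun k h => φ (Z k h)) k h = φ '' pathGens X Z k h := by
  induction k with
  | zero => exact (Set.image_empty _).symm
  | succ k ih => rw [pathGens, pathGens, ih, Set.image_union, Set.image_pair]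

namespace PauliTree

variable {n : ℕ} (T : PauliTree n 𝓐)

/-- The image of a tree of qubits under a homomorphism. -/
def map : PauliTree n 𝓑 where
  X k h := φ (T.X k h)
  Z k h := φ (T.Z k h)
  isPauliPair k hk h := (T.isPauliPair k hk h).map φ
  commute_path k hk h g hg := by
    rw [pathGens_map] at hg
    obtain ⟨g, hg, rfl⟩ := hg
    exact ⟨(T.commute_path k hk h g hg).1.map φ, (T.commute_path k hk h g hg).2.map φ⟩

theorem map_proj (θ : Bool → ℝ) (k : ℕ) (h : Hist k) (p : Bool × Bool) :
    (T.map φ).proj θ k h p = φ (T.proj θ k h p) :=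
  (map_pauliProj φ _ _ _ _).symm

theorem map_run (θ : Bool → ℝ) (k : ℕ) (h : Hist k) :
    (T.map φ).run θ k h = φ (T.run θ k h) := by
  induction k with
  | zero => exact (map_one φ).symm
  | succ k ih => rw [run, run, ih, map_proj, map_mul]

end PauliTree

end MapTree

/-! ### From L² distance of branches to trace distance. -/

section TraceDistance

variable {H : Type*} [NormedAddCommGroup H] [InnerProductSpace ℂ H] [CompleteSpace H]

theorem sum_mul_le_of_sum_sq_le {ι : Type*} [Fintype ι] {f g : ι → ℝ} {a b : ℝ} (ha : 0 ≤ a)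
    (hb : 0 ≤ b) (hf : ∑ i, f i ^ 2 ≤ a ^ 2) (hg : ∑ i, g i ^ 2 ≤ b ^ 2) :
    ∑ i, f i * g i ≤ a * b :=
  (Real.sum_mul_le_sqrt_mul_sqrt _ _ _).trans <|
    mul_le_mul (Real.sqrt_le_iff.2 ⟨ha, hf⟩) (Real.sqrt_le_iff.2 ⟨hb, hg⟩) (Real.sqrt_nonneg _) ha

/-- The scaled vector `2^{-k/2} v`. -/
def halfScale (k : ℕ) (v : H) : H := ((√(1 / 2) ^ k : ℝ) : ℂ) • v

theorem norm_halfScale_sq (k : ℕ) (v : H) : ‖halfScale k v‖ ^ 2 = (1 / 2) ^ k * ‖v‖ ^ 2 := by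
  rw [halfScale, norm_smul, Complex.norm_real, Real.norm_of_nonneg (by positivity), mul_pow,
    ← pow_mul, mul_comm k, pow_mul, Real.sq_sqrt (by norm_num)]

/-- Cauchy–Schwarz applied to ∑ ‖u − v‖ (‖u‖ + ‖v‖). Each family has total squared norm 1, whence
the factor 2. -/
theorem traceNorm_blockDiag_halfScale_le {X : Type*} [Fintype X] {k : ℕ} {u v : X → H} {c : ℝ}
    (hc : 0 ≤ c) (hu : ∑ x, (1 / 2) ^ k * ‖u x‖ ^ 2 = 1) (hv : ∑ x, (1 / 2) ^ k * ‖v x‖ ^ 2 = 1)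
    (huv : ∑ x, (1 / 2) ^ k * ‖u x - v x‖ ^ 2 ≤ c ^ 2) :
    traceNorm (blockDiag (fun x => InnerProductSpace.rankOne ℂ (halfScale k (u x))
        (halfScale k (u x))) -
      blockDiag (fun x => InnerProductSpace.rankOne ℂ (halfScale k (v x)) (halfScale k (v x)))) ≤
      ENNReal.ofReal (2 * c) := by
  refine (traceNorm_blockDiag_rankOne_sub_le _ _).trans (ENNReal.ofReal_le_ofReal ?_)
  simp_rw [← norm_halfScale_sq] at hu hv huv
  have hsub : ∀ x, halfScale k (u x) - halfScale k (v x) = halfScale k (u x - v x) :=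
    fun x => (smul_sub _ _ _).symm
  simp_rw [hsub, mul_add, Finset.sum_add_distrib]
  have h1 := sum_mul_le_of_sum_sq_le hc zero_le_one huv (by rw [hu]; norm_num)
  have h2 := sum_mul_le_of_sum_sq_le hc zero_le_one huv (by rw [hv]; norm_num)
  linarith

theorem half_smul_comp_rankOne_comp {p : H →L[ℂ] H} (hp : IsSelfAdjoint p) (k : ℕ) (u : H) :
    (1 / 2 : ℂ) • (p ∘L InnerProductSpace.rankOne ℂ (halfScale k u) (halfScale k u) ∘L p) =
      InnerProductSpace.rankOne ℂ (halfScale (k + 1) (p u)) (halfScale (k + 1) (p u)) := by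
  have h2 : ((√(1 / 2) : ℝ) : ℂ) * ((√(1 / 2) : ℝ) : ℂ) = 1 / 2 := by
    rw [← Complex.ofReal_mul, Real.mul_self_sqrt (by norm_num)]
    norm_num
  ext v
  have hs : ∀ w, halfScale (k + 1) (p w) = ((√(1 / 2) : ℝ) : ℂ) • p (halfScale k w) := by
    intro w
    rw [halfScale, halfScale, map_smul, smul_smul, ← Complex.ofReal_mul, pow_succ']
  simp only [smul_apply, ContinuousLinearMap.comp_apply, InnerProductSpace.rankOne_apply, hs,
    inner_smul_left, map_smul, smul_smul, inner_isSelfAdjoint hp, Complex.conj_ofReal]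
  rw [← h2]
  ring_nf

end TraceDistance

/-! ### The CHSH operator in terms of Pauli operators. -/

section Correlation

variable {𝓐 : Type*} [Ring 𝓐] [StarRing 𝓐] [Algebra ℂ 𝓐] [StarModule ℂ 𝓐]

theorem sum_sgn_smul_pauliRefl_mul (x z x' z' : 𝓐) :
    ∑ a : Bool, ∑ b : Bool, ((sgn (a && b) : ℝ) : ℂ) •
      (pauliRefl x z (angleA a) * pauliRefl x' z' (angleB b)) =
      ((√2 : ℝ) : ℂ) • (x * x' + z * z') := by
  have hA : ∀ a, pauliRefl x z (angleA a) = if a then x else z := by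
    intro a
    cases a <;> simp [pauliRefl, angleA, -Complex.ofReal_cos, -Complex.ofReal_sin]
  have hB : ∀ b, pauliRefl x' z' (angleB b) =
      ((√2 / 2 : ℝ) : ℂ) • z' + ((sgn b * (√2 / 2) : ℝ) : ℂ) • x' := by
    intro b
    cases b <;> simp [pauliRefl, angleB, sgn, -Complex.ofReal_cos, -Complex.ofReal_sin]
  simp only [hA, hB, Fintype.sum_bool, mul_add, mul_smul_comm]
  simp [sgn]
  module

end Correlation

/-! ### From strategies to trees of qubits and back. -/

namespace Strategy

variable {n : ℕ} {HA : Type u₁} {HB : Type u₂} {HC : Type u₃}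
  [NormedAddCommGroup HA] [InnerProductSpace ℂ HA] [CompleteSpace HA]
  [NormedAddCommGroup HB] [InnerProductSpace ℂ HB] [CompleteSpace HB]
  [NormedAddCommGroup HC] [InnerProductSpace ℂ HC]

theorem independent_map (TA : PauliTree n (HA →L[ℂ] HA)) (TB : PauliTree n (HB →L[ℂ] HB)) :
    (TA.map (aliceHom HA HB HC)).Independent (TB.map (bobHom HA HB HC)) where
  xx _ _ _ _ := commute_aliceHom_bobHom _ _
  xz _ _ _ _ := commute_aliceHom_bobHom _ _
  zx _ _ _ _ := commute_aliceHom_bobHom _ _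
  zz _ _ _ _ := commute_aliceHom_bobHom _ _

variable {S : Strategy n HA HB HC}

section Play

variable {TA : PauliTree n (HA →L[ℂ] HA)} {TB : PauliTree n (HB →L[ℂ] HB)} {θ : Bool → ℝ}

theorem playA_eq_rankOne (hS : S.alice.Measures TA θ) {k : ℕ} (hk : k ≤ n) :
    S.playA k hk = fun h =>
      InnerProductSpace.rankOne ℂ (halfScale k ((TA.map (aliceHom HA HB HC)).run θ k h S.ψ))
        (halfScale k ((TA.map (aliceHom HA HB HC)).run θ k h S.ψ)) := by
  funext h
  induction k with
  | zero => simp [playA, halfScale, PauliTree.run]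
  | succ k ih =>
    rw [playA, ih, hS.proj_eq, ← aliceHom_apply, ← PauliTree.map_proj,
      half_smul_comp_rankOne_comp]
    · rfl
    · exact (isStarProjection_pauliProj
        ((TA.map (aliceHom HA HB HC)).isPauliPair k hk _) _ _).isSelfAdjoint

theorem playB_eq_rankOne (hS : S.bob.Measures TB θ) {k : ℕ} (hk : k ≤ n) :
    S.playB k hk = fun h =>
      InnerProductSpace.rankOne ℂ (halfScale k ((TB.map (bobHom HA HB HC)).run θ k h S.ψ))
        (halfScale k ((TB.map (bobHom HA HB HC)).run θ k h S.ψ)) := by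
  funext h
  induction k with
  | zero => simp [playB, halfScale, PauliTree.run]
  | succ k ih =>
    rw [playB, ih, hS.proj_eq, ← bobHom_apply, ← PauliTree.map_proj,
      half_smul_comp_rankOne_comp]
    · rfl
    · exact (isStarProjection_pauliProj
        ((TB.map (bobHom HA HB HC)).isPauliPair k hk _) _ _).isSelfAdjoint

end Play

section Structured

variable {TA : PauliTree n (HA →L[ℂ] HA)} {TB : PauliTree n (HB →L[ℂ] HB)} {θ θ' : Bool → ℝ}

theorem unnormState_eq (hA : S.alice.Measures TA θ) (hB : S.bob.Measures TB θ') {k : ℕ}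
    (hk : k ≤ n) (x y : Hist k) : S.unnormState k hk x y =
      (TA.map (aliceHom HA HB HC)).run θ k x ((TB.map (bobHom HA HB HC)).run θ' k y S.ψ) := by
  rw [PauliTree.map_run, PauliTree.map_run, ← clm_mul_apply, aliceHom_mul_bobHom,
    unnormState, hA.seqProj_eq hk, hB.seqProj_eq hk]

/-- Multiplying by the squared norm removes the normalization; for a transcript of probability zero
both sides vanish. -/
theorem correlation_mul_norm_sq (S : Strategy n HA HB HC) (j : Fin n) (x y : Hist j) :
    S.correlation j x y * ‖S.unnormState j j.isLt.le x y‖ ^ 2 =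
      ∑ a : Bool, ∑ b : Bool, sgn (a && b) *
        (inner ℂ (S.unnormState j j.isLt.le x y)
          (map3 HC (S.alice.R j x a) (S.bob.R j y b) (S.unnormState j j.isLt.le x y))).re := by
  rw [correlation, Finset.sum_mul]
  refine Finset.sum_congr rfl fun a _ => ?_
  rw [Finset.sum_mul]
  refine Finset.sum_congr rfl fun b _ => ?_
  rw [state]
  generalize S.unnormState j j.isLt.le x y = v
  rw [map_smul, inner_smul_left, inner_smul_right, Complex.conj_ofReal, ← mul_assoc,
    ← Complex.ofReal_mul, Complex.re_ofReal_mul]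
  rcases eq_or_ne v 0 with rfl | hv
  · simp
  · have := norm_ne_zero_iff.2 hv
    field_simp

theorem correlation_eq (hA : S.alice.Measures TA angleA) (hB : S.bob.Measures TB angleB)
    (j : Fin n) (x y : Hist j) :
    S.correlation j x y * ‖S.unnormState j j.isLt.le x y‖ ^ 2 =
      √2 * (inner ℂ (S.unnormState j j.isLt.le x y)
        (((TA.map (aliceHom HA HB HC)).X j x * (TB.map (bobHom HA HB HC)).X j y +
          (TA.map (aliceHom HA HB HC)).Z j x * (TB.map (bobHom HA HB HC)).Z j y)
          (S.unnormState j j.isLt.le x y))).re := by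
  rw [correlation_mul_norm_sq]
  generalize S.unnormState j j.isLt.le x y = v
  have h := congrArg (fun f : Hilb3 HA HB HC →L[ℂ] Hilb3 HA HB HC => (inner ℂ v (f v)).re)
    (sum_sgn_smul_pauliRefl_mul ((TA.map (aliceHom HA HB HC)).X j x)
      ((TA.map (aliceHom HA HB HC)).Z j x) ((TB.map (bobHom HA HB HC)).X j y)
      ((TB.map (bobHom HA HB HC)).Z j y))
  simp only [sum_apply, smul_apply, inner_sum, inner_smul_right, Complex.re_sum,
    Complex.re_ofReal_mul] at h
  rw [← h]
  refine Finset.sum_congr rfl fun a _ => Finset.sum_congr rfl fun b _ => ?_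
  rw [hA, hB, ← aliceHom_mul_bobHom, map_pauliRefl, map_pauliRefl]
  rfl

theorem sum_prob (hA : S.alice.Measures TA θ) (hB : S.bob.Measures TB θ') {k : ℕ} (hk : k ≤ n) :
    ∑ x, ∑ y, S.prob k hk x y = 1 := by
  simp only [prob, unnormState_eq hA hB hk]
  rw [sum_joint_run (independent_map TA TB) hk, S.norm_ψ, one_pow]

/-- In a structured strategy, the qubits of each game are close to an EPR pair. -/
theorem IsStructured.sum_one_sub_epr_le {δ ε : ℝ} (hε : 0 ≤ ε)
    (hS : S.IsStructured δ ε) (hA : S.alice.Measures TA angleA) (hB : S.bob.Measures TB angleB)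
    {k : ℕ} (hk : k < n) :
    ∑ x, ∑ y, (1 / 4) ^ k * ‖(1 - PauliTree.eprAt (TA.map (aliceHom HA HB HC))
      (TB.map (bobHom HA HB HC)) k x y) ((TA.map (aliceHom HA HB HC)).run angleA k x
        ((TB.map (bobHom HA HB HC)).run angleB k y S.ψ))‖ ^ 2 ≤ min 1 (δ + ε) := by
  have hind := independent_map (HC := HC) TA TB
  have hprob := sum_prob hA hB hk.le
  have hstar : ∀ x y, IsStarProjection (1 - PauliTree.eprAt (TA.map (aliceHom HA HB HC))
      (TB.map (bobHom HA HB HC)) k x y) := fun x y => (hind.isStarProjection_epr hk x y).one_sub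
  have h0 := hS ⟨k, hk⟩
  simp only [← unnormState_eq hA hB hk.le]
  have h1 : ∀ x y, (1 / 4) ^ k * ‖(1 - PauliTree.eprAt (TA.map (aliceHom HA HB HC))
      (TB.map (bobHom HA HB HC)) k x y) (S.unnormState k hk.le x y)‖ ^ 2 ≤
      S.prob k hk.le x y := by
    intro x y
    rw [prob]
    gcongr
    exact norm_starProjection_le (hstar x y) _
  -- The trivial bound 1 is kept because a small power of δ + ε dominates its square root only when
  -- the latter is capped.
  refine le_min ?_ ?_
  · exact (Finset.sum_le_sum fun x _ => Finset.sum_le_sum fun y _ => h1 x y).trans_eq hprob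
  · classical
    -- A structured transcript contributes at most ε times its probability. Any other contributes at
    -- most its whole probability, and these amount to at most δ in total.
    have h2 : ∀ x y, (1 / 4) ^ k * ‖(1 - PauliTree.eprAt (TA.map (aliceHom HA HB HC))
        (TB.map (bobHom HA HB HC)) k x y) (S.unnormState k hk.le x y)‖ ^ 2 ≤
        ε * S.prob k hk.le x y + (S.prob k hk.le x y -
          if 2 * √2 - ε ≤ S.correlation ⟨k, hk⟩ x y then S.prob k hk.le x y else 0) := by
      intro x y
      have hp : 0 ≤ S.prob k hk.le x y := by rw [prob]; positivity
      split_ifs with hc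
      · have := (hind.isQubitPair hk x y).norm_sq_one_sub_eprProj_le_of_correlation hε
          ((mul_le_mul_of_nonneg_right hc (sq_nonneg ‖S.unnormState k hk.le x y‖)).trans_eq
            (correlation_eq hA hB ⟨k, hk⟩ x y))
        rw [sub_self, add_zero, prob, mul_left_comm]
        exact mul_le_mul_of_nonneg_left this (by positivity)
      · have := h1 x y
        have := mul_nonneg hε hp
        linarith
    refine (Finset.sum_le_sum fun x _ => Finset.sum_le_sum fun y _ => h2 x y).trans ?_
    simp only [Finset.sum_add_distrib, Finset.sum_sub_distrib, ← Finset.mul_sum]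
    rw [hprob]
    have h3 : 1 - δ ≤ ∑ x, ∑ y,
        if 2 * √2 - ε ≤ S.correlation ⟨k, hk⟩ x y then S.prob k hk.le x y else 0 := by
      convert h0
    linarith

end Structured

section Ideal

variable {KA : Type u₄} {KB : Type u₅}
  [NormedAddCommGroup KA] [InnerProductSpace ℂ KA] [CompleteSpace KA]
  [NormedAddCommGroup KB] [InnerProductSpace ℂ KB] [CompleteSpace KB]
  (FA : QubitFrame n HA KA) (FB : QubitFrame n HB KB)

/-- The strategy that measures the qubits at the locations along the transcripts `gA` and `gB`. -/
def fixed (gA gB : Hist n) (w : Hilb3 HA HB HC) (hw : ‖w‖ = 1) : Strategy n HA HB HC where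
  ψ := w
  norm_ψ := hw
  alice := FA.fixedReflections gA angleA
  bob := FB.fixedReflections gB angleB

theorem norm_map3_of_isUnitaryMap {HA' HB' : Type*}
    [NormedAddCommGroup HA'] [InnerProductSpace ℂ HA'] [CompleteSpace HA']
    [NormedAddCommGroup HB'] [InnerProductSpace ℂ HB'] [CompleteSpace HB']
    {M : HA →L[ℂ] HA'} {N : HB →L[ℂ] HB'} (hM : IsUnitaryMap M) (hN : IsUnitaryMap N)
    (v : Hilb3 HA HB HC) : ‖map3 HC M N v‖ = ‖v‖ :=
  (map3 HC M N).norm_map_iff_adjoint_comp_self.2 (by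
    rw [adjoint_map3, ← map3_comp, hM.adjoint_comp, hN.adjoint_comp, map3_id]; rfl) v

/-- By `qubitOp_prefix` the fixed qubits of all games are conjugates of the register qubits under
one unitary per prover. It carries the stabilizer relations of w to the registers, where they force
EPR pairs. -/
theorem isIdealVia_fixed {gA gB : Hist n} {w : Hilb3 HA HB HC} (hw : ‖w‖ = 1)
    (h : ∀ (G : Matrix Bool Bool ℂ), G = matX ∨ G = matZ → ∀ k : Fin n,
      aliceHom HA HB HC (FA.qubitOp G k (gA.prefix k)) w =
        bobHom HA HB HC (FB.qubitOp G k (gB.prefix k)) w) :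
    (fixed FA FB gA gB w hw).IsIdealVia (FA.location n le_rfl gA) (FB.location n le_rfl gB) := by
  have hMA := FA.isUnitaryMap_location le_rfl gA
  have hMB := FB.isUnitaryMap_location le_rfl gB
  have hstab : ∀ G, G = matX ∨ G = matZ → ∀ k : Fin n,
      map3 HC (onQubit KA k G) (.id ℂ _)
        (map3 HC (FA.location n le_rfl gA) (FB.location n le_rfl gB) w) =
      map3 HC (.id ℂ _) (onQubit KB k G)
        (map3 HC (FA.location n le_rfl gA) (FB.location n le_rfl gB) w) := by
    intro G hG k
    have := congrArg (map3 HC (FA.location n le_rfl gA) (FB.location n le_rfl gB)) (h G hG k)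
    rwa [aliceHom_apply, bobHom_apply, map3_apply_apply, map3_apply_apply, FA.qubitOp_prefix,
      FB.qubitOp_prefix, comp_conjBy hMA, comp_conjBy hMB, ContinuousLinearMap.comp_id,
      ContinuousLinearMap.comp_id, ← ContinuousLinearMap.id_comp (FB.location n le_rfl gB),
      ← ContinuousLinearMap.id_comp (FA.location n le_rfl gA), map3_comp, map3_comp] at this
  obtain ⟨ψ', hψ', hψ⟩ := exists_eq_eprPairs (hstab matX (Or.inl rfl)) (hstab matZ (Or.inr rfl))
    ((norm_map3_of_isUnitaryMap hMA hMB w).trans hw)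
  exact ⟨AddMonoidHomClass.isometry_of_norm _ hMA.norm_apply,
    AddMonoidHomClass.isometry_of_norm _ hMB.norm_apply, ⟨ψ', hψ', hψ⟩,
    FA.fixedReflections_R idealA_eq gA, FB.fixedReflections_R idealB_eq gB⟩

/-- Since s ≤ 1, lowering the exponent from 1/2 to 1/40 only increases the power of s; afterwards s
is replaced by t. -/
theorem two_mul_le_bound (n : ℕ) {s t : ℝ} (ht : 0 ≤ t) (hs : s = min 1 t) :
    2 * (20 * (n : ℝ) ^ 4 * √s) ≤ 40 * (n : ℝ) ^ (40 : ℝ) * t ^ (1 / (40 : ℝ)) := by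
  have hs0 : 0 ≤ s := hs ▸ le_min zero_le_one ht
  have hs1 : s ≤ 1 := hs ▸ min_le_left _ _
  have hst : s ≤ t := hs ▸ min_le_right _ _
  have h1 : √s ≤ t ^ (1 / (40 : ℝ)) := by
    rw [Real.sqrt_eq_rpow]
    exact (Real.rpow_le_rpow_of_exponent_ge' hs0 hs1 (by norm_num) (by norm_num)).trans
      (Real.rpow_le_rpow hs0 hst (by norm_num))
  have h2 : (n : ℝ) ^ 4 ≤ (n : ℝ) ^ (40 : ℝ) := by
    rw [show (40 : ℝ) = ((40 : ℕ) : ℝ) by norm_num, Real.rpow_natCast]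
    rcases n.eq_zero_or_pos with rfl | hn
    · simp
    · exact pow_le_pow_right₀ (by exact_mod_cast hn) (by norm_num)
  calc 2 * (20 * (n : ℝ) ^ 4 * √s) = 40 * (n : ℝ) ^ 4 * √s := by ring
    _ ≤ _ := by gcongr

/-- A structured multi-qubit ideal strategy is simulated by an ideal strategy whose qubit locations
are those along fixed transcripts. -/
theorem exists_ideal_simulates {δ ε : ℝ} (hδ : 0 ≤ δ) (hε : 0 ≤ ε)
    (hI : S.IsMultiQubitIdeal FA FB) (hS : S.IsStructured δ ε) :
    ∃ (gA gB : Hist n) (T : Strategy n HA HB HC),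
      T.IsIdealVia (FA.location n le_rfl gA) (FB.location n le_rfl gB) ∧
      T.Simulates S (2 * (20 * (n : ℝ) ^ 4 * √(min 1 (δ + ε)))) := by
  have hA : S.alice.Measures FA.tree angleA := hI.1.measures idealA_eq
  have hB : S.bob.Measures FB.tree angleB := hI.2.measures idealB_eq
  -- The main estimate is used with a² = min(1, δ + ε).
  obtain ⟨gA, gB, w, hw, hstab, hsimA, hsimB⟩ := exists_fixed_locations
    (independent_map (HC := HC) FA.tree FB.tree) S.norm_ψ (Real.sqrt_nonneg (min 1 (δ + ε)))
    (fun k hk => by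
      rw [Real.sq_sqrt (le_min zero_le_one (add_nonneg hδ hε))]
      exact hS.sum_one_sub_epr_le hε hA hB hk) abs_cos_angle_sub_le
  refine ⟨gA, gB, fixed FA FB gA gB w hw, isIdealVia_fixed FA FB hw ?_, fun k hk => ⟨?_, ?_⟩⟩
  · rintro G (rfl | rfl) k
    · exact (hstab k k.isLt).1
    · exact (hstab k k.isLt).2
  · rw [playA_eq_rankOne hA, playA_eq_rankOne (S := fixed FA FB gA gB w hw)
      (FA.measures_fixedReflections gA angleA)]
    refine traceNorm_blockDiag_halfScale_le (by positivity) ?_ ?_ (hsimA k hk)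
    · rw [sum_run _ _ hk, S.norm_ψ, one_pow]
    · exact (sum_run _ _ hk _).trans (by rw [Strategy.norm_ψ, one_pow])
  · rw [playB_eq_rankOne hB, playB_eq_rankOne (S := fixed FA FB gA gB w hw)
      (FB.measures_fixedReflections gB angleB)]
    refine traceNorm_blockDiag_halfScale_le (by positivity) ?_ ?_ (hsimB k hk)
    · rw [sum_run _ _ hk, S.norm_ψ, one_pow]
    · exact (sum_run _ _ hk _).trans (by rw [Strategy.norm_ψ, one_pow])

end Ideal

end Strategy

end

end CHSH

theorem theoremt :
    ∃ κ : ℝ, 0 < κ ∧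
      ∀ (n : ℕ)
        (HA : Type u₁) [NormedAddCommGroup HA] [InnerProductSpace ℂ HA] [CompleteSpace HA]
        (HB : Type u₂) [NormedAddCommGroup HB] [InnerProductSpace ℂ HB] [CompleteSpace HB]
        (HC : Type u₃) [NormedAddCommGroup HC] [InnerProductSpace ℂ HC] [CompleteSpace HC]
        (KA : Type u₄) [NormedAddCommGroup KA] [InnerProductSpace ℂ KA] [CompleteSpace KA]
        (KB : Type u₅) [NormedAddCommGroup KB] [InnerProductSpace ℂ KB] [CompleteSpace KB]
        (S : CHSH.Strategy n HA HB HC)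
        (FA : CHSH.QubitFrame n HA KA) (FB : CHSH.QubitFrame n HB KB)
        (δ ε : ℝ), 0 ≤ δ → 0 ≤ ε →
        S.IsMultiQubitIdeal FA FB → S.IsStructured δ ε →
        ∃ (hA hB : CHSH.Hist n) (T : CHSH.Strategy n HA HB HC),
          T.IsIdealVia (FA.location n le_rfl hA) (FB.location n le_rfl hB) ∧
          T.Simulates S (κ * (n : ℝ) ^ κ * (δ + ε) ^ (1 / κ)) := by
  -- The prefactor 2 · 20 dictates 40; as exponents, 40 ≥ 4 and 1/40 ≤ 1/2 are amply sufficient.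
  refine ⟨40, by norm_num, ?_⟩
  intro n HA _ _ _ HB _ _ _ HC _ _ _ KA _ _ _ KB _ _ _ S FA FB δ ε hδ hε hI hS
  obtain ⟨gA, gB, T, hT, hsim⟩ := CHSH.Strategy.exists_ideal_simulates FA FB hδ hε hI hS
  have hle := CHSH.Strategy.two_mul_le_bound n (add_nonneg hδ hε) rfl
  exact ⟨gA, gB, T, hT, fun k hk =>
    ⟨(hsim k hk).1.trans (ENNReal.ofReal_le_ofReal hle),
      (hsim k hk).2.trans (ENNReal.ofReal_le_ofReal hle)⟩⟩
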